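/- **Setting.** Let $D$ be a probability distribution on $\mathcal X\times\{+1,-1\}$ with marginal $D_{\mathcal X}$ and conditional probability $\eta(x)=P(y=+1\mid x)$. For a (randomized) classifier $h$ put $\mathrm{err}(h)=P(h(x)\ne y)$; the *standard excess error* of $h$ is $\mathrm{err}(h)-\mathrm{err}(h^\star)$, where $h^\star(x)=\mathrm{sgn}(2\eta(x)-1)$. An active learner sees i.i.d. points $x_1,x_2,\dots\sim D_{\mathcal X}$ one at a time and, for each, decides from the past points, the past queried labels and the current point whether to query its label $y_t$; after finitely many points it outputs a classifier. Let $\mathcal F$ be a class of measurable functions $\mathcal X\to[0,1]$ with $\eta\in\mathcal F$, and let a regression oracle be given that returns, for every finite labelled sample, a minimizer over $\mathcal F$ of $\sum_t(f(x_t)-\mathbf 1(y_t=+1))^2$. Assume that $\mathcal F$ is pointwise separable (it has a countable subset $\mathcal F_0$ such that each $f\in\mathcal F$ is a pointwise limit of a sequence in $\mathcal F_0$) and that the confidence bounds $\mathrm{lcb},\mathrm{ucb}$ below are jointly measurable in the labelled sample and the point $x$. Let $\mathrm{Pdim}(\mathcal F)$ be the VC dimension of $\{(x,\zeta)\mapsto\mathbf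 1(f(x)>\zeta):f\in\mathcal F\}$ and $$\theta(\gamma)=\sup_{f^\circ\in\mathcal F,\ \iota>0}\ \sup_{\mu}\ \sup_{\gamma'>\gamma/2,\ \epsilon'>\iota}\Big\{\tfrac{\gamma'^2}{\epsilon'^2}\,\mu\big(x:\exists f\in\mathcal F,\ |f(x)-f^\circ(x)|>\gamma',\ \|f-f^\circ\|_{L^2(\mu)}\le\epsilon'\big)\Big\}\vee 1,$$ with $\mu$ ranging over all probability measures on $\mathcal X$. Let $d\ge1$ be an integer with $\mathrm{Pdim}(\mathcal F)\le d$ and let $\theta<\infty$ be a real number with $\theta(\gamma)\le\theta$. **Algorithm 1** with inputs $\epsilon>0$, $\gamma\in(0,\frac12)$, $\delta\in(0,1)$ and absolute constants $C_1,C_2$. Put $T=C_1\frac{\theta d}{\epsilon\gamma}\log\frac{\theta d}{\epsilon\gamma\delta}$, $M=\lceil\log_2T\rceil$, $C_\delta=C_2\,d\log(T/\delta)$, $t_0=0$, $t_m=2^m$ for $m\ge1$, and $\beta_m=(M-m+1)C_\delta$. At the start of epoch $m=1,\dots,M$, let $\hat f_m\in\mathcal F$ be the oracle's minimizer of the square loss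 $\hat R_m(f)$ over the labels queried among $t\le t_{m-1}$, let $\mathcal F_m=\{f\in\mathcal F:\hat R_m(f)\le\hat R_m(\hat f_m)+\beta_m\}$, and let $\mathrm{lcb}_m(x)=\inf_{f\in\mathcal F_m}f(x)$, $\mathrm{ucb}_m(x)=\sup_{f\in\mathcal F_m}f(x)$. The classifier $\hat h_m(x)$ abstains if $[\mathrm{lcb}_m(x),\mathrm{ucb}_m(x)]\subseteq[\frac12-\gamma,\frac12+\gamma]$; otherwise $\hat h_m(x)=\mathrm{sgn}(2\hat f_m(x)-1)$, where a tie $\hat f_m(x)=\frac12$ is resolved as $-1$ if $\mathrm{ucb}_m(x)\le\frac12$ and as $+1$ otherwise. For $m<M$, at the times $t_{m-1}<t\le t_m$ the label of $x_t$ is queried if and only if $\frac12\in(\mathrm{lcb}_m(x_t),\mathrm{ucb}_m(x_t))$ and $\hat h_m$ does not abstain at $x_t$. At $m=M$ the algorithm stops with $\hat h_M$. Let $\check h$ be the classifier that equals $\hat h_M$ where $\hat h_M$ does not abstain and predicts $+1$ or $-1$ with probability $\frac12$ each where it does. **Theorem.** There are absolute constants $C_1,C_2,C_3,c_0>0$ such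 that the following holds for all $\mathcal X,D,\mathcal F,d,\theta$ as above and all $\epsilon,\delta\in(0,1)$. 1. *Massart noise.* Suppose $\tau_0>0$ and $P(|\eta(x)-\frac12|\le\tau_0)=0$ (so that $\tau_0<\frac12$). Run with accuracy $\epsilon$ and $\gamma=\tau_0$, with probability at least $1-2\delta$ Algorithm 1 yields $\check h$ with standard excess error at most $\epsilon$ and queries at most $$C_3\,\frac{\theta d}{\tau_0^{2}}\,\log^2\!\Big(\frac{\theta d}{\epsilon\tau_0}\Big)\log\!\Big(\frac{\theta d}{\epsilon\tau_0\delta}\Big)=\tilde O(\tau_0^{-2})\quad\text{labels.}$$ 2. *Tsybakov noise.* Suppose $\beta\ge0$, $c>0$ and $P(|\eta(x)-\frac12|\le\tau)\le c\,\tau^\beta$ for all $\tau>0$. Run with accuracy $\epsilon/2$ and $\gamma=(\epsilon/(2c))^{1/(1+\beta)}$ (which lies in $(0,\frac12)$), with probability at least $1-2\delta$ Algorithm 1 yields $\check h$ with standard excess error at most $\epsilon$ and queries at most $$C_3\,\theta d\,\Big(\frac{2c}{\epsilon}\Big)^{\frac{2}{1+\beta}}\log^2\!\Big(\frac{\theta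 d}{\epsilon\gamma}\Big)\log\!\Big(\frac{\theta d}{\epsilon\gamma\delta}\Big)=\tilde O\big(\epsilon^{-2/(1+\beta)}\big)\quad\text{labels.}$$ 3. *These rates are minimax optimal up to the logarithmic factors.* For all $0<\epsilon\le\tau_0<\frac12$ there are $\mathcal X$ and a class $\mathcal F$ as above with $\mathrm{Pdim}(\mathcal F)\le1$ and $\theta(\gamma)\le1$ for all $\gamma>0$ such that every (possibly randomized) active learner which, for every $D$ with $\eta\in\mathcal F$ satisfying the Massart condition with parameter $\tau_0$, attains standard excess error at most $\epsilon$ with at most $n$ label queries with probability at least $\frac34$, has $n\ge c_0\,\tau_0^{-2}$. For all $\beta\ge0$, $c\ge2^\beta$ (without which no distribution satisfies the Tsybakov condition) and $0<\epsilon\le\frac14$ the same holds with the Tsybakov condition with parameters $\beta,c$ and with $n\ge c_0\,\epsilon^{-2/(1+\beta)}$. -/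

import Mathlib

open MeasureTheory

universe u v

noncomputable section

namespace ActiveLearning

/-! Labels are encoded by `Bool`: `true` is the label +1 and `false` is the label -1. -/

/-! ### Distributions, classifiers and standard error -/

/-- `η` is a version of the conditional probability `x ↦ P(y = +1 | x)` under `D`. -/
def IsCondProb {X : Type u} [MeasurableSpace X] (D : Measure (X × Bool)) (η : X → ℝ) : Prop :=
  Measurable η ∧ ∀ A : Set X, MeasurableSet A →
    D (A ×ˢ {true}) = ∫⁻ x in A, ENNReal.ofReal (η x) ∂D.fst

/-- Massart noise: `P(|η(x) - 1/2| ≤ τ₀) = 0`. -/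
def Massart {X : Type u} [MeasurableSpace X] (D : Measure (X × Bool)) (η : X → ℝ)
    (τ₀ : ℝ) : Prop :=
  0 < τ₀ ∧ D.fst {x | |η x - 1 / 2| ≤ τ₀} = 0

/-- Tsybakov noise: `P(|η(x) - 1/2| ≤ τ) ≤ c τ ^ β` for every `τ > 0`. -/
def Tsybakov {X : Type u} [MeasurableSpace X] (D : Measure (X × Bool)) (η : X → ℝ)
    (β c : ℝ) : Prop :=
  0 ≤ β ∧ 0 < c ∧ ∀ τ : ℝ, 0 < τ → D.fst {x | |η x - 1 / 2| ≤ τ} ≤ ENNReal.ofReal (c * τ ^ β)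

/-- A randomized classifier: `p x` is the probability with which +1 is predicted at `x`. -/
abbrev RandClassifier (X : Type u) := X → unitInterval

/-- Standard error: the probability, over `(x, y) ∼ D` and over the classifier's own
randomization, that the prediction differs from `y`. -/
def err {X : Type u} [MeasurableSpace X] (D : Measure (X × Bool)) (p : RandClassifier X) : ℝ :=
  ∫ z, (if z.2 then 1 - (p z.1 : ℝ) else (p z.1 : ℝ)) ∂D

open Classical in
/-- The classifier `h_f(x) = sgn(2 f(x) - 1)`. -/
def plugIn {X : Type u} (f : X → ℝ) : RandClassifier X :=
  fun x => if 0 ≤ 2 * f x - 1 then 1 else 0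

/-- Standard excess error over the Bayes classifier `h_η`. -/
def excess {X : Type u} [MeasurableSpace X] (D : Measure (X × Bool)) (η : X → ℝ)
    (p : RandClassifier X) : ℝ :=
  err D p - err D (plugIn η)

/-- Randomization over the abstention region: an abstaining classifier `h` (with `none` as the
action of abstaining) becomes the classifier that predicts `h x` where `h` does not abstain, and
+1 or -1 with equal probability where it does. -/
def randomize {X : Type u} (h : X → Option Bool) : RandClassifier X := fun x =>
  match h x with
  | some true => 1
  | some false => 0
  | none => ⟨1 / 2, by norm_num, by norm_num⟩

/-! ### Complexity measures of a class of regression functions -/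

/-- `S` is shattered by the threshold functions `(x, ζ) ↦ 1(f(x) > ζ)`, `f ∈ F`. -/
def PseudoShatters {X : Type u} (F : Set (X → ℝ)) (S : Finset (X × ℝ)) : Prop :=
  ∀ T : Finset (X × ℝ), T ⊆ S → ∃ f ∈ F, ∀ q ∈ S, (f q.1 > q.2 ↔ q ∈ T)

/-- The pseudo-dimension. -/
def pdim {X : Type u} (F : Set (X → ℝ)) : ℕ∞ :=
  ⨆ (S : Finset (X × ℝ)) (_ : PseudoShatters F S), (S.card : ℕ∞)

/-- The value function disagreement coefficient of `F` at `fs`, at scales `γ₀` and `ε₀`. -/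
def disagreementCoeff {X : Type u} [MeasurableSpace X] (F : Set (X → ℝ)) (fs : X → ℝ)
    (γ₀ ε₀ : ℝ) : ENNReal :=
  (⨆ (μ : Measure X) (_ : IsProbabilityMeasure μ) (γ : ℝ) (_ : γ₀ < γ) (ε : ℝ) (_ : ε₀ < ε),
    ENNReal.ofReal (γ ^ 2 / ε ^ 2) *
      μ {x | ∃ f ∈ F, |f x - fs x| > γ ∧ Real.sqrt (∫ x', (f x' - fs x') ^ 2 ∂μ) ≤ ε}) ⊔ 1

/-- `θ`, the supremum of the disagreement coefficients at `γ / 2` over all `fs ∈ F`, `ι > 0`. -/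
def theta {X : Type u} [MeasurableSpace X] (F : Set (X → ℝ)) (γ : ℝ) : ENNReal :=
  ⨆ fs ∈ F, ⨆ (ι : ℝ) (_ : 0 < ι), disagreementCoeff F fs (γ / 2) ι

/-! ### Stream-based active learners

A history lists the points observed so far; a point comes with its label exactly if the label was
queried. -/

/-- A history of observed points and queried labels. -/
abbrev History (X : Type u) := List (X × Option Bool)

/-- A (deterministic) active learner: from the history and the current point it decides whether
to query the label of this point, and after `horizon` points it outputs a classifier. -/
structure ActiveLearner (X : Type u) where
  horizon : ℕ
  query : History X → X → Prop
  output : History X → RandClassifier X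

open Classical in
/-- The history after `t` points, when the stream is `ω`. -/
def ActiveLearner.history {X : Type u} (A : ActiveLearner X) (ω : ℕ → X × Bool) : ℕ → History X
  | 0 => []
  | t + 1 => A.history ω t ++
      [((ω t).1, if A.query (A.history ω t) (ω t).1 then some (ω t).2 else none)]

/-- The classifier learned from the stream `ω`. -/
def ActiveLearner.learned {X : Type u} (A : ActiveLearner X) (ω : ℕ → X × Bool) :
    RandClassifier X :=
  A.output (A.history ω A.horizon)

/-- The number of labels queried on the stream `ω`. -/
def ActiveLearner.labels {X : Type u} (A : ActiveLearner X) (ω : ℕ → X × Bool) : ℕ :=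
  (A.history ω A.horizon).countP (fun z => z.2.isSome)

/-- On the stream `ω`, the learner outputs a classifier with standard excess error at most `ε`
after at most `n` label queries. -/
def ActiveLearner.Succeeds {X : Type u} [MeasurableSpace X] (A : ActiveLearner X)
    (D : Measure (X × Bool)) (η : X → ℝ) (ε n : ℝ) (ω : ℕ → X × Bool) : Prop :=
  Measurable (A.learned ω) ∧ excess D η (A.learned ω) ≤ ε ∧ (A.labels ω : ℝ) ≤ n

/-- On an i.i.d. stream from `D`, the learner succeeds with probability at least `p`. -/
def ActiveLearner.SucceedsWithProb {X : Type u} [MeasurableSpace X] (A : ActiveLearner X)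
    (D : Measure (X × Bool)) [IsProbabilityMeasure D] (η : X → ℝ) (ε n p : ℝ) : Prop :=
  ∃ E : Set (ℕ → X × Bool), MeasurableSet E ∧
    ENNReal.ofReal p ≤ Measure.infinitePi (fun _ : ℕ => D) E ∧
    ∀ ω ∈ E, A.Succeeds D η ε n ω

/-- The same for a learner with internal randomness: `A s` is the learner on the seed `s ∼ ν`,
drawn independently of the stream. -/
def RandLearnerSucceedsWithProb {X : Type u} [MeasurableSpace X] {U : Type v} [MeasurableSpace U]
    (ν : Measure U) (A : U → ActiveLearner X)
    (D : Measure (X × Bool)) [IsProbabilityMeasure D] (η : X → ℝ) (ε n p : ℝ) : Prop :=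
  ∃ E : Set (U × (ℕ → X × Bool)), MeasurableSet E ∧
    ENNReal.ofReal p ≤ (ν.prod (Measure.infinitePi (fun _ : ℕ => D))) E ∧
    ∀ q ∈ E, (A q.1).Succeeds D η ε n q.2

/-! ### Least squares, active sets and confidence bounds -/

/-- The sum of `Q_t (f(x_t) - y_t) ^ 2` along a history; here the label +1 counts as the number
1 and the label -1 as the number 0, so that `f(x)` predicts the conditional mean of `y`. -/
def sqLoss {X : Type u} (S : History X) (f : X → ℝ) : ℝ :=
  (S.map fun z => match z.2 with
    | some y => (f z.1 - (if y then 1 else 0)) ^ 2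
    | none => 0).sum

/-- `O` is a regression oracle for `F`: it returns a minimizer in `F` of the square loss. -/
def IsRegressionOracle {X : Type u} (F : Set (X → ℝ)) (O : History X → X → ℝ) : Prop :=
  ∀ S, O S ∈ F ∧ ∀ f ∈ F, sqLoss S (O S) ≤ sqLoss S f

/-- The functions of `F` whose loss is within `b` of the loss of the oracle's answer. -/
def activeSet {X : Type u} (F : Set (X → ℝ)) (O : History X → X → ℝ) (S : History X) (b : ℝ) :
    Set (X → ℝ) :=
  {f ∈ F | sqLoss S f ≤ sqLoss S (O S) + b}

/-- Lower confidence bound `inf_{f ∈ G} f(x)`. -/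
def lcb {X : Type u} (G : Set (X → ℝ)) (x : X) : ℝ := sInf ((fun f => f x) '' G)

/-- Upper confidence bound `sup_{f ∈ G} f(x)`. -/
def ucb {X : Type u} (G : Set (X → ℝ)) (x : X) : ℝ := sSup ((fun f => f x) '' G)

/-- A labelled sample as a history. -/
def labelled {X : Type u} {n : ℕ} (z : Fin n → X × Bool) : History X :=
  List.ofFn fun i => ((z i).1, some (z i).2)

/-- Standing regularity of a class `F` of regression functions with regression oracle `O`. -/
structure IsRegressionClass {X : Type u} [MeasurableSpace X] (F : Set (X → ℝ))
    (O : History X → X → ℝ) : Prop where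
  /-- values in `[0, 1]` -/
  mem_Icc : ∀ f ∈ F, ∀ x, f x ∈ Set.Icc (0 : ℝ) 1
  /-- `O` is a regression oracle for `F` -/
  oracle : IsRegressionOracle F O
  /-- the regression functions are measurable -/
  measurable : ∀ f ∈ F, Measurable f
  /-- `F` is pointwise separable -/
  separable : ∃ F₀ ⊆ F, F₀.Countable ∧ ∀ f ∈ F, ∃ g : ℕ → X → ℝ,
    (∀ k, g k ∈ F₀) ∧ ∀ x, Filter.Tendsto (fun k => g k x) Filter.atTop (nhds (f x))
  /-- lower confidence bounds are measurable in the labelled sample and the point -/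
  measurable_lcb : ∀ (n : ℕ) (b : ℝ), 0 ≤ b →
    Measurable fun q : (Fin n → X × Bool) × X => lcb (activeSet F O (labelled q.1) b) q.2
  /-- upper confidence bounds are measurable in the labelled sample and the point -/
  measurable_ucb : ∀ (n : ℕ) (b : ℝ), 0 ≤ b →
    Measurable fun q : (Fin n → X × Bool) × X => ucb (activeSet F O (labelled q.1) b) q.2

/-! ### The algorithm -/

/-- Epoch ends: `0` for `m = 0` and `2 ^ m` for `m ≥ 1`. -/
def epochEnd (m : ℕ) : ℕ := if m = 0 then 0 else 2 ^ m

/-- The epoch of the `(t + 1)`-st point of the stream; see `epoch_spec`. -/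
def epoch (t : ℕ) : ℕ := Nat.log 2 t + 1

theorem epoch_spec (t : ℕ) : epochEnd (epoch t - 1) ≤ t ∧ t < epochEnd (epoch t) := by
  unfold epochEnd epoch
  refine ⟨?_, ?_⟩
  · split_ifs with h
    · exact Nat.zero_le _
    · simp only [Nat.add_sub_cancel] at h ⊢
      exact Nat.pow_log_le_self 2 (fun h0 => h (by simp [h0]))
  · simpa using Nat.lt_pow_succ_log_self (b := 2) (by norm_num) t

/-- Parameters of the algorithm: `d` and `θ` are (upper bounds on) the pseudo-dimension and the
disagreement coefficient, `ε` the accuracy, `γ` the abstention parameter, `δ` the confidence;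
`C₁` and `C₂` are the absolute constants in the definitions of `T` and `C_δ`. -/
structure Params where
  C₁ : ℝ
  C₂ : ℝ
  d : ℕ
  θ : ℝ
  ε : ℝ
  γ : ℝ
  δ : ℝ

namespace Params

/-- `T = C₁ (θ d / (ε γ)) log (θ d / (ε γ δ))`. -/
def T (P : Params) : ℝ :=
  P.C₁ * (P.θ * P.d / (P.ε * P.γ)) * Real.log (P.θ * P.d / (P.ε * P.γ * P.δ))

/-- The number of epochs, `⌈log₂ T⌉`. -/
def M (P : Params) : ℕ := ⌈Real.logb 2 P.T⌉₊

/-- `C_δ = C₂ d log (T / δ)`. -/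
def Cδ (P : Params) : ℝ := P.C₂ * P.d * Real.log (P.T / P.δ)

/-- `β_m = (M - m + 1) C_δ`. -/
def β (P : Params) (m : ℕ) : ℝ := ((P.M : ℝ) - m + 1) * P.Cδ

end Params

section Algorithm

variable {X : Type u} (F : Set (X → ℝ)) (O : History X → X → ℝ) (P : Params)

/-- The part of the history that precedes epoch `m`. -/
def past (m : ℕ) (H : History X) : History X := H.take (epochEnd (m - 1))

/-- The active set `F_m`. -/
def activeSetAt (m : ℕ) (H : History X) : Set (X → ℝ) := activeSet F O (past m H) (P.β m)

open Classical in
/-- The abstaining classifier of epoch `m`. It predicts the sign of `2 f(x) - 1` for the least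
squares solution `f`; at a tie `f(x) = 1/2` it predicts -1 if the upper confidence bound is at
most 1/2, and +1 otherwise. -/
def classifierAt (m : ℕ) (H : History X) (x : X) : Option Bool :=
  if Set.Icc (lcb (activeSetAt F O P m H) x) (ucb (activeSetAt F O P m H) x) ⊆
      Set.Icc (1 / 2 - P.γ) (1 / 2 + P.γ) then none
  else some (decide (0 < 2 * O (past m H) x - 1 ∨
    (2 * O (past m H) x - 1 = 0 ∧ 1 / 2 < ucb (activeSetAt F O P m H) x)))

/-- The query rule of epoch `m`. -/
def queryAt (m : ℕ) (H : History X) (x : X) : Prop :=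
  (1 / 2 : ℝ) ∈ Set.Ioo (lcb (activeSetAt F O P m H) x) (ucb (activeSetAt F O P m H) x) ∧
    classifierAt F O P m H x ≠ none

/-- The epoch-based active learner with abstention, followed by randomization over the abstention
region of the classifier of the last epoch `M`. Sampling takes place in epochs `1, …, M - 1`. -/
def algorithm : ActiveLearner X where
  horizon := epochEnd (P.M - 1)
  query := fun H x => queryAt F O P (epoch H.length) H x
  output := fun H => randomize (classifierAt F O P P.M H)

end Algorithm

end ActiveLearning

end

open ActiveLearning

namespace ActiveLearning

/-! ### Finite covers from the pseudo-dimension -/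

/-! Upper bounds. Everything is deterministic on a stream where three kinds of events hold with
slack `K = Cδ / 8`: the label noise is controlled between any two epoch starts, the population
squared distance to `η` on each query region is bounded by its empirical counterpart, and each
epoch's label count is bounded by its mean. On such a stream the excess square loss of `f` over `η`
is at least half the queried squared distance minus `2 K`. Hence `η` stays active, and because `β`
drops by `Cδ` per epoch the active sets, and with them the query regions, are nested. A function
active in epoch `m + 1` is therefore close to `η` in mean square on the region of epoch `m`.

Each point of a query region is separated by more than `γ / 2` from `η` by an active function.
Applying the disagreement coefficient to the marginal conditioned on the region turns mean-square
closeness into small probability of the region, about `θ β / (γ² 2^m)`. Multiplied by the epoch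
length this bounds the labels of one epoch. Off the last region a prediction without abstention
agrees with Bayes except where `η = 1/2`. On the region the regret is at most `2 |f - η|`, and
abstention costs at most `γ`, only where `|η - 1/2| ≤ γ`. The noise condition makes this last
contribution zero (Massart) or `ε / 2` (Tsybakov).

The uniform bounds over `F` (`lintegral_iSup_noise_le`, `lintegral_iSup_deviation_le`) share one
mechanism, `lintegral_iSup_supermartingale_le`. The law of the stream is invariant under a
randomized move that keeps the observed points: redrawing a label given its point, or swapping a
point with its ghost copy. With the points frozen, the supremum is replaced by a sum over a finite
cover from Sauer-Shelah, and each summand is an exponential supermartingale under the moves.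

Lower bounds. Two regression functions on two points differ only in the sign of a bias `a` at one
point. A Bhattacharyya-type inequality, carried through the observations (`Separated.step`), loses a
factor `√(1 - 4 a²)` per queried label, so telling the two apart takes order `a⁻²` labels. The bias
and the mass of the ambiguous point are tuned to the noise condition. -/

theorem sum_choose_le_succ_pow (n d : ℕ) :
    ∑ k ∈ Finset.Iic d, n.choose k ≤ (n + 1) ^ d := by
  have hI : Finset.Iic d = Finset.range (d + 1) := by ext; simp
  rw [hI, add_pow]
  refine Finset.sum_le_sum fun k hk => ?_
  have h1 : 1 ≤ d.choose k := Nat.choose_pos (by simpa using hk)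
  calc n.choose k ≤ n ^ k := Nat.choose_le_pow n k
    _ ≤ n ^ k * 1 ^ (d - k) * d.choose k := by simpa using Nat.le_mul_of_pos_right _ h1

theorem pdim_mono {X : Type u} {F G : Set (X → ℝ)} (h : F ⊆ G) : pdim F ≤ pdim G := by
  refine iSup₂_le fun S hS => le_iSup₂_of_le S (fun T hT => ?_) le_rfl
  obtain ⟨f, hf, h'⟩ := hS T hT
  exact ⟨f, h hf, h'⟩

-- Sauer-Shelah: a set of sign patterns on `Γ` that is shattered by the traces is pseudo-shattered
-- by `F`, so the traces have VC dimension at most `d` and are polynomially many. One representative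
-- per trace is kept.
open Classical in
theorem exists_finite_trace_cover {X : Type u} {F : Set (X → ℝ)} {d : ℕ} (hd : pdim F ≤ d)
    (Γ : Finset (X × ℝ)) :
    ∃ G : Finset (X → ℝ), ↑G ⊆ F ∧ G.card ≤ (Γ.card + 1) ^ d ∧
      ∀ f ∈ F, ∃ g ∈ G, ∀ q ∈ Γ, f q.1 > q.2 ↔ g q.1 > q.2 := by
  set tr : (X → ℝ) → Finset Γ := fun f => Finset.univ.filter fun q => f q.1.1 > q.1.2 with htr
  set 𝒜 : Finset (Finset Γ) := Finset.univ.filter fun A => ∃ f ∈ F, tr f = A with h𝒜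
  have hrep : ∀ A : Finset Γ, ∃ f : X → ℝ, A ∈ 𝒜 → f ∈ F ∧ tr f = A := by
    intro A
    by_cases hA : A ∈ 𝒜
    · obtain ⟨f, hf, h⟩ := (Finset.mem_filter.1 hA).2
      exact ⟨f, fun _ => ⟨hf, h⟩⟩
    · exact ⟨fun _ => 0, fun h => absurd h hA⟩
  choose r hr using hrep
  have hvc : 𝒜.vcDim ≤ d := by
    refine Finset.sup_le fun t ht => ?_
    have hsh := Finset.mem_shatterer.1 ht
    have hps : PseudoShatters F (t.map (Function.Embedding.subtype _)) := by
      intro T hT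
      obtain ⟨u, hu, hut⟩ := hsh (t := t.filter fun q => q.1 ∈ T) (Finset.filter_subset _ _)
      obtain ⟨f, hf, hfu⟩ := (Finset.mem_filter.1 hu).2
      refine ⟨f, hf, fun q hq => ?_⟩
      obtain ⟨q', hq', rfl⟩ := Finset.mem_map.1 hq
      have h1 : q' ∈ t ∩ u ↔ q' ∈ t.filter fun q => q.1 ∈ T := by rw [hut]
      simp only [Finset.mem_inter, hq', true_and, Finset.mem_filter, ← hfu, htr,
        Finset.mem_univ] at h1
      simpa using h1
    have h2 : ((t.map (Function.Embedding.subtype _)).card : ℕ∞) ≤ pdim F :=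
      le_iSup₂_of_le (f := fun (S : Finset (X × ℝ)) (_ : PseudoShatters F S) => (S.card : ℕ∞))
        _ hps le_rfl
    rw [Finset.card_map] at h2
    exact_mod_cast h2.trans hd
  refine ⟨𝒜.image r, ?_, ?_, ?_⟩
  · intro f hf
    obtain ⟨A, hA, rfl⟩ := Finset.mem_image.1 (Finset.mem_coe.1 hf)
    exact (hr A hA).1
  · calc (𝒜.image r).card ≤ 𝒜.card := Finset.card_image_le
      _ ≤ 𝒜.shatterer.card := Finset.card_le_card_shatterer 𝒜
      _ ≤ ∑ k ∈ Finset.Iic 𝒜.vcDim, (Fintype.card Γ).choose k :=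
        Finset.card_shatterer_le_sum_vcDim
      _ ≤ (Fintype.card Γ + 1) ^ 𝒜.vcDim := sum_choose_le_succ_pow _ _
      _ ≤ (Γ.card + 1) ^ d := by
        rw [Fintype.card_coe]
        exact Nat.pow_le_pow_right (Nat.succ_pos _) hvc
  · intro f hf
    have hA : tr f ∈ 𝒜 := by simp [h𝒜]; exact ⟨f, hf, rfl⟩
    refine ⟨r (tr f), Finset.mem_image_of_mem _ hA, fun q hq => ?_⟩
    have h1 : (⟨q, hq⟩ : Γ) ∈ tr (r (tr f)) ↔ (⟨q, hq⟩ : Γ) ∈ tr f := by rw [(hr _ hA).2]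
    simp only [htr, Finset.mem_filter, Finset.mem_univ, true_and] at h1
    exact h1.symm

open Classical in
/-- A class of pseudo-dimension at most `d` has a small cover in the supremum norm over any finite
set of points. -/
theorem exists_finite_cover {X : Type u} {F : Set (X → ℝ)} {d : ℕ}
    (hF : ∀ f ∈ F, ∀ x, f x ∈ Set.Icc (0 : ℝ) 1) (hd : pdim F ≤ d) (s : Finset X) {K : ℕ}
    (hK : 0 < K) :
    ∃ G : Finset (X → ℝ), ↑G ⊆ F ∧ G.card ≤ (s.card * (K + 1) + 1) ^ d ∧
      ∀ f ∈ F, ∃ g ∈ G, ∀ x ∈ s, |f x - g x| ≤ 1 / K := by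
  have hK' : (0 : ℝ) < K := by exact_mod_cast hK
  set Γ : Finset (X × ℝ) := s ×ˢ ((Finset.range (K + 1)).image fun j : ℕ => (j : ℝ) / K)
  obtain ⟨G, hG, hc, hcov⟩ := exists_finite_trace_cover hd Γ
  refine ⟨G, hG, hc.trans (Nat.pow_le_pow_left (Nat.succ_le_succ ?_) d), fun f hf => ?_⟩
  · rw [Finset.card_product]
    exact Nat.mul_le_mul_left _ (Finset.card_image_le.trans (by simp))
  obtain ⟨g, hg, h⟩ := hcov f hf
  refine ⟨g, hg, fun x hx => ?_⟩
  have key : ∀ a b : X → ℝ, a ∈ F → b ∈ F → (∀ q ∈ Γ, a q.1 > q.2 → b q.1 > q.2) →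
      a x - b x ≤ 1 / K := by
    intro a b ha hb hab
    by_contra! hlt
    -- If `a x` exceeds `b x` by more than `1 / K`, the grid threshold obtained by rounding `b x` up
    -- lies in `[b x, a x)`, so the traces differ there. It belongs to the grid since `b x ≤ 1`.
    set j := ⌈K * b x⌉₊
    have hb0 : 0 ≤ (K : ℝ) * b x := mul_nonneg hK'.le (hF b hb x).1
    have hj1 : (K : ℝ) * b x ≤ j := Nat.le_ceil _
    have hj2 : (j : ℝ) < K * b x + 1 := Nat.ceil_lt_add_one hb0
    have hjK : j ≤ K := Nat.ceil_le.2 (by nlinarith [(hF b hb x).2])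
    have hq : (x, (j : ℝ) / K) ∈ Γ := by
      refine Finset.mem_product.2 ⟨hx, Finset.mem_image.2 ⟨j, ?_, rfl⟩⟩
      simpa [Nat.lt_succ_iff] using hjK
    have h1 : a x > (j : ℝ) / K := by
      rw [gt_iff_lt, div_lt_iff₀ hK']
      rw [div_lt_iff₀ hK'] at hlt
      nlinarith
    have h2 := hab _ hq h1
    rw [gt_iff_lt, div_lt_iff₀ hK'] at h2
    simp only at h2
    nlinarith
  rw [abs_le]
  have h1 := key f g hf (hG hg) fun q hq => (h q hq).1
  have h2 := key g f (hG hg) hf fun q hq => (h q hq).2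
  constructor <;> linarith

/-! ### Invariance properties of the law of an i.i.d. stream -/

section Stream

variable {Z : Type u} [MeasurableSpace Z]

/-- The law of an i.i.d. stream from `D`. -/
noncomputable abbrev streamLaw (D : Measure Z) : Measure (ℕ → Z) :=
  Measure.infinitePi fun _ : ℕ => D

/-- The stream that follows `ω` up to time `a` and continues with `ω'`. -/
def glue (a : ℕ) (ω ω' : ℕ → Z) : ℕ → Z := fun t => if t < a then ω t else ω' (t - a)

theorem measurable_glue (a : ℕ) : Measurable fun p : (ℕ → Z) × (ℕ → Z) => glue a p.1 p.2 := by
  refine measurable_pi_lambda _ fun t => ?_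
  unfold glue
  split_ifs <;> fun_prop

theorem measurable_update_stream (k : ℕ) :
    Measurable fun p : Z × (ℕ → Z) => Function.update p.2 k p.1 := by
  refine measurable_pi_lambda _ fun t => ?_
  by_cases h : t = k
  · subst h; simpa using measurable_fst
  · simp only [Function.update_of_ne h]; fun_prop

theorem measurable_reindex (e : ℕ → ℕ) : Measurable fun ω : ℕ → Z => fun t => ω (e t) :=
  measurable_pi_lambda _ fun _ => measurable_pi_apply _

variable (D : Measure Z) [IsProbabilityMeasure D]

/-- The future of an i.i.d. stream is a fresh stream independent of its past. This is used to
condition on everything before an epoch, which fixes the query region, and to create a ghost sample.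
-/
theorem map_glue (a : ℕ) :
    ((streamLaw D).prod (streamLaw D)).map (fun p => glue a p.1 p.2) = streamLaw D := by
  classical
  refine Measure.eq_infinitePi _ fun s t ht => ?_
  have hpre : (fun p : (ℕ → Z) × (ℕ → Z) => glue a p.1 p.2) ⁻¹' (Set.pi s t) =
      (Set.pi (s.filter (· < a)) t) ×ˢ
        (Set.pi ((s.filter (¬ · < a)).image (· - a)) fun i => t (i + a)) := by
    ext ⟨ω, ω'⟩
    simp only [Set.mem_preimage, Set.mem_pi, Set.mem_prod, Finset.mem_coe, Finset.mem_filter,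
      Finset.mem_image, glue, not_lt]
    constructor
    · intro h
      refine ⟨fun i hi => by simpa [hi.2] using h i hi.1, ?_⟩
      rintro _ ⟨i, hi, rfl⟩
      have := h i hi.1
      rw [Nat.sub_add_cancel hi.2]
      rwa [if_neg (not_lt.2 hi.2)] at this
    · rintro ⟨h1, h2⟩ i hi
      split_ifs with hia
      · exact h1 i ⟨hi, hia⟩
      · have := h2 (i - a) ⟨i, ⟨hi, not_lt.1 hia⟩, rfl⟩
        rwa [Nat.sub_add_cancel (not_lt.1 hia)] at this
  rw [Measure.map_apply (measurable_glue a) (MeasurableSet.pi s.countable_toSet fun i _ => ht i),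
    hpre, Measure.prod_prod, Measure.infinitePi_pi _ fun i _ => ht i,
    Measure.infinitePi_pi _ fun i _ => ht _, Finset.prod_image, ← Finset.prod_filter_mul_prod_filter_not s (· < a)]
  · congr 1
    refine Finset.prod_congr rfl fun i hi => ?_
    rw [Nat.sub_add_cancel (not_lt.1 (Finset.mem_filter.1 hi).2)]
  · intro i hi j hj hij
    have hi' := not_lt.1 (Finset.mem_filter.1 hi).2
    have hj' := not_lt.1 (Finset.mem_filter.1 hj).2
    simp only at hij
    omega

theorem lintegral_glue (a : ℕ) {Φ : (ℕ → Z) → ENNReal} (hΦ : Measurable Φ) :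
    ∫⁻ ω, Φ ω ∂(streamLaw D) =
      ∫⁻ ω, ∫⁻ ω', Φ (glue a ω ω') ∂(streamLaw D) ∂(streamLaw D) := by
  conv_lhs => rw [← map_glue D a]
  rw [lintegral_map hΦ (measurable_glue a)]
  exact lintegral_prod _ (hΦ.comp (measurable_glue a)).aemeasurable

theorem map_update (k : ℕ) :
    (D.prod (streamLaw D)).map (fun p => Function.update p.2 k p.1) = streamLaw D := by
  classical
  refine Measure.eq_infinitePi _ fun s t ht => ?_
  have hpre : (fun p : Z × (ℕ → Z) => Function.update p.2 k p.1) ⁻¹' (Set.pi s t) =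
      (if k ∈ s then t k else Set.univ) ×ˢ (Set.pi (s.erase k) t) := by
    ext ⟨z, ω⟩
    simp only [Set.mem_preimage, Set.mem_pi, Set.mem_prod, Finset.mem_coe, Finset.mem_erase]
    constructor
    · intro h
      refine ⟨?_, fun i hi => by simpa [Function.update_of_ne hi.1] using h i hi.2⟩
      split_ifs with hk
      · simpa using h k hk
      · trivial
    · rintro ⟨h1, h2⟩ i hi
      by_cases hik : i = k
      · subst hik; simpa [hi] using h1
      · simpa [Function.update_of_ne hik] using h2 i ⟨hik, hi⟩
  rw [Measure.map_apply (measurable_update_stream k)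
      (MeasurableSet.pi s.countable_toSet fun i _ => ht i),
    hpre, Measure.prod_prod, Measure.infinitePi_pi _ fun i _ => ht i]
  split_ifs with hk
  · rw [Finset.mul_prod_erase s (fun i => D (t i)) hk]
  · rw [measure_univ, one_mul, Finset.erase_eq_of_notMem hk]

theorem lintegral_update (k : ℕ) {Φ : (ℕ → Z) → ENNReal} (hΦ : Measurable Φ) :
    ∫⁻ ω, Φ ω ∂(streamLaw D) =
      ∫⁻ ω, ∫⁻ z, Φ (Function.update ω k z) ∂D ∂(streamLaw D) := by
  conv_lhs => rw [← map_update D k]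
  rw [lintegral_map hΦ (measurable_update_stream k)]
  exact lintegral_prod_symm _ (hΦ.comp (measurable_update_stream k)).aemeasurable

theorem map_reindex (e : ℕ ≃ ℕ) :
    (streamLaw D).map (fun ω t => ω (e t)) = streamLaw D := by
  classical
  refine Measure.eq_infinitePi _ fun s t ht => ?_
  have hpre : (fun (ω : ℕ → Z) t => ω (e t)) ⁻¹' (Set.pi s t) =
      Set.pi (s.map e.toEmbedding) fun i => t (e.symm i) := by
    ext ω
    simp only [Set.mem_preimage, Set.mem_pi, Finset.mem_coe, Finset.mem_map_equiv]
    exact ⟨fun h i hi => by simpa using h _ hi, fun h i hi => by simpa using h (e i) (by simpa)⟩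
  rw [Measure.map_apply (measurable_reindex e)
      (MeasurableSet.pi s.countable_toSet fun i _ => ht i),
    hpre, Measure.infinitePi_pi _ fun i _ => ht _, Finset.prod_map]
  simp

theorem lintegral_reindex (e : ℕ ≃ ℕ) {Φ : (ℕ → Z) → ENNReal} (hΦ : Measurable Φ) :
    ∫⁻ ω, Φ (fun t => ω (e t)) ∂(streamLaw D) = ∫⁻ ω, Φ ω ∂(streamLaw D) := by
  conv_rhs => rw [← map_reindex D e]
  rw [lintegral_map hΦ (measurable_reindex e)]

theorem map_eval_streamLaw (k : ℕ) : (streamLaw D).map (fun ω => ω k) = D :=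
  Measure.infinitePi_map_eval (fun _ : ℕ => D) k

end Stream

/-! ### Suprema of exponential supermartingales under resampling -/

section Branch

variable {Ω : Type u}

/-- Average of `Φ` over the two branches `τ ω b` with weights `w ω b`. -/
noncomputable def branch (w : Ω → Bool → ENNReal) (τ : Ω → Bool → Ω) (Φ : Ω → ENNReal) (ω : Ω) : ENNReal :=
  w ω false * Φ (τ ω false) + w ω true * Φ (τ ω true)

/-- Iterated branching at the times `0, …, n - 1`. -/
noncomputable def branchIter (w : ℕ → Ω → Bool → ENNReal) (τ : ℕ → Ω → Bool → Ω) :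
    ℕ → (Ω → ENNReal) → Ω → ENNReal
  | 0, Φ => Φ
  | n + 1, Φ => branchIter w τ n (branch (w n) (τ n) Φ)

variable {w : ℕ → Ω → Bool → ENNReal} {τ : ℕ → Ω → Bool → Ω}

/-- The comparison is needed only on states reachable from `ω₀`. This is what allows a cover chosen
from the frozen data of `ω₀`. -/
theorem branchIter_le_of_rel {rel : Ω → Ω → Prop} {n : ℕ}
    (hτ : ∀ k < n, ∀ ω₀ ω b, rel ω₀ ω → rel ω₀ (τ k ω b)) {Φ Ψ : Ω → ENNReal} {ω₀ : Ω}
    (h : ∀ ω, rel ω₀ ω → Φ ω ≤ Ψ ω) {ω : Ω} (hω : rel ω₀ ω) :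
    branchIter w τ n Φ ω ≤ branchIter w τ n Ψ ω := by
  induction n generalizing Φ Ψ with
  | zero => exact h ω hω
  | succ n ih =>
    refine ih (fun k hk => hτ k (hk.trans n.lt_succ_self)) fun ω' hω' => ?_
    have hb := fun b => h _ (hτ n n.lt_succ_self ω₀ ω' b hω')
    exact add_le_add (mul_le_mul_right (hb _) _) (mul_le_mul_right (hb _) _)

theorem branchIter_mono (n : ℕ) {Φ Ψ : Ω → ENNReal} (h : ∀ ω, Φ ω ≤ Ψ ω) (ω : Ω) :
    branchIter w τ n Φ ω ≤ branchIter w τ n Ψ ω :=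
  branchIter_le_of_rel (rel := fun _ _ => True) (ω₀ := ω) (fun _ _ _ _ _ _ => trivial)
    (fun ω _ => h ω) trivial

theorem branchIter_const_mul (n : ℕ) (C : ENNReal) (Φ : Ω → ENNReal) (ω : Ω) :
    branchIter w τ n (fun ω => C * Φ ω) ω = C * branchIter w τ n Φ ω := by
  induction n generalizing Φ with
  | zero => rfl
  | succ n ih =>
    simp only [branchIter]
    rw [← ih]
    congr 1
    ext ω'
    simp only [branch]
    ring

theorem branchIter_sum (n : ℕ) {ι : Type*} (G : Finset ι) (Φ : ι → Ω → ENNReal) (ω : Ω) :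
    branchIter w τ n (fun ω => ∑ g ∈ G, Φ g ω) ω = ∑ g ∈ G, branchIter w τ n (Φ g) ω := by
  induction n generalizing Φ with
  | zero => rfl
  | succ n ih =>
    simp only [branchIter]
    rw [← ih]
    congr 1
    ext ω'
    simp only [branch, Finset.mul_sum, Finset.sum_add_distrib]

/-- `branchIter` averages over the latest move first, so each one-step inequality peels off one time
index until `S 0` remains. -/
theorem branchIter_supermartingale {n : ℕ} {S : ℕ → Ω → ENNReal} (h0 : ∀ ω, S 0 ω ≤ 1)
    (hS : ∀ k < n, ∀ ω, branch (w k) (τ k) (S (k + 1)) ω ≤ S k ω) (ω : Ω) :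
    branchIter w τ n (S n) ω ≤ 1 := by
  induction n with
  | zero => exact h0 ω
  | succ n ih =>
    exact (branchIter_mono n (hS n n.lt_succ_self) ω).trans
      (ih fun k hk => hS k (hk.trans n.lt_succ_self))

variable [MeasurableSpace Ω]

theorem lintegral_branchIter {μ : Measure Ω} {n : ℕ}
    (hw : ∀ k < n, ∀ b, Measurable fun ω => w k ω b)
    (hτ : ∀ k < n, ∀ b, Measurable fun ω => τ k ω b)
    (hinv : ∀ k < n, ∀ Φ : Ω → ENNReal, Measurable Φ →
      ∫⁻ ω, branch (w k) (τ k) Φ ω ∂μ = ∫⁻ ω, Φ ω ∂μ)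
    {Φ : Ω → ENNReal} (hΦ : Measurable Φ) :
    ∫⁻ ω, branchIter w τ n Φ ω ∂μ = ∫⁻ ω, Φ ω ∂μ := by
  induction n generalizing Φ with
  | zero => rfl
  | succ n ih =>
    have hlt := n.lt_succ_self
    rw [← hinv n hlt Φ hΦ]
    refine ih (fun k hk => hw k (hk.trans hlt)) (fun k hk => hτ k (hk.trans hlt))
      (fun k hk => hinv k (hk.trans hlt)) ?_
    exact ((hw n hlt _).mul (hΦ.comp (hτ n hlt _))).add ((hw n hlt _).mul (hΦ.comp (hτ n hlt _)))

/-- A supremum of exponential supermartingales has expectation at most the covering number. -/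
theorem lintegral_iSup_supermartingale_le {μ : Measure Ω} [IsProbabilityMeasure μ] {n : ℕ}
    (hw : ∀ k < n, ∀ b, Measurable fun ω => w k ω b)
    (hτ : ∀ k < n, ∀ b, Measurable fun ω => τ k ω b)
    (hinv : ∀ k < n, ∀ Φ : Ω → ENNReal, Measurable Φ →
      ∫⁻ ω, branch (w k) (τ k) Φ ω ∂μ = ∫⁻ ω, Φ ω ∂μ)
    {ι : Type v} [Countable ι] {S : ι → ℕ → Ω → ENNReal} (h0 : ∀ i ω, S i 0 ω ≤ 1)
    (hS : ∀ i, ∀ k < n, ∀ ω, branch (w k) (τ k) (S i (k + 1)) ω ≤ S i k ω)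
    (hSm : ∀ i, Measurable (S i n))
    {rel : Ω → Ω → Prop} (hrel : ∀ ω, rel ω ω)
    (hrelτ : ∀ k < n, ∀ ω₀ ω b, rel ω₀ ω → rel ω₀ (τ k ω b)) {C : ENNReal} {B : ℕ}
    (hcov : ∀ ω₀, ∃ G : Finset ι, G.card ≤ B ∧
      ∀ i, ∃ g ∈ G, ∀ ω, rel ω₀ ω → S i n ω ≤ C * S g n ω) :
    ∫⁻ ω, ⨆ i, S i n ω ∂μ ≤ C * B := by
  rw [← lintegral_branchIter hw hτ hinv (Measurable.iSup hSm)]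
  calc ∫⁻ ω, branchIter w τ n (fun ω => ⨆ i, S i n ω) ω ∂μ ≤ ∫⁻ _, C * B ∂μ := by
        -- After inserting the invariant moves the bound is pointwise in `ω₀`: the cover may depend
        -- on `ω₀`, while all remaining randomness is in the branches.
        refine lintegral_mono fun ω₀ => ?_
        obtain ⟨G, hGB, hG⟩ := hcov ω₀
        calc branchIter w τ n (fun ω => ⨆ i, S i n ω) ω₀
            ≤ branchIter w τ n (fun ω => C * ∑ g ∈ G, S g n ω) ω₀ := by
              refine branchIter_le_of_rel hrelτ (fun ω hω => iSup_le fun i => ?_) (hrel ω₀)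
              obtain ⟨g, hg, h⟩ := hG i
              exact (h ω hω).trans (mul_le_mul_right (Finset.single_le_sum
                (f := fun g => S g n ω) (fun _ _ => zero_le) hg) C)
          _ = C * ∑ g ∈ G, branchIter w τ n (S g n) ω₀ := by
              rw [branchIter_const_mul, branchIter_sum]
          _ ≤ C * ∑ g ∈ G, 1 := by
              gcongr with g
              exact branchIter_supermartingale (h0 g) (hS g) ω₀
          _ ≤ C * B := by
              gcongr
              simpa using hGB
    _ = C * B := by simp

end Branch

/-! ### Exponential moment bounds -/

theorem exp_le_one_add_add_sq {x : ℝ} (hx : |x| ≤ 1) : Real.exp x ≤ 1 + x + x ^ 2 := by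
  have := (abs_le.1 (Real.abs_exp_sub_one_sub_id_le hx)).2
  linarith

/-- With `e^x ≤ 1 + x + x²` the centred variable has exponential moment at most `1 + a² p (1 - p)`,
and `p (1 - p) ≤ 1/4` matches the compensator `a² / 4`. The factor `q` switches the term off when no
label is queried. -/
theorem bernoulli_exp_le_one {p a q : ℝ} (hp0 : 0 ≤ p) (hp1 : p ≤ 1) (ha : |a| ≤ 1)
    (hq : q = 0 ∨ q = 1) :
    (1 - p) * Real.exp (q * (a * (0 - p) - a ^ 2 / 4)) +
      p * Real.exp (q * (a * (1 - p) - a ^ 2 / 4)) ≤ 1 := by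
  rcases hq with rfl | rfl
  · simp
  have ha' := abs_le.1 ha
  have h0 : Real.exp (-(a * p)) ≤ 1 + -(a * p) + (-(a * p)) ^ 2 :=
    exp_le_one_add_add_sq (by
      rw [abs_neg, abs_mul, abs_of_nonneg hp0]
      nlinarith [abs_nonneg a])
  have h1 : Real.exp (a * (1 - p)) ≤ 1 + a * (1 - p) + (a * (1 - p)) ^ 2 :=
    exp_le_one_add_add_sq (by
      rw [abs_mul, abs_of_nonneg (by linarith : 0 ≤ 1 - p)]
      nlinarith [abs_nonneg a])
  have h2 : a ^ 2 / 4 + 1 ≤ Real.exp (a ^ 2 / 4) := Real.add_one_le_exp _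
  have h3 : (1 - p) * Real.exp (-(a * p)) + p * Real.exp (a * (1 - p)) ≤
      Real.exp (a ^ 2 / 4) := by
    have e1 := mul_le_mul_of_nonneg_left h0 (by linarith : 0 ≤ 1 - p)
    have e2 := mul_le_mul_of_nonneg_left h1 hp0
    have e3 : (1 - p) * (1 + -(a * p) + (-(a * p)) ^ 2) +
        p * (1 + a * (1 - p) + (a * (1 - p)) ^ 2) = 1 + a ^ 2 * (p * (1 - p)) := by ring
    have e4 : p * (1 - p) ≤ 1 / 4 := by nlinarith [sq_nonneg (p - 1 / 2)]
    nlinarith [mul_le_mul_of_nonneg_left e4 (sq_nonneg a)]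
  have e0 : ∀ x : ℝ, Real.exp (1 * (x - a ^ 2 / 4)) = Real.exp x * Real.exp (-(a ^ 2 / 4)) := by
    intro x; rw [← Real.exp_add]; ring_nf
  rw [e0, e0, show a * (0 - p) = -(a * p) by ring]
  calc _ = ((1 - p) * Real.exp (-(a * p)) + p * Real.exp (a * (1 - p))) *
        Real.exp (-(a ^ 2 / 4)) := by ring
    _ ≤ Real.exp (a ^ 2 / 4) * Real.exp (-(a ^ 2 / 4)) := by gcongr
    _ = 1 := by rw [← Real.exp_add]; simp

/-- The doubled empirical term creates a drift `-(a + b) / 8`. On `[0, 1]` it dominates the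
second-order terms, which are at most `5 (a + b) / 64`. This self-bounding effect gives a deviation
bound free of square roots. -/
theorem swap_exp_le_two {a b : ℝ} (ha0 : 0 ≤ a) (ha1 : a ≤ 1) (hb0 : 0 ≤ b) (hb1 : b ≤ 1) :
    Real.exp (1 / 8 * (b - 2 * a)) + Real.exp (1 / 8 * (a - 2 * b)) ≤ 2 := by
  have h1 := exp_le_one_add_add_sq (x := 1 / 8 * (b - 2 * a)) (by
    rw [abs_le]; constructor <;> linarith)
  have h2 := exp_le_one_add_add_sq (x := 1 / 8 * (a - 2 * b)) (by
    rw [abs_le]; constructor <;> linarith)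
  nlinarith [mul_nonneg ha0 hb0, mul_nonneg ha0 (by linarith : 0 ≤ 1 - a),
    mul_nonneg hb0 (by linarith : 0 ≤ 1 - b)]

/-- One term of the exponent in the noise bound. -/
noncomputable def noiseTerm {X : Type u} (f η : X → ℝ) (z : X × Bool) : ℝ :=
  (f z.1 - η z.1) * ((if z.2 then 1 else 0) - η z.1) - (f z.1 - η z.1) ^ 2 / 4

theorem abs_noiseTerm_sub_le {X : Type u} {f g η : X → ℝ} {z : X × Bool}
    (hη : η z.1 ∈ Set.Icc (0 : ℝ) 1) (hf : f z.1 ∈ Set.Icc (0 : ℝ) 1)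
    (hg : g z.1 ∈ Set.Icc (0 : ℝ) 1) :
    |noiseTerm f η z - noiseTerm g η z| ≤ 3 / 2 * |f z.1 - g z.1| := by
  have e : noiseTerm f η z - noiseTerm g η z = (f z.1 - g z.1) *
      (((if z.2 then 1 else 0) - η z.1) - (f z.1 + g z.1 - 2 * η z.1) / 4) := by
    unfold noiseTerm; ring
  rw [e, abs_mul, mul_comm]
  refine mul_le_mul_of_nonneg_right ?_ (abs_nonneg _)
  obtain ⟨h1, h2⟩ := hη
  obtain ⟨h3, h4⟩ := hf
  obtain ⟨h5, h6⟩ := hg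
  rw [abs_le]
  split_ifs <;> constructor <;> linarith

/-! ### Uniform control of the label noise by resampling labels with the points fixed. -/

section Noise

variable {X : Type u} [MeasurableSpace X] {D : Measure (X × Bool)} [IsProbabilityMeasure D]
  {η : X → ℝ}

theorem lintegral_fst (D : Measure (X × Bool)) {g : X → ENNReal} (hg : Measurable g) :
    ∫⁻ x, g x ∂D.fst = ∫⁻ z, g z.1 ∂D :=
  lintegral_map hg measurable_fst

theorem eq_map_withDensity_of_isCondProb (hη : IsCondProb D η)
    (h01 : ∀ x, η x ∈ Set.Icc (0 : ℝ) 1) :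
    D = (D.fst.withDensity fun x => ENNReal.ofReal (1 - η x)).map (fun x => (x, false)) +
      (D.fst.withDensity fun x => ENNReal.ofReal (η x)).map (fun x => (x, true)) := by
  have hmf : ∀ b : Bool, Measurable fun x : X => (x, b) := fun b => measurable_prodMk_right
  have htrue : ∀ A : Set X, MeasurableSet A →
      D (A ×ˢ {true}) = ∫⁻ x in A, ENNReal.ofReal (η x) ∂D.fst := hη.2
  have hfalse : ∀ A : Set X, MeasurableSet A →
      D (A ×ˢ {false}) = ∫⁻ x in A, ENNReal.ofReal (1 - η x) ∂D.fst := by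
    intro A hA
    have h1 : D (A ×ˢ {false}) + D (A ×ˢ {true}) = D.fst A := by
      rw [← measure_union _ (hA.prod (measurableSet_singleton _)), Measure.fst_apply hA]
      · congr 1
        ext ⟨x, b⟩
        cases b <;> simp
      · rw [Set.disjoint_left]
        rintro ⟨x, b⟩ hb hb'
        simp_all
    have h2 : ∫⁻ x in A, ENNReal.ofReal (1 - η x) ∂D.fst +
        ∫⁻ x in A, ENNReal.ofReal (η x) ∂D.fst = D.fst A := by
      rw [← lintegral_add_right _ hη.1.ennreal_ofReal]
      rw [← setLIntegral_one]
      refine lintegral_congr fun x => ?_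
      rw [← ENNReal.ofReal_add (by linarith [(h01 x).2]) (h01 x).1]
      simp
    rw [htrue A hA, ← h2] at h1
    refine (ENNReal.add_left_inj ?_).1 h1
    refine ne_top_of_le_ne_top (measure_ne_top D.fst A) ?_
    rw [← h2]
    exact le_add_self
  ext S hS
  set A : Set X := (fun x => (x, false)) ⁻¹' S
  set B : Set X := (fun x => (x, true)) ⁻¹' S
  have hA : MeasurableSet A := hmf _ hS
  have hB : MeasurableSet B := hmf _ hS
  have hdec : S = A ×ˢ {false} ∪ B ×ˢ {true} := by
    ext ⟨x, b⟩
    cases b <;> simp [A, B]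
  rw [Measure.add_apply, Measure.map_apply (hmf _) hS, Measure.map_apply (hmf _) hS,
    withDensity_apply _ hA, withDensity_apply _ hB, ← htrue B hB, ← hfalse A hA,
    ← measure_union _ (hB.prod (measurableSet_singleton _)), ← hdec]
  rw [Set.disjoint_left]
  rintro ⟨x, b⟩ hb hb'
  simp_all

/-- Resampling the label given the point does not change the law. -/
theorem lintegral_resample (hη : IsCondProb D η) (h01 : ∀ x, η x ∈ Set.Icc (0 : ℝ) 1)
    {Φ : X × Bool → ENNReal} (hΦ : Measurable Φ) :
    ∫⁻ z, (ENNReal.ofReal (1 - η z.1) * Φ (z.1, false) + ENNReal.ofReal (η z.1) * Φ (z.1, true)) ∂D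
      = ∫⁻ z, Φ z ∂D := by
  have hmf : ∀ b : Bool, Measurable fun x : X => (x, b) := fun b => measurable_prodMk_right
  have hm1 : Measurable fun x => ENNReal.ofReal (1 - η x) :=
    (measurable_const.sub hη.1).ennreal_ofReal
  have hm2 : Measurable fun x => ENNReal.ofReal (η x) := hη.1.ennreal_ofReal
  rw [← lintegral_fst D (g := fun x => ENNReal.ofReal (1 - η x) * Φ (x, false) +
    ENNReal.ofReal (η x) * Φ (x, true))
    ((hm1.mul (hΦ.comp (hmf _))).add (hm2.mul (hΦ.comp (hmf _))))]
  conv_rhs => rw [eq_map_withDensity_of_isCondProb hη h01]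
  have hmΦ : ∀ b : Bool, Measurable fun x : X => Φ (x, b) := fun b => hΦ.comp (hmf b)
  rw [lintegral_add_measure, lintegral_map hΦ (hmf _), lintegral_map hΦ (hmf _),
    lintegral_withDensity_eq_lintegral_mul _ hm1 (hmΦ false),
    lintegral_withDensity_eq_lintegral_mul _ hm2 (hmΦ true),
    ← lintegral_add_left (hm1.mul (hmΦ false))]
  rfl

theorem measurable_noiseTerm {f : X → ℝ} (hf : Measurable f) (hη : Measurable η) :
    Measurable (noiseTerm f η) := by
  have hb : Measurable fun z : X × Bool => (if z.2 then (1 : ℝ) else 0) :=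
    (measurable_of_countable (fun b : Bool => if b then (1 : ℝ) else 0)).comp measurable_snd
  have h1 : Measurable fun z : X × Bool => f z.1 - η z.1 :=
    (hf.comp measurable_fst).sub (hη.comp measurable_fst)
  exact (h1.mul (hb.sub (hη.comp measurable_fst))).sub ((h1.pow_const 2).div_const 4)

/-- The move at time `k` redraws the label at `k` from its conditional law. Points never change, so
one cover on the points of `ω₀` serves all branches. Since `q` is predictable (it sees earlier
observations and the current point, not the current label), the redrawn label enters only the last
term and `bernoulli_exp_le_one` applies. -/
theorem lintegral_iSup_noise_le (hη : IsCondProb D η) (h01 : ∀ x, η x ∈ Set.Icc (0 : ℝ) 1)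
    {F : Set (X → ℝ)} (hFc : F.Countable) (hFm : ∀ f ∈ F, Measurable f)
    (hF : ∀ f ∈ F, ∀ x, f x ∈ Set.Icc (0 : ℝ) 1) {d : ℕ} (hd : pdim F ≤ d)
    {q : ℕ → (ℕ → X × Bool) → ℝ} (hq01 : ∀ t ω, q t ω = 0 ∨ q t ω = 1)
    (hqm : ∀ t, Measurable (q t))
    (hqa : ∀ t ω ω', (∀ s < t, ω s = ω' s) → (ω t).1 = (ω' t).1 → q t ω = q t ω')
    {n : ℕ} (hn : 0 < n) :
    ∫⁻ ω, ⨆ f : F, ENNReal.ofReal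
        (Real.exp (∑ t ∈ Finset.range n, q t ω * noiseTerm f η (ω t))) ∂(streamLaw D) ≤
      ENNReal.ofReal (Real.exp (3 / 2)) * ((n * (n + 1) + 1) ^ d : ℕ) := by
  classical
  have := hFc.to_subtype
  set w : ℕ → (ℕ → X × Bool) → Bool → ENNReal := fun k ω b =>
    if b then ENNReal.ofReal (η (ω k).1) else ENNReal.ofReal (1 - η (ω k).1) with hw
  set τ : ℕ → (ℕ → X × Bool) → Bool → (ℕ → X × Bool) := fun k ω b =>
    Function.update ω k ((ω k).1, b) with hτ
  have hwm : ∀ k b, Measurable fun ω => w k ω b := by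
    intro k b
    have hηk : Measurable fun ω : ℕ → X × Bool => η (ω k).1 :=
      hη.1.comp (measurable_fst.comp (measurable_pi_apply k))
    cases b
    · exact (measurable_const.sub hηk).ennreal_ofReal
    · exact hηk.ennreal_ofReal
  have hτm : ∀ k b, Measurable fun ω => τ k ω b := by
    intro k b
    exact (measurable_update_stream k).comp
      (((measurable_fst.comp (measurable_pi_apply k)).prodMk measurable_const).prodMk
        measurable_id)
  refine lintegral_iSup_supermartingale_le (w := w) (τ := τ) (n := n)
    (S := fun (f : F) k ω => ENNReal.ofReal
        (Real.exp (∑ t ∈ Finset.range k, q t ω * noiseTerm f η (ω t))))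
    (rel := fun ω₀ ω => ∀ t, (ω t).1 = (ω₀ t).1)
    (fun k _ b => hwm k b) (fun k _ b => hτm k b) ?_ ?_ ?_ ?_ (fun _ _ => rfl) ?_ ?_
  · intro k _ Φ hΦ
    have hbr : Measurable (branch (w k) (τ k) Φ) :=
      ((hwm k _).mul (hΦ.comp (hτm k _))).add ((hwm k _).mul (hΦ.comp (hτm k _)))
    rw [lintegral_update D k hbr, lintegral_update D k hΦ]
    refine lintegral_congr fun ω => ?_
    have hm : Measurable fun z => Φ (Function.update ω k z) :=
      hΦ.comp ((measurable_update_stream k).comp (measurable_id.prodMk measurable_const))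
    rw [← lintegral_resample hη h01 hm]
    refine lintegral_congr fun z => ?_
    simp [branch, hw, hτ]
  · intro f ω
    simp
  · intro f k _ ω
    have hpast : ∀ b, ∀ s < k, τ k ω b s = ω s := fun b s hs => by
      simp [hτ, Function.update_of_ne hs.ne]
    have hsum : ∀ b, ∑ t ∈ Finset.range (k + 1), q t (τ k ω b) * noiseTerm f η (τ k ω b t) =
        ∑ t ∈ Finset.range k, q t ω * noiseTerm f η (ω t) +
          q k ω * noiseTerm f η ((ω k).1, b) := by
      intro b
      rw [Finset.sum_range_succ]
      congr 1
      · refine Finset.sum_congr rfl fun t ht => ?_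
        have ht := Finset.mem_range.1 ht
        rw [hpast b t ht, hqa t (τ k ω b) ω (fun s hs => hpast b s (hs.trans ht))
          (by rw [hpast b t ht])]
      · rw [hqa k (τ k ω b) ω (hpast b) (by simp [hτ])]
        simp [hτ]
    have hη1 := h01 (ω k).1
    have hf1 := hF f f.2 (ω k).1
    simp only [branch, hsum, hw, Real.exp_add]
    set E := Real.exp (∑ t ∈ Finset.range k, q t ω * noiseTerm f η (ω t)) with hE
    have hE0 : 0 ≤ E := (Real.exp_pos _).le
    simp only [Bool.false_eq_true, if_false, if_true]
    rw [← ENNReal.ofReal_mul (by linarith [hη1.2]), ← ENNReal.ofReal_mul hη1.1,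
      ← ENNReal.ofReal_add
        (mul_nonneg (by linarith [hη1.2]) (mul_nonneg hE0 (Real.exp_pos _).le))
        (mul_nonneg hη1.1 (mul_nonneg hE0 (Real.exp_pos _).le))]
    refine ENNReal.ofReal_le_ofReal ?_
    have hb := bernoulli_exp_le_one (p := η (ω k).1) (a := f.1 (ω k).1 - η (ω k).1) (q := q k ω)
      hη1.1 hη1.2 (by rw [abs_le]; constructor <;> linarith [hη1.1, hη1.2, hf1.1, hf1.2])
      (hq01 k ω)
    have hb' := mul_le_mul_of_nonneg_left hb hE0
    simp only [noiseTerm, Bool.false_eq_true, if_false, if_true]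
    linarith
  · intro f
    refine (Real.measurable_exp.comp (Finset.measurable_sum _ fun t _ => ?_)).ennreal_ofReal
    exact (hqm t).mul ((measurable_noiseTerm (hFm f f.2) hη.1).comp (measurable_pi_apply t))
  · intro k _ ω₀ ω b h t
    by_cases htk : t = k
    · subst htk; simp [hτ, h]
    · simp [hτ, Function.update_of_ne htk, h]
  · intro ω₀
    obtain ⟨G, hGF, hGc, hG⟩ := exists_finite_cover hF hd
      ((Finset.range n).image fun t => (ω₀ t).1) hn
    refine ⟨G.subtype (· ∈ F), ?_, fun f => ?_⟩
    · rw [Finset.card_subtype]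
      refine (Finset.card_filter_le _ _).trans (hGc.trans ?_)
      gcongr
      exact Finset.card_image_le.trans (by simp)
    · obtain ⟨g, hg, h⟩ := hG f f.2
      refine ⟨⟨g, hGF hg⟩, by simpa using hg, fun ω hω => ?_⟩
      rw [← ENNReal.ofReal_mul (Real.exp_pos _).le, ← Real.exp_add]
      refine ENNReal.ofReal_le_ofReal (Real.exp_le_exp.2 ?_)
      have hn' : (0 : ℝ) < n := by exact_mod_cast hn
      -- The cover has radius `1 / n` and one term is `3/2`-Lipschitz in `f`, so replacing `f` by
      -- `g` costs `3/2` in total, whence the factor `exp (3 / 2)`.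
      have hsum : ∑ t ∈ Finset.range n, q t ω * noiseTerm f η (ω t) ≤
          ∑ t ∈ Finset.range n, (3 / 2 * (1 / n) + q t ω * noiseTerm g η (ω t)) := by
        refine Finset.sum_le_sum fun t ht => ?_
        have h1 := abs_noiseTerm_sub_le (z := ω t) (h01 _) (hF f f.2 _) (hF g (hGF hg) _)
        have h2 := h (ω t).1 (Finset.mem_image.2 ⟨t, ht, (hω t).symm⟩)
        have h3 := (abs_le.1 (h1.trans (mul_le_mul_of_nonneg_left h2 (by norm_num)))).2
        have h4 : (0 : ℝ) ≤ 3 / 2 * (1 / n) := by positivity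
        rcases hq01 t ω with hq | hq <;> rw [hq] <;> linarith
      refine hsum.trans_eq ?_
      rw [Finset.sum_add_distrib, Finset.sum_const, Finset.card_range, nsmul_eq_mul]
      field_simp

end Noise

/-! ### Chernoff bound and symmetrization for i.i.d. samples. -/

section IID

variable {Z : Type u} [MeasurableSpace Z] {D : Measure Z} [IsProbabilityMeasure D]

/-- Chernoff's bound for the number of visits to `R`. -/
theorem lintegral_exp_count_le (D : Measure Z) [IsProbabilityMeasure D] {R : Set Z}
    (hR : MeasurableSet R) (n : ℕ) :
    ∫⁻ ω, ENNReal.ofReal (Real.exp (∑ t ∈ Finset.range n,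
      (R.indicator (fun _ => (1 : ℝ)) (ω t) - 2 * D.real R))) ∂(streamLaw D) ≤ 1 := by
  have hi : Measurable (R.indicator fun _ => (1 : ℝ)) := measurable_const.indicator hR
  have hterm : ∀ t : ℕ, Measurable fun ω : ℕ → Z =>
      R.indicator (fun _ => (1 : ℝ)) (ω t) - 2 * D.real R :=
    fun t => (hi.comp (measurable_pi_apply t)).sub_const _
  have hS : ∀ n, Measurable fun ω : ℕ → Z => ENNReal.ofReal (Real.exp (∑ t ∈ Finset.range n,
      (R.indicator (fun _ => (1 : ℝ)) (ω t) - 2 * D.real R))) := fun n =>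
    (Real.measurable_exp.comp (Finset.measurable_sum _ fun t _ => hterm t)).ennreal_ofReal
  have hone : ∫⁻ z, ENNReal.ofReal (Real.exp (R.indicator (fun _ => (1 : ℝ)) z - 2 * D.real R)) ∂D
      ≤ 1 := by
    have e : ∀ z, Real.exp (R.indicator (fun _ => (1 : ℝ)) z - 2 * D.real R) =
        Real.exp (- (2 * D.real R)) * (1 + (Real.exp 1 - 1) * R.indicator (fun _ => (1 : ℝ)) z) := by
      intro z
      rw [sub_eq_add_neg, Real.exp_add, mul_comm]
      by_cases hz : z ∈ R <;> simp [hz]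
    have hint : Integrable (R.indicator fun _ => (1 : ℝ)) D := (integrable_const _).indicator hR
    rw [← ofReal_integral_eq_lintegral_ofReal, ENNReal.ofReal_le_one]
    · simp_rw [e]
      rw [integral_const_mul, integral_add (integrable_const _) (hint.const_mul _),
        integral_const_mul, integral_indicator_const _ hR]
      simp only [integral_const, probReal_univ, smul_eq_mul, mul_one]
      -- Uses `e < 3`; this is why the count is compared with twice its mean.
      have h1 : 1 + (Real.exp 1 - 1) * D.real R ≤ Real.exp (2 * D.real R) := by
        have h2 := Real.add_one_le_exp (2 * D.real R)
        have h3 := Real.exp_one_lt_d9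
        nlinarith [measureReal_nonneg (μ := D) (s := R)]
      calc _ ≤ Real.exp (-(2 * D.real R)) * Real.exp (2 * D.real R) := by gcongr
        _ = 1 := by rw [← Real.exp_add]; simp
    · simp_rw [e]
      exact ((integrable_const _).add (hint.const_mul _)).const_mul _
    · exact Filter.Eventually.of_forall fun z => (Real.exp_pos _).le
  induction n with
  | zero => simp
  | succ n ih =>
    rw [lintegral_update D n (hS (n + 1))]
    refine le_trans (lintegral_mono fun ω => ?_) ih
    have hsplit : ∀ z, ENNReal.ofReal (Real.exp (∑ t ∈ Finset.range (n + 1),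
        (R.indicator (fun _ => (1 : ℝ)) (Function.update ω n z t) - 2 * D.real R))) =
        ENNReal.ofReal (Real.exp (∑ t ∈ Finset.range n,
          (R.indicator (fun _ => (1 : ℝ)) (ω t) - 2 * D.real R))) *
        ENNReal.ofReal (Real.exp (R.indicator (fun _ => (1 : ℝ)) z - 2 * D.real R)) := by
      intro z
      rw [Finset.sum_range_succ, Real.exp_add, ENNReal.ofReal_mul (Real.exp_pos _).le,
        Function.update_self]
      congr 3
      refine Finset.sum_congr rfl fun t ht => ?_
      rw [Function.update_of_ne (Finset.mem_range.1 ht).ne]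
    simp_rw [hsplit]
    have hlast : Measurable fun z => ENNReal.ofReal
        (Real.exp (R.indicator (fun _ => (1 : ℝ)) z - 2 * D.real R)) :=
      (Real.measurable_exp.comp (hi.sub_const _)).ennreal_ofReal
    rw [lintegral_const_mul _ hlast]
    exact mul_le_of_le_one_right zero_le hone

/-- A uniform lower deviation bound for the empirical means of a class of nonnegative functions
with finite covers, by symmetrization. -/
theorem lintegral_iSup_deviation_le {ι : Type v} [Countable ι] {h : ι → Z → ℝ}
    (hm : ∀ i, Measurable (h i)) (h01 : ∀ i z, h i z ∈ Set.Icc (0 : ℝ) 1) {n B : ℕ} {r : ℝ}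
    (hcov : ∀ s : Finset Z, s.card ≤ 2 * n → ∃ G : Finset ι, G.card ≤ B ∧
      ∀ i, ∃ g ∈ G, ∀ z ∈ s, |h i z - h g z| ≤ r) :
    ∫⁻ ω, ⨆ i, ENNReal.ofReal (Real.exp (1 / 8 *
        (n * ∫ z, h i z ∂D - 2 * ∑ t ∈ Finset.range n, h i (ω t)))) ∂(streamLaw D) ≤
      ENNReal.ofReal (Real.exp (1 / 8 * (n * (3 * r)))) * B := by
  classical
  set S : ι → ℕ → (ℕ → Z) → ENNReal := fun i k ω => ENNReal.ofReal (Real.exp (∑ t ∈ Finset.range k,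
    1 / 8 * (h i (ω (t + n)) - 2 * h i (ω t)))) with hS
  have hSm : ∀ i k, Measurable (S i k) := fun i k =>
    (Real.measurable_exp.comp (Finset.measurable_sum _ fun t _ =>
      ((((hm i).comp (measurable_pi_apply _)).sub
        (((hm i).comp (measurable_pi_apply _)).const_mul 2)).const_mul _))).ennreal_ofReal
  -- Ghost sample: the mean of `h i` is the expectation of its empirical sum over the times `n, …, 2
  -- n - 1`, and Jensen moves this expectation outside the exponential.
  have hghost : ∫⁻ ω, ⨆ i, ENNReal.ofReal (Real.exp (1 / 8 *
        (n * ∫ z, h i z ∂D - 2 * ∑ t ∈ Finset.range n, h i (ω t)))) ∂(streamLaw D) ≤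
      ∫⁻ ω, ⨆ i, S i n ω ∂(streamLaw D) := by
    rw [lintegral_glue D n (Measurable.iSup fun i => hSm i n)]
    refine lintegral_mono fun ω => iSup_le fun i => ?_
    set g : (ℕ → Z) → ℝ := fun ω' => 1 / 8 *
      (∑ t ∈ Finset.range n, h i (ω' t) - 2 * ∑ t ∈ Finset.range n, h i (ω t)) with hg
    have hhint : ∀ t : ℕ, Integrable (fun ω' : ℕ → Z => h i (ω' t)) (streamLaw D) := fun t =>
      Integrable.of_bound ((hm i).comp (measurable_pi_apply t)).aestronglyMeasurable 1
        (Filter.Eventually.of_forall fun ω' => by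
          rw [Real.norm_eq_abs, abs_le]; constructor <;> linarith [(h01 i (ω' t)).1, (h01 i (ω' t)).2])
    have hgint : Integrable g (streamLaw D) :=
      ((integrable_finsetSum _ fun t _ => hhint t).sub (integrable_const _)).const_mul _
    have hgmean : ∫ ω', g ω' ∂(streamLaw D) = 1 / 8 *
        (n * ∫ z, h i z ∂D - 2 * ∑ t ∈ Finset.range n, h i (ω t)) := by
      have h1 : ∀ t : ℕ, ∫ ω', h i (ω' t) ∂(streamLaw D) = ∫ z, h i z ∂D := by
        intro t
        conv_rhs => rw [← map_eval_streamLaw D t]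
        rw [integral_map (measurable_pi_apply t).aemeasurable (hm i).aestronglyMeasurable]
      simp only [hg]
      rw [integral_const_mul, integral_sub (integrable_finsetSum _ fun t _ => hhint t)
        (integrable_const _), integral_finsetSum _ fun t _ => hhint t]
      simp [h1]
    have hgm : Measurable g :=
      ((Finset.measurable_sum _ fun t _ => (hm i).comp (measurable_pi_apply t)).sub_const
        _).const_mul _
    have hgle : ∀ ω', g ω' ≤ 1 / 8 * n := by
      intro ω'
      have h1 : ∑ t ∈ Finset.range n, h i (ω' t) ≤ n := by
        calc _ ≤ ∑ t ∈ Finset.range n, (1 : ℝ) := Finset.sum_le_sum fun t _ => (h01 i _).2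
          _ = n := by simp
      have h2 : 0 ≤ ∑ t ∈ Finset.range n, h i (ω t) := Finset.sum_nonneg fun t _ => (h01 i _).1
      simp only [hg]
      linarith
    have heint : Integrable (fun ω' => Real.exp (g ω')) (streamLaw D) :=
      Integrable.of_bound (Real.measurable_exp.comp hgm).aestronglyMeasurable
        (Real.exp (1 / 8 * n)) (Filter.Eventually.of_forall fun ω' => by
          rw [Real.norm_eq_abs, abs_of_pos (Real.exp_pos _)]
          exact Real.exp_le_exp.2 (hgle ω'))
    have hjensen : Real.exp (∫ ω', g ω' ∂(streamLaw D)) ≤ ∫ ω', Real.exp (g ω') ∂(streamLaw D) :=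
      convexOn_exp.map_integral_le Real.continuous_exp.continuousOn isClosed_univ
        (Filter.Eventually.of_forall fun _ => trivial) hgint heint
    rw [← hgmean]
    refine (ENNReal.ofReal_le_ofReal hjensen).trans ?_
    rw [ofReal_integral_eq_lintegral_ofReal heint
      (Filter.Eventually.of_forall fun _ => (Real.exp_pos _).le)]
    refine lintegral_mono fun ω' => le_iSup_of_le i (le_of_eq ?_)
    simp only [hS, hg]
    congr 2
    rw [← Finset.mul_sum, Finset.sum_sub_distrib, ← Finset.mul_sum]
    congr 2
    · refine Finset.sum_congr rfl fun t _ => ?_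
      simp [glue]
    · congr 1
      refine Finset.sum_congr rfl fun t ht => ?_
      simp [glue, Finset.mem_range.1 ht]
  refine hghost.trans ?_
  -- The move at time `k` swaps the sample point `k` with its ghost `k + n` with probability `1/2`.
  -- The first `2 n` values are only permuted, so a cover on them survives every branch.
  set τ : ℕ → (ℕ → Z) → Bool → (ℕ → Z) := fun k ω b =>
    if b then fun t => ω (Equiv.swap k (k + n) t) else ω with hτ
  have hτm : ∀ k b, Measurable fun ω => τ k ω b := by
    intro k b
    cases b
    · exact measurable_id
    · simpa [hτ] using measurable_reindex _
  refine lintegral_iSup_supermartingale_le (w := fun _ _ _ => 2⁻¹) (τ := τ) (n := n) (S := S)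
    (rel := fun ω₀ ω => ∀ t < 2 * n, ∃ s < 2 * n, ω t = ω₀ s)
    (fun k _ b => measurable_const) (fun k _ b => hτm k b) ?_ ?_ ?_ (fun i => hSm i n)
    (fun ω t ht => ⟨t, ht, rfl⟩) ?_ ?_
  · intro k _ Φ hΦ
    simp only [branch, hτ, Bool.false_eq_true, if_false, if_true]
    have hΦ' : Measurable fun ω : ℕ → Z => Φ fun t => ω (Equiv.swap k (k + n) t) :=
      hΦ.comp (measurable_reindex _)
    rw [lintegral_add_left (hΦ.const_mul _), lintegral_const_mul _ hΦ, lintegral_const_mul _ hΦ', lintegral_reindex D _ hΦ, ← add_mul,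
      ENNReal.inv_two_add_inv_two, one_mul]
  · intro i ω
    simp [hS]
  · intro i k hk ω
    have hsum : ∑ t ∈ Finset.range k, 1 / 8 * (h i (ω (Equiv.swap k (k + n) (t + n))) -
        2 * h i (ω (Equiv.swap k (k + n) t))) =
        ∑ t ∈ Finset.range k, 1 / 8 * (h i (ω (t + n)) - 2 * h i (ω t)) := by
      refine Finset.sum_congr rfl fun t ht => ?_
      have ht := Finset.mem_range.1 ht
      rw [Equiv.swap_apply_of_ne_of_ne (by omega) (by omega),
        Equiv.swap_apply_of_ne_of_ne (by omega) (by omega)]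
    simp only [branch, hS, hτ, Bool.false_eq_true, if_false, if_true, Finset.sum_range_succ, hsum,
      Equiv.swap_apply_left, Equiv.swap_apply_right, Real.exp_add]
    set E := Real.exp (∑ t ∈ Finset.range k, 1 / 8 * (h i (ω (t + n)) - 2 * h i (ω t)))
    have hE0 : 0 ≤ E := (Real.exp_pos _).le
    have h2 : (2⁻¹ : ENNReal) = ENNReal.ofReal (1 / 2) := by
      rw [one_div, ENNReal.ofReal_inv_of_pos two_pos]; simp
    rw [h2, ← ENNReal.ofReal_mul (by norm_num), ← ENNReal.ofReal_mul (by norm_num),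
      ← ENNReal.ofReal_add (by positivity) (by positivity)]
    refine ENNReal.ofReal_le_ofReal ?_
    have := mul_le_mul_of_nonneg_left (swap_exp_le_two (h01 i (ω k)).1 (h01 i (ω k)).2
      (h01 i (ω (k + n))).1 (h01 i (ω (k + n))).2) hE0
    linarith
  · intro k hk ω₀ ω b hω t ht
    cases b
    · simpa [hτ] using hω t ht
    · simp only [hτ, if_true]
      refine hω _ ?_
      rw [Equiv.swap_apply_def]
      split_ifs <;> omega
  · intro ω₀
    obtain ⟨G, hGB, hG⟩ := hcov ((Finset.range (2 * n)).image ω₀)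
      (Finset.card_image_le.trans (by simp))
    refine ⟨G, hGB, fun i => ?_⟩
    obtain ⟨g, hg, hgr⟩ := hG i
    refine ⟨g, hg, fun ω hω => ?_⟩
    rw [← ENNReal.ofReal_mul (Real.exp_pos _).le, ← Real.exp_add]
    refine ENNReal.ofReal_le_ofReal (Real.exp_le_exp.2 ?_)
    have hclose : ∀ t < 2 * n, |h i (ω t) - h g (ω t)| ≤ r := by
      intro t ht
      obtain ⟨s, hs, e⟩ := hω t ht
      exact hgr _ (Finset.mem_image.2 ⟨s, Finset.mem_range.2 hs, e.symm⟩)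
    have hsum : ∑ t ∈ Finset.range n, 1 / 8 * (h i (ω (t + n)) - 2 * h i (ω t)) ≤
        ∑ t ∈ Finset.range n, (1 / 8 * (3 * r) + 1 / 8 * (h g (ω (t + n)) - 2 * h g (ω t))) := by
      refine Finset.sum_le_sum fun t ht => ?_
      have ht := Finset.mem_range.1 ht
      have h1 := abs_le.1 (hclose t (by omega))
      have h2 := abs_le.1 (hclose (t + n) (by omega))
      linarith [h1.1, h2.2]
    refine hsum.trans_eq ?_
    rw [Finset.sum_add_distrib, Finset.sum_const, Finset.card_range, nsmul_eq_mul]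
    ring

end IID

/-! ### Histories, active sets and query regions -/

section History

variable {X : Type u}

namespace ActiveLearner

variable (A : ActiveLearner X)

theorem length_history (ω : ℕ → X × Bool) (t : ℕ) : (A.history ω t).length = t := by
  induction t with
  | zero => rfl
  | succ t ih => simp [history, ih]

theorem take_history (ω : ℕ → X × Bool) {s t : ℕ} (h : s ≤ t) :
    (A.history ω t).take s = A.history ω s := by
  induction t, h using Nat.le_induction with
  | base => exact List.take_of_length_le (A.length_history ω s).le
  | succ t hst ih =>
    rw [history, List.take_append_of_le_length (by rw [A.length_history]; exact hst), ih]

theorem history_congr {ω ω' : ℕ → X × Bool} {t : ℕ} (h : ∀ s < t, ω s = ω' s) :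
    A.history ω t = A.history ω' t := by
  induction t with
  | zero => rfl
  | succ t ih =>
    rw [history, history, ih fun s hs => h s (hs.trans t.lt_succ_self), h t t.lt_succ_self]

/-- The label at time `t` is queried. -/
def Queries (ω : ℕ → X × Bool) (t : ℕ) : Prop := A.query (A.history ω t) (ω t).1

open Classical in
theorem sqLoss_history (ω : ℕ → X × Bool) (t : ℕ) (f : X → ℝ) :
    sqLoss (A.history ω t) f = ∑ s ∈ Finset.range t, if A.Queries ω s then
      (f (ω s).1 - (if (ω s).2 then 1 else 0)) ^ 2 else 0 := by
  induction t with
  | zero => simp [sqLoss, history]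
  | succ t ih =>
    rw [Finset.sum_range_succ, ← ih, history, sqLoss, List.map_append, List.sum_append, ← sqLoss]
    congr 1
    by_cases h : A.query (A.history ω t) (ω t).1 <;> simp [Queries, h]

open Classical in
theorem labels_eq_sum (ω : ℕ → X × Bool) :
    (A.labels ω : ℝ) = ∑ s ∈ Finset.range A.horizon, if A.Queries ω s then (1 : ℝ) else 0 := by
  rw [labels]
  generalize A.horizon = t
  induction t with
  | zero => simp [history]
  | succ t ih =>
    rw [Finset.sum_range_succ, ← ih, history, List.countP_append, Nat.cast_add]
    congr 1
    by_cases h : A.query (A.history ω t) (ω t).1 <;> simp [Queries, h]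

end ActiveLearner

theorem sqLoss_labelled {n : ℕ} (z : Fin n → X × Bool) (f : X → ℝ) :
    sqLoss (labelled z) f = ∑ i, (f (z i).1 - (if (z i).2 then 1 else 0)) ^ 2 := by
  simp [sqLoss, labelled, List.sum_ofFn]

/-- The oracle may answer differently on histories with the same loss functional, but the minimal
loss agrees, and only that value enters the active set. -/
theorem activeSet_congr {F : Set (X → ℝ)} {O : History X → X → ℝ} (hO : IsRegressionOracle F O)
    {S S' : History X} (h : ∀ f, sqLoss S f = sqLoss S' f) (b : ℝ) :
    activeSet F O S b = activeSet F O S' b := by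
  have e : sqLoss S (O S) = sqLoss S' (O S') := by
    refine le_antisymm ?_ ?_
    · rw [← h (O S')]; exact (hO S).2 _ (hO S').1
    · rw [h (O S)]; exact (hO S').2 _ (hO S).1
  unfold activeSet
  rw [e]
  ext f
  change _ ∧ _ ↔ _ ∧ _
  rw [h f]

theorem exists_history_eq_labelled {F : Set (X → ℝ)} {O : History X → X → ℝ}
    (hO : IsRegressionOracle F O) (A : ActiveLearner X) (u : Finset ℕ) {t : ℕ}
    (hu : u ⊆ Finset.range t) {ω : ℕ → X × Bool} (hω : ∀ s < t, s ∈ u ↔ A.Queries ω s) (b : ℝ) :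
    activeSet F O (A.history ω t) b =
      activeSet F O (labelled fun i : Fin u.card => ω (u.orderEmbOfFin rfl i)) b := by
  classical
  refine activeSet_congr hO (fun f => ?_) b
  rw [A.sqLoss_history, sqLoss_labelled, ← Finset.sum_filter]
  have hf : (Finset.range t).filter (fun s => A.Queries ω s) = u := by
    ext s
    rw [Finset.mem_filter, Finset.mem_range]
    constructor
    · rintro ⟨h1, h2⟩; exact (hω s h1).2 h2
    · intro h
      have := Finset.mem_range.1 (hu h)
      exact ⟨this, (hω s this).1 h⟩
  rw [hf]
  conv_lhs => rw [← Finset.map_orderEmbOfFin_univ u rfl]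
  rw [Finset.sum_map]
  rfl

section Measurability

variable [MeasurableSpace X]

/-- The streams split into finitely many measurable pieces according to the set `u` of queried
times. On each piece the active set is that of a labelled sample of fixed size, where the assumed
joint measurability applies. -/
theorem measurable_comp_activeSet_history {F : Set (X → ℝ)} {O : History X → X → ℝ}
    (hO : IsRegressionOracle F O) (A : ActiveLearner X) {t : ℕ}
    (hA : ∀ s < t, MeasurableSet {ω | A.Queries ω s}) {b : ℝ} {Λ : Set (X → ℝ) → X → ℝ}
    (hΛ : ∀ n : ℕ, Measurable fun q : (Fin n → X × Bool) × X =>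
      Λ (activeSet F O (labelled q.1) b) q.2) :
    Measurable fun p : (ℕ → X × Bool) × X => Λ (activeSet F O (A.history p.1 t) b) p.2 := by
  classical
  intro V hV
  set P : Finset ℕ → Set (ℕ → X × Bool) := fun u => {ω | ∀ s < t, s ∈ u ↔ A.Queries ω s}
  set g : Finset ℕ → (ℕ → X × Bool) × X → ℝ := fun u p =>
    Λ (activeSet F O (labelled fun i : Fin u.card => p.1 (u.orderEmbOfFin rfl i)) b) p.2
  have hPm : ∀ u, MeasurableSet (P u) := by
    intro u
    have : P u = ⋂ s ∈ Finset.range t, {ω | s ∈ u ↔ A.Queries ω s} := by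
      ext ω; simp [P]
    rw [this]
    refine Finset.measurableSet_biInter _ fun s hs => ?_
    have hm := hA s (Finset.mem_range.1 hs)
    by_cases hsu : s ∈ u
    · simpa [hsu] using hm
    · simp only [hsu, false_iff]
      exact hm.compl
  have hgm : ∀ u, Measurable (g u) := by
    intro u
    have h1 : Measurable fun p : (ℕ → X × Bool) × X =>
        ((fun i : Fin u.card => p.1 (u.orderEmbOfFin rfl i)), p.2) :=
      (measurable_pi_lambda _ fun i => (measurable_pi_apply _).comp measurable_fst).prodMk
        measurable_snd
    exact (hΛ u.card).comp h1
  have hpre : (fun p : (ℕ → X × Bool) × X => Λ (activeSet F O (A.history p.1 t) b) p.2) ⁻¹' V =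
      ⋃ u ∈ (Finset.range t).powerset, (Prod.fst ⁻¹' P u ∩ g u ⁻¹' V) := by
    ext ⟨ω, x⟩
    simp only [Set.mem_preimage, Set.mem_iUnion, Set.mem_inter_iff, exists_prop]
    constructor
    · intro h
      have hu : (Finset.range t).filter (fun s => A.Queries ω s) ⊆ Finset.range t :=
        Finset.filter_subset _ _
      have hP : ω ∈ P ((Finset.range t).filter fun s => A.Queries ω s) := by
        intro s hs; simp [hs]
      refine ⟨_, Finset.mem_powerset.2 hu, hP, ?_⟩
      simp only [g]
      rwa [← exists_history_eq_labelled hO A _ hu hP]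
    · rintro ⟨u, hu, hP, hg⟩
      rw [exists_history_eq_labelled hO A u (Finset.mem_powerset.1 hu) hP]
      exact hg
  rw [hpre]
  exact Finset.measurableSet_biUnion _ fun u _ => (measurable_fst (hPm u)).inter (hgm u hV)

end Measurability

end History

/-! ### Dyadic bookkeeping for epochs. -/

section Epochs

/-- The time at which epoch `m` starts. -/
def epochStart (m : ℕ) : ℕ := epochEnd (m - 1)

theorem epochStart_epoch_le (t : ℕ) : epochStart (epoch t) ≤ t := (epoch_spec t).1

theorem one_le_epoch (t : ℕ) : 1 ≤ epoch t := Nat.succ_pos _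

theorem epochEnd_mono : Monotone epochEnd := by
  intro a b h
  unfold epochEnd
  split_ifs with h1 h2 h2
  · exact le_rfl
  · exact Nat.zero_le _
  · omega
  · exact Nat.pow_le_pow_right two_pos h

theorem epochStart_mono : Monotone epochStart := fun _ _ h =>
  epochEnd_mono (Nat.sub_le_sub_right h 1)

theorem epoch_eq_of_mem {m t : ℕ} (hm : 1 ≤ m) (h1 : epochStart m ≤ t)
    (h2 : t < epochStart (m + 1)) : epoch t = m := by
  have h := epoch_spec t
  have h0 := one_le_epoch t
  rcases lt_trichotomy (epoch t) m with hlt | heq | hgt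
  · have := epochEnd_mono (show epoch t ≤ m - 1 by omega)
    unfold epochStart at h1
    omega
  · exact heq
  · have := epochEnd_mono (show m ≤ epoch t - 1 by omega)
    simp only [epochStart, Nat.add_sub_cancel] at h2
    omega

theorem epoch_lt_of_lt_epochStart {m t : ℕ} (h : t < epochStart m) : epoch t < m := by
  by_contra! hc
  have := epochEnd_mono (show m - 1 ≤ epoch t - 1 by omega)
  have := (epoch_spec t).1
  unfold epochStart at h
  omega

/-- The number of points of epoch `m`. -/
def epochLen (m : ℕ) : ℕ := epochStart (m + 1) - epochStart m

theorem epochStart_add_epochLen (m : ℕ) : epochStart m + epochLen m = epochStart (m + 1) :=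
  Nat.add_sub_cancel' (epochStart_mono m.le_succ)

theorem epochStart_of_two_le {m : ℕ} (hm : 2 ≤ m) : epochStart m = 2 ^ (m - 1) := by
  rw [epochStart, epochEnd, if_neg (by omega)]

theorem epochLen_one : epochLen 1 = 2 := rfl

theorem epochLen_of_two_le {m : ℕ} (hm : 2 ≤ m) : epochLen m = 2 ^ (m - 1) := by
  obtain ⟨k, rfl⟩ : ∃ k, m = k + 2 := ⟨m - 2, by omega⟩
  rw [epochLen, epochStart_of_two_le hm, epochStart_of_two_le (by omega)]
  simp only [show k + 2 - 1 = k + 1 by omega, show k + 2 + 1 - 1 = k + 2 by omega]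
  rw [pow_succ 2 (k + 1)]
  omega

theorem two_pow_le_epochLen {m : ℕ} (hm : 1 ≤ m) : 2 ^ (m - 1) ≤ epochLen m := by
  rcases hm.eq_or_lt with rfl | h
  · rw [epochLen_one]; norm_num
  · rw [epochLen_of_two_le h]

end Epochs

/-! ### Query regions, predictability and measurability of the queries. -/

section Region

variable {X : Type u} (F : Set (X → ℝ)) (O : History X → X → ℝ) (P : Params)

/-- The active set of epoch `m` on the stream `ω`. -/
noncomputable def activeOn (m : ℕ) (ω : ℕ → X × Bool) : Set (X → ℝ) :=
  activeSet F O ((algorithm F O P).history ω (epochStart m)) (P.β m)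

/-- The query region of epoch `m` on the stream `ω`. -/
def region (m : ℕ) (ω : ℕ → X × Bool) : Set X :=
  {x | lcb (activeOn F O P m ω) x < 1 / 2 ∧ 1 / 2 < ucb (activeOn F O P m ω) x ∧
    (lcb (activeOn F O P m ω) x < 1 / 2 - P.γ ∨ 1 / 2 + P.γ < ucb (activeOn F O P m ω) x)}

open Classical in
/-- Query indicator at time `t`. -/
noncomputable def queryInd (t : ℕ) (ω : ℕ → X × Bool) : ℝ :=
  (region F O P (epoch t) ω).indicator (fun _ => 1) (ω t).1

variable {F O P}

theorem activeSetAt_history {m t : ℕ} (h : epochStart m ≤ t) (ω : ℕ → X × Bool) :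
    activeSetAt F O P m ((algorithm F O P).history ω t) = activeOn F O P m ω := by
  rw [activeSetAt, past, activeOn, ← epochStart, ActiveLearner.take_history _ _ h]

theorem queries_iff (t : ℕ) (ω : ℕ → X × Bool) :
    (algorithm F O P).Queries ω t ↔ (ω t).1 ∈ region F O P (epoch t) ω := by
  change queryAt F O P (epoch ((algorithm F O P).history ω t).length)
    ((algorithm F O P).history ω t) (ω t).1 ↔ _
  rw [ActiveLearner.length_history, queryAt, classifierAt,
    activeSetAt_history (epochStart_epoch_le t)]
  simp only [region, Set.mem_ofPred_eq, Set.mem_Ioo, ne_eq]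
  constructor
  · rintro ⟨⟨h1, h2⟩, h3⟩
    refine ⟨h1, h2, ?_⟩
    by_contra! hc
    exact h3 (if_pos (Set.Icc_subset_Icc hc.1 hc.2))
  · rintro ⟨h1, h2, h3⟩
    refine ⟨⟨h1, h2⟩, ?_⟩
    rw [if_neg]
    · simp
    · rw [Set.Icc_subset_Icc_iff (h1.trans h2).le]
      rintro ⟨h4, h5⟩
      rcases h3 with h3 | h3 <;> linarith

theorem activeOn_congr {m : ℕ} {ω ω' : ℕ → X × Bool} (h : ∀ s < epochStart m, ω s = ω' s) :
    activeOn F O P m ω = activeOn F O P m ω' := by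
  rw [activeOn, activeOn, ActiveLearner.history_congr _ h]

theorem region_congr {m : ℕ} {ω ω' : ℕ → X × Bool} (h : ∀ s < epochStart m, ω s = ω' s) :
    region F O P m ω = region F O P m ω' := by
  rw [region, region, activeOn_congr h]

/-- Predictability: the current label does not influence whether it is queried. -/
theorem queryInd_congr (t : ℕ) (ω ω' : ℕ → X × Bool) (h : ∀ s < t, ω s = ω' s)
    (ht : (ω t).1 = (ω' t).1) : queryInd F O P t ω = queryInd F O P t ω' := by
  rw [queryInd, queryInd, ht,
    region_congr fun s hs => h s (hs.trans_le (epochStart_epoch_le t))]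

theorem queryInd_eq_zero_or_one (t : ℕ) (ω : ℕ → X × Bool) :
    queryInd F O P t ω = 0 ∨ queryInd F O P t ω = 1 := by
  unfold queryInd
  by_cases h : (ω t).1 ∈ region F O P (epoch t) ω <;> simp [h]

theorem queryInd_nonneg (t : ℕ) (ω : ℕ → X × Bool) : 0 ≤ queryInd F O P t ω := by
  rcases queryInd_eq_zero_or_one (F := F) (O := O) (P := P) t ω with h | h <;> rw [h]
  norm_num

theorem queryInd_le_one (t : ℕ) (ω : ℕ → X × Bool) : queryInd F O P t ω ≤ 1 := by
  rcases queryInd_eq_zero_or_one (F := F) (O := O) (P := P) t ω with h | h <;> rw [h]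
  norm_num

theorem sqLoss_algorithm (ω : ℕ → X × Bool) (t : ℕ) (f : X → ℝ) :
    sqLoss ((algorithm F O P).history ω t) f = ∑ s ∈ Finset.range t, queryInd F O P s ω *
      (f (ω s).1 - (if (ω s).2 then 1 else 0)) ^ 2 := by
  rw [ActiveLearner.sqLoss_history]
  refine Finset.sum_congr rfl fun s _ => ?_
  rw [queryInd]
  by_cases h : (ω s).1 ∈ region F O P (epoch s) ω
  · rw [if_pos ((queries_iff s ω).2 h), Set.indicator_of_mem h, one_mul]
  · rw [if_neg (mt (queries_iff s ω).1 h), Set.indicator_of_notMem h, zero_mul]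

theorem labels_algorithm (ω : ℕ → X × Bool) :
    ((algorithm F O P).labels ω : ℝ) =
      ∑ s ∈ Finset.range (epochStart P.M), queryInd F O P s ω := by
  rw [ActiveLearner.labels_eq_sum]
  refine Finset.sum_congr rfl fun s _ => ?_
  rw [queryInd]
  by_cases h : (ω s).1 ∈ region F O P (epoch s) ω
  · rw [if_pos ((queries_iff s ω).2 h), Set.indicator_of_mem h]
  · rw [if_neg (mt (queries_iff s ω).1 h), Set.indicator_of_notMem h]

section Bounds

variable {G : Set (X → ℝ)} {f : X → ℝ}

theorem lcb_le (hF : ∀ f ∈ F, ∀ x, f x ∈ Set.Icc (0 : ℝ) 1) (hG : G ⊆ F) (hf : f ∈ G) (x : X) :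
    lcb G x ≤ f x :=
  csInf_le ⟨0, by rintro _ ⟨g, hg, rfl⟩; exact (hF g (hG hg) x).1⟩ ⟨f, hf, rfl⟩

theorem le_ucb (hF : ∀ f ∈ F, ∀ x, f x ∈ Set.Icc (0 : ℝ) 1) (hG : G ⊆ F) (hf : f ∈ G) (x : X) :
    f x ≤ ucb G x :=
  le_csSup ⟨1, by rintro _ ⟨g, hg, rfl⟩; exact (hF g (hG hg) x).2⟩ ⟨f, hf, rfl⟩

theorem lcb_anti {G' : Set (X → ℝ)} (hF : ∀ f ∈ F, ∀ x, f x ∈ Set.Icc (0 : ℝ) 1) (hG : G ⊆ F)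
    (hGG : G' ⊆ G) (hne : G'.Nonempty) (x : X) : lcb G x ≤ lcb G' x :=
  csInf_le_csInf ⟨0, by rintro _ ⟨g, hg, rfl⟩; exact (hF g (hG hg) x).1⟩ (hne.image _)
    (Set.image_mono hGG)

theorem ucb_mono {G' : Set (X → ℝ)} (hF : ∀ f ∈ F, ∀ x, f x ∈ Set.Icc (0 : ℝ) 1) (hG : G ⊆ F)
    (hGG : G' ⊆ G) (hne : G'.Nonempty) (x : X) : ucb G' x ≤ ucb G x :=
  csSup_le_csSup ⟨1, by rintro _ ⟨g, hg, rfl⟩; exact (hF g (hG hg) x).2⟩ (hne.image _)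
    (Set.image_mono hGG)

end Bounds

section Measurability

variable [MeasurableSpace X]

theorem measurableSet_queries_of_past (hR : IsRegressionClass F O) {m : ℕ} (hβ : 0 ≤ P.β m)
    (hq : ∀ s < epochStart m, MeasurableSet {ω | (algorithm F O P).Queries ω s}) :
    MeasurableSet {p : (ℕ → X × Bool) × X | p.2 ∈ region F O P m p.1} := by
  have hl := measurable_comp_activeSet_history hR.oracle (algorithm F O P) hq (Λ := lcb)
    fun n => hR.measurable_lcb n _ hβ
  have hu := measurable_comp_activeSet_history hR.oracle (algorithm F O P) hq (Λ := ucb)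
    fun n => hR.measurable_ucb n _ hβ
  exact (measurableSet_lt hl measurable_const).inter ((measurableSet_lt measurable_const hu).inter
    ((measurableSet_lt hl measurable_const).union (measurableSet_lt measurable_const hu)))

/-- Strong induction is needed because the query at `t` depends on confidence bounds built from the
earlier queries. The restriction to epochs up to `M` keeps the radii `β` nonnegative. -/
theorem measurableSet_queries (hR : IsRegressionClass F O) (hβ : ∀ m ≤ P.M, 0 ≤ P.β m) {t : ℕ}
    (ht : epoch t ≤ P.M) : MeasurableSet {ω | (algorithm F O P).Queries ω t} := by
  induction t using Nat.strong_induction_on with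
  | _ t ih =>
    have hs := measurableSet_queries_of_past (F := F) (O := O) hR (hβ _ ht) (fun s hs =>
      ih s (hs.trans_le (epochStart_epoch_le t)) ((epoch_lt_of_lt_epochStart hs).le.trans ht))
    have hm : Measurable fun ω : ℕ → X × Bool => (ω, (ω t).1) :=
      measurable_id.prodMk (measurable_fst.comp (measurable_pi_apply t))
    have := hm hs
    simp only [queries_iff]
    exact this

theorem measurableSet_region_prod (hR : IsRegressionClass F O) (hβ : ∀ m ≤ P.M, 0 ≤ P.β m)
    {m : ℕ} (hm : m ≤ P.M) :
    MeasurableSet {p : (ℕ → X × Bool) × X | p.2 ∈ region F O P m p.1} :=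
  measurableSet_queries_of_past hR (hβ m hm) fun _ hs =>
    measurableSet_queries hR hβ ((epoch_lt_of_lt_epochStart hs).le.trans hm)

theorem measurableSet_region (hR : IsRegressionClass F O) (hβ : ∀ m ≤ P.M, 0 ≤ P.β m)
    {m : ℕ} (hm : m ≤ P.M) (ω : ℕ → X × Bool) : MeasurableSet (region F O P m ω) :=
  measurable_prodMk_left (x := ω) (measurableSet_region_prod hR hβ hm)

theorem measurable_queryInd (hR : IsRegressionClass F O) (hβ : ∀ m ≤ P.M, 0 ≤ P.β m) {t : ℕ}
    (ht : epoch t ≤ P.M) : Measurable (queryInd F O P t) := by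
  have h : queryInd F O P t = {ω | (algorithm F O P).Queries ω t}.indicator fun _ => 1 := by
    ext ω
    rw [queryInd]
    by_cases h : (ω t).1 ∈ region F O P (epoch t) ω
    · have h' : ω ∈ {ω | (algorithm F O P).Queries ω t} := (queries_iff t ω).2 h
      rw [Set.indicator_of_mem h, Set.indicator_of_mem h']
    · have h' : ω ∉ {ω | (algorithm F O P).Queries ω t} := mt (queries_iff t ω).1 h
      rw [Set.indicator_of_notMem h, Set.indicator_of_notMem h']
  rw [h]
  exact measurable_const.indicator (measurableSet_queries hR hβ ht)

theorem measurableSet_queries_of_lt_epochStart (hR : IsRegressionClass F O)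
    (hβ : ∀ m ≤ P.M, 0 ≤ P.β m) {m : ℕ} (hm : m ≤ P.M) {s : ℕ} (hs : s < epochStart m) :
    MeasurableSet {ω | (algorithm F O P).Queries ω s} :=
  measurableSet_queries hR hβ ((epoch_lt_of_lt_epochStart hs).le.trans hm)

theorem measurable_lcb_activeOn (hR : IsRegressionClass F O) (hβ : ∀ m ≤ P.M, 0 ≤ P.β m)
    {m : ℕ} (hm : m ≤ P.M) (ω : ℕ → X × Bool) : Measurable (lcb (activeOn F O P m ω)) := by
  have h1 : ∀ s < epochStart m, MeasurableSet {ω | (algorithm F O P).Queries ω s} :=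
    fun s hs => measurableSet_queries_of_lt_epochStart hR hβ hm hs
  have h := measurable_comp_activeSet_history hR.oracle (algorithm F O P) h1 (Λ := lcb)
    fun n => hR.measurable_lcb n _ (hβ m hm)
  unfold activeOn
  have h2 : Measurable fun x : X => (ω, x) := measurable_prodMk_left
  have h3 := h.comp h2
  exact h3

theorem measurable_ucb_activeOn (hR : IsRegressionClass F O) (hβ : ∀ m ≤ P.M, 0 ≤ P.β m)
    {m : ℕ} (hm : m ≤ P.M) (ω : ℕ → X × Bool) : Measurable (ucb (activeOn F O P m ω)) := by
  have h1 : ∀ s < epochStart m, MeasurableSet {ω | (algorithm F O P).Queries ω s} :=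
    fun s hs => measurableSet_queries_of_lt_epochStart hR hβ hm hs
  have h := measurable_comp_activeSet_history hR.oracle (algorithm F O P) h1 (Λ := ucb)
    fun n => hR.measurable_ucb n _ (hβ m hm)
  unfold activeOn
  have h2 : Measurable fun x : X => (ω, x) := measurable_prodMk_left
  have h3 := h.comp h2
  exact h3

end Measurability

end Region

/-! ### High-probability events -/

/-- Markov's inequality for the supremum of the exponentials. -/
theorem measure_exists_lt_le {Ω : Type u} [MeasurableSpace Ω] {μ : Measure Ω} {ι : Type v}
    [Countable ι] {Y : ι → Ω → ℝ} (hY : ∀ i, Measurable (Y i)) {C : ENNReal}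
    (h : ∫⁻ ω, ⨆ i, ENNReal.ofReal (Real.exp (Y i ω)) ∂μ ≤ C) (K : ℝ) :
    μ {ω | ∃ i, K < Y i ω} ≤ C * ENNReal.ofReal (Real.exp (-K)) := by
  have hm : Measurable fun ω => ⨆ i, ENNReal.ofReal (Real.exp (Y i ω)) :=
    Measurable.iSup fun i => (Real.measurable_exp.comp (hY i)).ennreal_ofReal
  have hK : ENNReal.ofReal (Real.exp K) ≠ 0 := by simp [Real.exp_pos]
  have h1 := (mul_meas_ge_le_lintegral hm (ENNReal.ofReal (Real.exp K))).trans h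
  have hsub : {ω | ∃ i, K < Y i ω} ⊆
      {ω | ENNReal.ofReal (Real.exp K) ≤ ⨆ i, ENNReal.ofReal (Real.exp (Y i ω))} := by
    rintro ω ⟨i, hi⟩
    exact (ENNReal.ofReal_le_ofReal (Real.exp_le_exp.2 hi.le)).trans
      (le_iSup (fun i => ENNReal.ofReal (Real.exp (Y i ω))) i)
  calc μ {ω | ∃ i, K < Y i ω} ≤ _ := measure_mono hsub
    _ = ENNReal.ofReal (Real.exp K) * μ {ω | ENNReal.ofReal (Real.exp K) ≤
        ⨆ i, ENNReal.ofReal (Real.exp (Y i ω))} * ENNReal.ofReal (Real.exp (-K)) := by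
        rw [Real.exp_neg, ENNReal.ofReal_inv_of_pos (Real.exp_pos _), mul_comm (ENNReal.ofReal _),
          mul_assoc, ENNReal.mul_inv_cancel hK ENNReal.ofReal_ne_top, mul_one]
    _ ≤ C * ENNReal.ofReal (Real.exp (-K)) := by gcongr

/-- Failure probability of a single high-probability event. -/
noncomputable def failBound (N d : ℕ) (K : ℝ) : ENNReal :=
  ENNReal.ofReal (Real.exp (3 / 2)) * ((N * (N + 1) + 1) ^ d : ℕ) * ENNReal.ofReal (Real.exp (-K))

section SqDist

variable {X : Type u} {η : X → ℝ}

/-- Squared distance of `f` and `η` on the region `R`. -/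
noncomputable def sqDist (R : Set X) (f η : X → ℝ) (x : X) : ℝ :=
  R.indicator (fun x => (f x - η x) ^ 2) x

theorem tendsto_sqDist {R : Set X} {g : ℕ → X → ℝ} {f : X → ℝ}
    (hlim : ∀ x, Filter.Tendsto (fun k => g k x) Filter.atTop (nhds (f x))) (x : X) :
    Filter.Tendsto (fun k => sqDist R (g k) η x) Filter.atTop (nhds (sqDist R f η x)) := by
  unfold sqDist
  by_cases hx : x ∈ R
  · simp only [Set.indicator_of_mem hx]
    exact ((hlim x).sub_const _).pow 2
  · simp [Set.indicator_of_notMem hx]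

theorem sqDist_mem_Icc {R : Set X} {f : X → ℝ} (hf : ∀ x, f x ∈ Set.Icc (0 : ℝ) 1)
    (hη : ∀ x, η x ∈ Set.Icc (0 : ℝ) 1) (x : X) : sqDist R f η x ∈ Set.Icc (0 : ℝ) 1 := by
  unfold sqDist
  by_cases hx : x ∈ R
  · rw [Set.indicator_of_mem hx]
    obtain ⟨h1, h2⟩ := hf x
    obtain ⟨h3, h4⟩ := hη x
    constructor <;> nlinarith
  · simp [Set.indicator_of_notMem hx]

theorem abs_sqDist_sub_le {R : Set X} {f g : X → ℝ} {x : X}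
    (hη : η x ∈ Set.Icc (0 : ℝ) 1) (hf : f x ∈ Set.Icc (0 : ℝ) 1)
    (hg : g x ∈ Set.Icc (0 : ℝ) 1) : |sqDist R f η x - sqDist R g η x| ≤ 2 * |f x - g x| := by
  unfold sqDist
  by_cases hx : x ∈ R
  · rw [Set.indicator_of_mem hx, Set.indicator_of_mem hx,
      show (f x - η x) ^ 2 - (g x - η x) ^ 2 = (f x + g x - 2 * η x) * (f x - g x) by ring, abs_mul]
    refine mul_le_mul_of_nonneg_right ?_ (abs_nonneg _)
    rw [abs_le]
    constructor <;> linarith [hη.1, hη.2, hf.1, hf.2, hg.1, hg.2]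
  · simp [Set.indicator_of_notMem hx]

end SqDist

section Noise

variable {X : Type u} (F : Set (X → ℝ)) (O : History X → X → ℝ) (P : Params) (η : X → ℝ) (K : ℝ)

/-- The label noise is controlled between the starts of the epochs `j` and `m`. -/
def NoiseGood (j m : ℕ) (ω : ℕ → X × Bool) : Prop :=
  ∀ f ∈ F, ∑ t ∈ Finset.Ico (epochStart j) (epochStart m),
    queryInd F O P t ω * noiseTerm f η (ω t) ≤ K

variable {F O P η K}

/-- The condition is closed under pointwise limits, so it suffices to control the countable class of
the separability hypothesis, for which suprema are measurable. -/
theorem NoiseGood.of_dense {F₀ : Set (X → ℝ)} (hF₀ : ∀ f ∈ F, ∃ g : ℕ → X → ℝ,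
      (∀ k, g k ∈ F₀) ∧ ∀ x, Filter.Tendsto (fun k => g k x) Filter.atTop (nhds (f x)))
    {j m : ℕ} {ω : ℕ → X × Bool}
    (h : ∀ f ∈ F₀, ∑ t ∈ Finset.Ico (epochStart j) (epochStart m),
      queryInd F O P t ω * noiseTerm f η (ω t) ≤ K) : NoiseGood F O P η K j m ω := by
  intro f hf
  obtain ⟨g, hg, hlim⟩ := hF₀ f hf
  have hlim' : Filter.Tendsto (fun k => ∑ t ∈ Finset.Ico (epochStart j) (epochStart m),
      queryInd F O P t ω * noiseTerm (g k) η (ω t)) Filter.atTop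
      (nhds (∑ t ∈ Finset.Ico (epochStart j) (epochStart m),
        queryInd F O P t ω * noiseTerm f η (ω t))) := by
    refine tendsto_finsetSum _ fun t _ => Filter.Tendsto.const_mul _ ?_
    exact (((hlim _).sub_const _).mul_const _).sub ((((hlim _).sub_const _).pow 2).div_const 4)
  exact le_of_tendsto' hlim' fun k => h (g k) (hg k)

end Noise

section Events

variable {X : Type u} [MeasurableSpace X]

variable (D : Measure (X × Bool)) (F : Set (X → ℝ)) (O : History X → X → ℝ) (P : Params)
  (η : X → ℝ) (K : ℝ)

/-- The expected squared distances on the query region of epoch `m` are controlled by the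
empirical ones. -/
def DevGood (m : ℕ) (ω : ℕ → X × Bool) : Prop :=
  ∀ f ∈ F, epochLen m * ∫ x, sqDist (region F O P m ω) f η x ∂D.fst ≤
    2 * ∑ t ∈ Finset.range (epochLen m),
      sqDist (region F O P m ω) f η (ω (epochStart m + t)).1 + 8 * K

/-- The number of queries of epoch `m` is controlled by its expectation. -/
def CountGood (m : ℕ) (ω : ℕ → X × Bool) : Prop :=
  ∑ t ∈ Finset.range (epochLen m), queryInd F O P (epochStart m + t) ω ≤
    2 * (epochLen m * D.fst.real (region F O P m ω)) + K

variable {D F O P η K} [IsProbabilityMeasure D]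

theorem measurable_sqDist {R : Set X} {f : X → ℝ} (hR : MeasurableSet R) (hf : Measurable f)
    (hη : Measurable η) : Measurable (sqDist R f η) :=
  ((hf.sub hη).pow_const 2).indicator hR

theorem DevGood.of_dense (hF : ∀ f ∈ F, ∀ x, f x ∈ Set.Icc (0 : ℝ) 1)
    (hFm : ∀ f ∈ F, Measurable f) (hη : η ∈ F) {F₀ : Set (X → ℝ)} (hsub : F₀ ⊆ F)
    (hF₀ : ∀ f ∈ F, ∃ g : ℕ → X → ℝ,
      (∀ k, g k ∈ F₀) ∧ ∀ x, Filter.Tendsto (fun k => g k x) Filter.atTop (nhds (f x)))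
    {m : ℕ} {ω : ℕ → X × Bool} (hR : MeasurableSet (region F O P m ω))
    (h : ∀ f ∈ F₀, epochLen m * ∫ x, sqDist (region F O P m ω) f η x ∂D.fst ≤
      2 * ∑ t ∈ Finset.range (epochLen m),
        sqDist (region F O P m ω) f η (ω (epochStart m + t)).1 + 8 * K) :
    DevGood D F O P η K m ω := by
  intro f hf
  obtain ⟨g, hg, hlim⟩ := hF₀ f hf
  refine le_of_tendsto_of_tendsto' (Filter.Tendsto.const_mul _ ?_)
    ((Filter.Tendsto.const_mul _ (tendsto_finsetSum _ fun t _ => tendsto_sqDist hlim _)).add_const _)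
    fun k => h (g k) (hg k)
  refine tendsto_integral_of_dominated_convergence (fun _ => 1)
    (fun k => (measurable_sqDist hR (hFm _ (hsub (hg k))) (hFm _ hη)).aestronglyMeasurable)
    (integrable_const _) (fun k => Filter.Eventually.of_forall fun x => ?_)
    (Filter.Eventually.of_forall fun x => tendsto_sqDist hlim x)
  have := sqDist_mem_Icc (R := region F O P m ω) (hF _ (hsub (hg k))) (hF _ hη) x
  rw [Real.norm_eq_abs, abs_of_nonneg this.1]
  exact this.2

variable {d N : ℕ}

theorem measure_not_noiseGood_le (hR : IsRegressionClass F O) (hηF : η ∈ F) (hη : IsCondProb D η)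
    (hd : pdim F ≤ d) (hβ : ∀ m ≤ P.M, 0 ≤ P.β m) (hK : 0 ≤ K) {j m : ℕ} (hm : m ≤ P.M)
    (hN : epochStart m ≤ N) :
    streamLaw D {ω | ¬ NoiseGood F O P η K j m ω} ≤ failBound N d K := by
  classical
  obtain ⟨F₀, hsub, hc, hdense⟩ := hR.separable
  have := hc.to_subtype
  rcases Nat.eq_zero_or_pos (epochStart m) with h0 | hpos
  · have : {ω | ¬ NoiseGood F O P η K j m ω} = ∅ := by
      ext ω
      simp [NoiseGood, h0, hK]
    rw [this, measure_empty]
    exact zero_le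
  -- Queries before epoch `j` are switched off. The indicator remains predictable, so the bound from
  -- time `0` yields the bound on a block of epochs.
  set q : ℕ → (ℕ → X × Bool) → ℝ := fun t ω =>
    if epochStart j ≤ t ∧ t < epochStart m then queryInd F O P t ω else 0 with hq
  have hqm : ∀ t, Measurable (q t) := by
    intro t
    by_cases ht : epochStart j ≤ t ∧ t < epochStart m
    · simp only [hq, if_pos ht]
      exact measurable_queryInd hR hβ ((epoch_lt_of_lt_epochStart ht.2).le.trans hm)
    · simp only [hq, if_neg ht]
      exact measurable_const
  have hsum : ∀ f ω, ∑ t ∈ Finset.range (epochStart m), q t ω * noiseTerm f η (ω t) =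
      ∑ t ∈ Finset.Ico (epochStart j) (epochStart m),
        queryInd F O P t ω * noiseTerm f η (ω t) := by
    intro f ω
    simp only [hq, ite_mul, zero_mul]
    rw [← Finset.sum_filter]
    refine Finset.sum_congr ?_ fun _ _ => rfl
    ext t
    simp only [Finset.mem_filter, Finset.mem_range, Finset.mem_Ico]
    tauto
  have hint := lintegral_iSup_noise_le hη (hR.mem_Icc η hηF) hc
    (fun f hf => hR.measurable f (hsub hf)) (fun f hf => hR.mem_Icc f (hsub hf))
    ((pdim_mono hsub).trans hd) (q := q) (fun t ω => by
      simp only [hq]; split_ifs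
      · exact queryInd_eq_zero_or_one t ω
      · exact Or.inl rfl) hqm (fun t ω ω' h1 h2 => by
        simp only [hq]; split_ifs
        · exact queryInd_congr t ω ω' h1 h2
        · rfl) hpos
  have hmark := measure_exists_lt_le (μ := streamLaw D)
    (Y := fun (f : F₀) ω => ∑ t ∈ Finset.range (epochStart m), q t ω * noiseTerm f η (ω t))
    (fun f => Finset.measurable_sum _ fun t _ => (hqm t).mul
      ((measurable_noiseTerm (hR.measurable f (hsub f.2)) hη.1).comp (measurable_pi_apply t)))
    hint K
  refine (measure_mono fun ω hω => ?_).trans (hmark.trans ?_)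
  · by_contra hcon
    refine hω (NoiseGood.of_dense hdense fun f hf => ?_)
    by_contra! hlt
    exact hcon ⟨⟨f, hf⟩, by rw [hsum]; exact hlt⟩
  · unfold failBound
    gcongr

theorem integral_fst_comp (D : Measure (X × Bool)) (h : X → ℝ) (hm : Measurable h) :
    ∫ z, h z.1 ∂D = ∫ x, h x ∂D.fst :=
  (integral_map measurable_fst.aemeasurable hm.aestronglyMeasurable).symm

/-- Conditionally on the stream before epoch `m` the region is a fixed set and the epoch is a fresh
i.i.d. sample, so the symmetrized deviation bound applies to the functions `sqDist`. -/
theorem measure_not_devGood_le (hR : IsRegressionClass F O) (hηF : η ∈ F)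
    (hd : pdim F ≤ d) (hβ : ∀ m ≤ P.M, 0 ≤ P.β m) {m : ℕ} (hm : m ≤ P.M) (hm1 : 1 ≤ m)
    (hN : 2 * epochLen m ≤ N) :
    streamLaw D {ω | ¬ DevGood D F O P η K m ω} ≤ failBound N d K := by
  classical
  obtain ⟨F₀, hsub, hc, hdense⟩ := hR.separable
  have := hc.to_subtype
  have hRm := measurableSet_region_prod (F := F) (O := O) hR hβ hm
  have hRω : ∀ ω, MeasurableSet (region F O P m ω) := measurableSet_region hR hβ hm
  have hηm := hR.measurable η hηF
  have hlen : 0 < epochLen m := lt_of_lt_of_le (by positivity) (two_pow_le_epochLen hm1)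
  set Y : F₀ → (ℕ → X × Bool) → ℝ := fun f ω => 1 / 8 *
    (epochLen m * ∫ x, sqDist (region F O P m ω) f η x ∂D.fst - 2 *
      ∑ t ∈ Finset.range (epochLen m), sqDist (region F O P m ω) f η (ω (epochStart m + t)).1)
    with hY
  have hjoint : ∀ f : F₀, Measurable fun p : (ℕ → X × Bool) × X =>
      sqDist (region F O P m p.1) f η p.2 := by
    intro f
    have e : (fun p : (ℕ → X × Bool) × X => sqDist (region F O P m p.1) f η p.2) =
        {p : (ℕ → X × Bool) × X | p.2 ∈ region F O P m p.1}.indicator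
          (fun p => (f.1 p.2 - η p.2) ^ 2) := by
      ext p
      by_cases hp : p.2 ∈ region F O P m p.1
      · have hp' : p ∈ {p : (ℕ → X × Bool) × X | p.2 ∈ region F O P m p.1} := hp
        rw [sqDist, Set.indicator_of_mem hp, Set.indicator_of_mem hp']
      · have hp' : p ∉ {p : (ℕ → X × Bool) × X | p.2 ∈ region F O P m p.1} := hp
        rw [sqDist, Set.indicator_of_notMem hp, Set.indicator_of_notMem hp']
    rw [e]
    exact ((((hR.measurable f (hsub f.2)).comp measurable_snd).sub
      (hηm.comp measurable_snd)).pow_const 2).indicator hRm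
  have hpt : ∀ t, Measurable fun ω : ℕ → X × Bool => (ω, (ω (epochStart m + t)).1) := fun t =>
    measurable_id.prodMk (measurable_fst.comp (measurable_pi_apply _))
  have hYm : ∀ f, Measurable (Y f) := by
    intro f
    have h1 : Measurable fun ω => ∫ x, sqDist (region F O P m ω) f η x ∂D.fst :=
      ((hjoint f).stronglyMeasurable.integral_prod_right').measurable
    refine ((h1.const_mul _).sub (Measurable.const_mul
      (Finset.measurable_sum _ fun t _ => ?_) _)).const_mul _
    have hcomp := (hjoint f).comp (hpt t)
    exact hcomp
  have hint : ∫⁻ ω, ⨆ f, ENNReal.ofReal (Real.exp (Y f ω)) ∂(streamLaw D) ≤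
      ENNReal.ofReal (Real.exp (3 / 2)) * ((N * (N + 1) + 1) ^ d : ℕ) := by
    have hYe : Measurable fun ω => ⨆ i, ENNReal.ofReal (Real.exp (Y i ω)) :=
      Measurable.iSup fun i => (Real.measurable_exp.comp (hYm i)).ennreal_ofReal
    rw [lintegral_glue D (epochStart m) hYe]
    refine (lintegral_mono (g := fun _ => ENNReal.ofReal (Real.exp (3 / 2)) *
      ((N * (N + 1) + 1) ^ d : ℕ)) fun ω => ?_).trans_eq (by simp)
    have hreg : ∀ ω', region F O P m (glue (epochStart m) ω ω') = region F O P m ω := fun ω' =>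
      region_congr fun s hs => by simp [glue, hs]
    have hgl : ∀ ω' t, glue (epochStart m) ω ω' (epochStart m + t) = ω' t := fun ω' t => by
      simp [glue]
    simp only [hY, hreg, hgl]
    have hdev := lintegral_iSup_deviation_le (D := D) (n := epochLen m)
      (B := (N * (N + 1) + 1) ^ d) (r := 1 / epochLen m)
      (h := fun (f : F₀) z => sqDist (region F O P m ω) f η z.1)
      (fun f => (measurable_sqDist (hRω ω) (hR.measurable f (hsub f.2)) hηm).comp measurable_fst)
      (fun f z => sqDist_mem_Icc (hR.mem_Icc f (hsub f.2)) (hR.mem_Icc η hηF) z.1) ?_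
    · simp only [integral_fst_comp D _
        (measurable_sqDist (hRω ω) (hR.measurable _ (hsub (Subtype.prop _))) hηm)] at hdev
      refine hdev.trans ?_
      gcongr
      field_simp
      norm_num
    · intro s hs
      -- Since `sqDist` is `2`-Lipschitz in `f`, a cover of radius `1 / (2 epochLen m)` gives the
      -- radius `r = 1 / epochLen m` for the squared distances.
      obtain ⟨G, hGF, hGc, hG⟩ := exists_finite_cover (fun f hf => hR.mem_Icc f (hsub hf))
        ((pdim_mono hsub).trans hd) (s.image Prod.fst) (K := 2 * epochLen m) (by omega)
      refine ⟨G.subtype (· ∈ F₀), ?_, fun f => ?_⟩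
      · rw [Finset.card_subtype]
        refine (Finset.card_filter_le _ _).trans (hGc.trans ?_)
        gcongr
        exact Finset.card_image_le.trans (hs.trans hN)
      · obtain ⟨g, hg, h⟩ := hG f f.2
        refine ⟨⟨g, hGF hg⟩, by simpa using hg, fun z hz => ?_⟩
        refine (abs_sqDist_sub_le (hR.mem_Icc η hηF _) (hR.mem_Icc f (hsub f.2) _)
          (hR.mem_Icc g (hsub (hGF hg)) _)).trans ?_
        refine (mul_le_mul_of_nonneg_left (h z.1 (Finset.mem_image_of_mem _ hz))
          (by norm_num)).trans_eq ?_
        push_cast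
        field_simp
  have hmark := measure_exists_lt_le hYm hint K
  refine (measure_mono fun ω hω => ?_).trans hmark
  by_contra hcon
  refine hω (DevGood.of_dense hR.mem_Icc hR.measurable hηF hsub hdense (hRω ω) fun f hf => ?_)
  by_contra! hlt
  refine hcon ⟨⟨f, hf⟩, ?_⟩
  simp only [hY]
  linarith

theorem measure_not_countGood_le (hR : IsRegressionClass F O) (hβ : ∀ m ≤ P.M, 0 ≤ P.β m) {m : ℕ}
    (hm : m ≤ P.M) (hm1 : 1 ≤ m) :
    streamLaw D {ω | ¬ CountGood D F O P K m ω} ≤ failBound N d K := by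
  classical
  have hRm := measurableSet_region_prod (F := F) (O := O) hR hβ hm
  have hRω : ∀ ω, MeasurableSet (region F O P m ω) := measurableSet_region hR hβ hm
  set Y : Unit → (ℕ → X × Bool) → ℝ := fun _ ω => ∑ t ∈ Finset.range (epochLen m),
    ((region F O P m ω).indicator (fun _ => (1 : ℝ)) (ω (epochStart m + t)).1 -
      2 * D.fst.real (region F O P m ω)) with hY
  have hind : Measurable fun p : (ℕ → X × Bool) × X =>
      (region F O P m p.1).indicator (fun _ => (1 : ℝ)) p.2 := by
    have e : (fun p : (ℕ → X × Bool) × X =>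
        (region F O P m p.1).indicator (fun _ => (1 : ℝ)) p.2) =
        {p : (ℕ → X × Bool) × X | p.2 ∈ region F O P m p.1}.indicator (fun _ => 1) := by
      ext p
      by_cases hp : p.2 ∈ region F O P m p.1
      · have hp' : p ∈ {p : (ℕ → X × Bool) × X | p.2 ∈ region F O P m p.1} := hp
        rw [Set.indicator_of_mem hp, Set.indicator_of_mem hp']
      · have hp' : p ∉ {p : (ℕ → X × Bool) × X | p.2 ∈ region F O P m p.1} := hp
        rw [Set.indicator_of_notMem hp, Set.indicator_of_notMem hp']
    rw [e]
    exact measurable_const.indicator hRm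
  have hreal : Measurable fun ω => D.fst.real (region F O P m ω) :=
    (measurable_measure_prodMk_left hRm).ennreal_toReal
  have hpt : ∀ t, Measurable fun ω : ℕ → X × Bool => (ω, (ω (epochStart m + t)).1) := fun t =>
    measurable_id.prodMk (measurable_fst.comp (measurable_pi_apply _))
  have hYm : ∀ i, Measurable (Y i) := fun _ => Finset.measurable_sum _ fun t _ =>
    (hind.comp (hpt t)).sub
      (hreal.const_mul 2)
  have hint : ∫⁻ ω, ⨆ i, ENNReal.ofReal (Real.exp (Y i ω)) ∂(streamLaw D) ≤ 1 := by
    have hYe : Measurable fun ω => ⨆ i, ENNReal.ofReal (Real.exp (Y i ω)) :=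
      Measurable.iSup fun i => (Real.measurable_exp.comp (hYm i)).ennreal_ofReal
    rw [lintegral_glue D (epochStart m) hYe]
    refine (lintegral_mono (g := fun _ => 1) fun ω => ?_).trans_eq (by simp)
    have hreg : ∀ ω', region F O P m (glue (epochStart m) ω ω') = region F O P m ω := fun ω' =>
      region_congr fun s hs => by simp [glue, hs]
    have hgl : ∀ ω' t, glue (epochStart m) ω ω' (epochStart m + t) = ω' t := fun ω' t => by
      simp [glue]
    simp only [hY, hreg, hgl, iSup_const]
    have hpre : MeasurableSet (Prod.fst ⁻¹' region F O P m ω : Set (X × Bool)) :=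
      measurable_fst (hRω ω)
    have hcount := lintegral_exp_count_le D hpre (epochLen m)
    have hreal' : D.real (Prod.fst ⁻¹' region F O P m ω) = D.fst.real (region F O P m ω) := by
      rw [measureReal_def, measureReal_def, Measure.fst_apply (hRω ω)]
    rw [hreal'] at hcount
    exact hcount
  have hmark := measure_exists_lt_le hYm hint K
  refine (measure_mono fun ω hω => ?_).trans (hmark.trans ?_)
  · refine ⟨(), ?_⟩
    simp only [CountGood, not_le, Set.mem_ofPred_eq] at hω
    simp only [hY, Finset.sum_sub_distrib, Finset.sum_const, Finset.card_range, nsmul_eq_mul]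
    have e : ∑ t ∈ Finset.range (epochLen m), queryInd F O P (epochStart m + t) ω =
        ∑ t ∈ Finset.range (epochLen m),
          (region F O P m ω).indicator (fun _ => (1 : ℝ)) (ω (epochStart m + t)).1 := by
      refine Finset.sum_congr rfl fun t ht => ?_
      have ht := Finset.mem_range.1 ht
      rw [queryInd, epoch_eq_of_mem hm1 (Nat.le_add_right _ _)
        (by rw [← epochStart_add_epochLen]; omega)]
    rw [← e]
    linarith
  · unfold failBound
    gcongr
    calc (1 : ENNReal) = 1 * 1 := (one_mul 1).symm
      _ ≤ _ := by
        gcongr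
        · rw [← ENNReal.ofReal_one]
          exact ENNReal.ofReal_le_ofReal (Real.one_le_exp (by norm_num))
        · exact_mod_cast Nat.one_le_pow _ _ (Nat.succ_pos _)

end Events

/-! ### Consequences of the disagreement coefficient -/

section Disagreement

variable {X : Type u} [MeasurableSpace X] {F : Set (X → ℝ)} {η : X → ℝ}

theorem le_theta {γ γ' ε : ℝ} (hη : η ∈ F) (hε : 0 < ε) (hγ : γ / 2 < γ') (μ : Measure X)
    [IsProbabilityMeasure μ] :
    ENNReal.ofReal (γ' ^ 2 / ε ^ 2) *
      μ {x | ∃ f ∈ F, |f x - η x| > γ' ∧ Real.sqrt (∫ x', (f x' - η x') ^ 2 ∂μ) ≤ ε} ≤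
    theta F γ := by
  unfold theta disagreementCoeff
  refine le_iSup₂_of_le η hη (le_iSup₂_of_le (ε / 2) (by linarith) (le_sup_of_le_left ?_))
  refine le_iSup₂_of_le μ inferInstance (le_iSup₂_of_le γ' hγ ?_)
  exact le_iSup₂_of_le ε (by linarith) le_rfl

theorem one_le_theta (hη : η ∈ F) (γ : ℝ) : 1 ≤ theta F γ := by
  unfold theta disagreementCoeff
  exact le_iSup₂_of_le η hη (le_iSup₂_of_le 1 one_pos le_sup_right)

theorem one_le_of_theta_le {γ θ : ℝ} (hη : η ∈ F) (h : theta F γ ≤ ENNReal.ofReal θ) : 1 ≤ θ := by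
  have := (one_le_theta hη γ).trans h
  rw [← ENNReal.ofReal_one] at this
  by_contra! hlt
  exact absurd ((ENNReal.ofReal_le_ofReal_iff' ).1 this) (by push Not; exact ⟨hlt, one_pos⟩)

/-- If every point of `R` is separated from `η` by some `f ∈ G` and all members of `G` are close
to `η` in mean square on `R`, then `R` has small probability. -/
theorem measureReal_le_of_theta_le {P : Measure X} [IsProbabilityMeasure P] {γ θ V : ℝ}
    (hη : η ∈ F) (hγ : 0 < γ) (hV : 0 < V)
    (hθ : theta F γ ≤ ENNReal.ofReal θ) {R : Set X} (hR : MeasurableSet R) {G : Set (X → ℝ)}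
    (hG : G ⊆ F) (hsep : ∀ x ∈ R, ∃ f ∈ G, γ / 2 < |f x - η x|)
    (hclose : ∀ f ∈ G, ∫ x, sqDist R f η x ∂P ≤ V) :
    P.real R ≤ 4 * θ * V / γ ^ 2 := by
  have hθ1 := one_le_of_theta_le hη hθ
  rcases eq_or_ne (P R) 0 with h0 | h0
  · rw [measureReal_def, h0]
    simp only [ENNReal.toReal_zero]
    positivity
  have hp : 0 < P.real R := ENNReal.toReal_pos h0 (measure_ne_top _ _)
  -- The coefficient ranges over all probability measures, so it may be used for the conditional law
  -- on `R`. There the `L²` distance sees only the region, where closeness is known, and `R` itself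
  -- has mass one.
  set μ : Measure X := ProbabilityTheory.cond P R with hμ
  have : IsProbabilityMeasure μ := ProbabilityTheory.cond_isProbabilityMeasure h0
  set ε := Real.sqrt (V / P.real R) with hε
  have hVp : 0 < V / P.real R := by positivity
  have hε0 : 0 < ε := Real.sqrt_pos.2 hVp
  have hε2 : ε ^ 2 = V / P.real R := Real.sq_sqrt hVp.le
  have hnorm : ∀ f ∈ G, Real.sqrt (∫ x', (f x' - η x') ^ 2 ∂μ) ≤ ε := by
    intro f hf
    refine Real.sqrt_le_sqrt ?_
    rw [hμ, ProbabilityTheory.cond, integral_smul_measure, ← integral_indicator hR, smul_eq_mul,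
      ENNReal.toReal_inv, ← measureReal_def, inv_mul_eq_div]
    exact div_le_div_of_nonneg_right (hclose f hf) hp.le
  -- The coefficient only allows scales strictly above `γ / 2`. Scales decreasing to `γ / 2` and
  -- continuity from below of `μ` recover the boundary scale.
  set g : ℕ → ℝ := fun k => γ / 2 + 1 / ((k : ℝ) + 1) with hg
  set S : ℕ → Set X := fun k => {x | ∃ f ∈ F, |f x - η x| > g k ∧
    Real.sqrt (∫ x', (f x' - η x') ^ 2 ∂μ) ≤ ε} with hS
  have hganti : Antitone g := by
    intro a b hab
    simp only [hg]
    have : (a : ℝ) ≤ b := by exact_mod_cast hab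
    gcongr
  have hmono : Monotone S := by
    rintro a b hab x ⟨f, hf, h1, h2⟩
    exact ⟨f, hf, lt_of_le_of_lt (hganti hab) h1, h2⟩
  have hgt : ∀ k, γ / 2 < g k := fun k => by
    simp only [hg]
    have : (0 : ℝ) < 1 / ((k : ℝ) + 1) := by positivity
    linarith
  have hRS : R ⊆ ⋃ k, S k := by
    intro x hx
    obtain ⟨f, hf, h⟩ := hsep x hx
    obtain ⟨k, hk⟩ := exists_nat_one_div_lt (sub_pos.2 h)
    refine Set.mem_iUnion.2 ⟨k, f, hG hf, ?_, hnorm f hf⟩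
    simp only [hg, gt_iff_lt]
    linarith
  have hμR : μ R = 1 := by
    rw [hμ, ProbabilityTheory.cond_apply hR, Set.inter_self]
    exact ENNReal.inv_mul_cancel h0 (measure_ne_top _ _)
  have hU : 1 ≤ ⨆ k, μ (S k) := by
    rw [← hmono.measure_iUnion, ← hμR]
    exact measure_mono hRS
  have hk : ∀ k, ENNReal.ofReal (γ ^ 2 / 4 / ε ^ 2) * μ (S k) ≤ ENNReal.ofReal θ := by
    intro k
    refine le_trans ?_ ((le_theta hη hε0 (hgt k) μ).trans hθ)
    gcongr
    nlinarith [hgt k]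
  have hfin : ENNReal.ofReal (γ ^ 2 / 4 / ε ^ 2) ≤ ENNReal.ofReal θ := by
    calc _ ≤ ENNReal.ofReal (γ ^ 2 / 4 / ε ^ 2) * ⨆ k, μ (S k) := le_mul_of_one_le_right' hU
      _ = ⨆ k, ENNReal.ofReal (γ ^ 2 / 4 / ε ^ 2) * μ (S k) := ENNReal.mul_iSup _ _
      _ ≤ _ := iSup_le hk
  rw [ENNReal.ofReal_le_ofReal_iff (by linarith), hε2] at hfin
  rw [le_div_iff₀ (by positivity)]
  rw [div_div_eq_mul_div, div_le_iff₀ hV] at hfin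
  linarith

end Disagreement

/-! ### Excess error -/

section Excess

variable {X : Type u} [MeasurableSpace X] {D : Measure (X × Bool)} [IsProbabilityMeasure D]
  {η : X → ℝ}

theorem err_eq_integral (hη : IsCondProb D η) (h01 : ∀ x, η x ∈ Set.Icc (0 : ℝ) 1)
    {p : RandClassifier X} (hp : Measurable p) :
    err D p = ∫ x, ((1 - η x) * p x + η x * (1 - p x)) ∂D.fst := by
  have hpm : Measurable fun x => (p x : ℝ) := measurable_subtype_coe.comp hp
  have hφ : Measurable fun z : X × Bool => if z.2 then 1 - (p z.1 : ℝ) else (p z.1 : ℝ) :=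
    Measurable.ite (measurable_snd (measurableSet_singleton true))
      (measurable_const.sub (hpm.comp measurable_fst)) (hpm.comp measurable_fst)
  have hψ : Measurable fun x => (1 - η x) * (p x : ℝ) + η x * (1 - p x) :=
    ((measurable_const.sub hη.1).mul hpm).add (hη.1.mul (measurable_const.sub hpm))
  have hψ' : Measurable fun z : X × Bool => (1 - η z.1) * (p z.1 : ℝ) + η z.1 * (1 - p z.1) :=
    hψ.comp measurable_fst
  rw [err, ← integral_fst_comp D _ hψ, integral_eq_lintegral_of_nonneg_ae _
    hφ.aestronglyMeasurable, integral_eq_lintegral_of_nonneg_ae _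
    hψ'.aestronglyMeasurable, ← lintegral_resample hη h01 hφ.ennreal_ofReal]
  · congr 1
    refine lintegral_congr fun z => ?_
    obtain ⟨h1, h2⟩ := h01 z.1
    obtain ⟨h3, h4⟩ := (p z.1).2
    simp only [Bool.false_eq_true, if_false, if_true]
    rw [← ENNReal.ofReal_mul (by linarith), ← ENNReal.ofReal_mul h1,
      ← ENNReal.ofReal_add (mul_nonneg (by linarith) h3) (mul_nonneg h1 (by linarith))]
  · refine Filter.Eventually.of_forall fun z => ?_
    obtain ⟨h1, h2⟩ := h01 z.1
    obtain ⟨h3, h4⟩ := (p z.1).2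
    exact add_nonneg (mul_nonneg (by linarith) h3) (mul_nonneg h1 (by linarith))
  · refine Filter.Eventually.of_forall fun z => ?_
    obtain ⟨h3, h4⟩ := (p z.1).2
    simp only [Pi.zero_apply]
    split_ifs <;> linarith

theorem measurable_plugIn {f : X → ℝ} (hf : Measurable f) : Measurable (plugIn f) := by
  unfold plugIn
  exact Measurable.ite (measurableSet_le measurable_const ((hf.const_mul 2).sub_const 1))
    measurable_const measurable_const

theorem integrable_of_mem_Icc {Ω : Type u} [MeasurableSpace Ω] {μ : Measure Ω} [IsFiniteMeasure μ]
    {g : Ω → ℝ} (hg : Measurable g) {a b : ℝ} (h : ∀ x, g x ∈ Set.Icc a b) : Integrable g μ :=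
  Integrable.of_bound hg.aestronglyMeasurable (max |a| |b|)
    (Filter.Eventually.of_forall fun x => abs_le_max_abs_abs (h x).1 (h x).2)

theorem excess_eq_integral (hη : IsCondProb D η) (h01 : ∀ x, η x ∈ Set.Icc (0 : ℝ) 1)
    {p : RandClassifier X} (hp : Measurable p) :
    excess D η p = ∫ x, (1 - 2 * η x) * ((p x : ℝ) - plugIn η x) ∂D.fst := by
  have hint : ∀ {p : RandClassifier X}, Measurable p →
      Integrable (fun x => (1 - η x) * (p x : ℝ) + η x * (1 - p x)) D.fst := by
    intro p hp
    have hpm : Measurable fun x => (p x : ℝ) := measurable_subtype_coe.comp hp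
    refine integrable_of_mem_Icc (a := 0) (b := 1)
      (((measurable_const.sub hη.1).mul hpm).add (hη.1.mul (measurable_const.sub hpm))) fun x => ?_
    obtain ⟨h1, h2⟩ := h01 x
    obtain ⟨h3, h4⟩ := (p x).2
    constructor <;> nlinarith [mul_nonneg h1 h3, mul_nonneg h1 (by linarith : 0 ≤ 1 - (p x : ℝ)),
      mul_nonneg h3 (by linarith : 0 ≤ 1 - η x),
      mul_nonneg (by linarith : 0 ≤ 1 - η x) (by linarith : 0 ≤ 1 - (p x : ℝ))]
  rw [excess, err_eq_integral hη h01 hp, err_eq_integral hη h01 (measurable_plugIn hη.1),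
    ← integral_sub (hint hp) (hint (measurable_plugIn hη.1))]
  refine integral_congr_ae (Filter.Eventually.of_forall fun x => ?_)
  simp only
  ring

end Excess

/-! ### The algorithm on a good stream -/

theorem Params.β_succ (P : Params) (m : ℕ) : P.β (m + 1) = P.β m - P.Cδ := by
  unfold Params.β; push_cast; ring

theorem Params.Cδ_le_β {P : Params} (hC : 0 ≤ P.Cδ) {m : ℕ} (hm : m ≤ P.M) : P.Cδ ≤ P.β m := by
  have : (m : ℝ) ≤ P.M := by exact_mod_cast hm
  unfold Params.β
  nlinarith

section ActiveOn

variable {X : Type u} {F : Set (X → ℝ)} {O : History X → X → ℝ} {P : Params} {η : X → ℝ}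

theorem activeOn_subset (m : ℕ) (ω : ℕ → X × Bool) : activeOn F O P m ω ⊆ F := fun _ h => h.1

theorem oracle_mem_activeOn (hO : IsRegressionOracle F O) {m : ℕ} (hβ : 0 ≤ P.β m)
    (ω : ℕ → X × Bool) :
    O ((algorithm F O P).history ω (epochStart m)) ∈ activeOn F O P m ω :=
  ⟨(hO _).1, by linarith⟩

/-- Half of the squared distance is kept as a gain; the other half is the compensator hidden in
`noiseTerm`. -/
theorem sqLoss_sub_sqLoss (f : X → ℝ) (t : ℕ) (ω : ℕ → X × Bool) :
    sqLoss ((algorithm F O P).history ω t) f - sqLoss ((algorithm F O P).history ω t) η =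
      ∑ s ∈ Finset.range t, (queryInd F O P s ω * (f (ω s).1 - η (ω s).1) ^ 2 / 2 -
        2 * (queryInd F O P s ω * noiseTerm f η (ω s))) := by
  rw [sqLoss_algorithm, sqLoss_algorithm, ← Finset.sum_sub_distrib]
  refine Finset.sum_congr rfl fun s _ => ?_
  unfold noiseTerm
  ring

end ActiveOn

/-- The class is regular, contains `η`, and all concentration bounds hold on the stream `ω`. -/
structure GoodStream {X : Type u} [MeasurableSpace X] (D : Measure (X × Bool)) (F : Set (X → ℝ))
    (O : History X → X → ℝ) (P : Params) (η : X → ℝ) (K : ℝ) (ω : ℕ → X × Bool) : Prop where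
  reg : IsRegressionClass F O
  mem : η ∈ F
  nonneg : 0 ≤ K
  le_Cδ : 8 * K ≤ P.Cδ
  noise : ∀ j m, j ≤ m → m ≤ P.M → NoiseGood F O P η K j m ω
  dev : ∀ m, 1 ≤ m → m < P.M → DevGood D F O P η K m ω
  count : ∀ m, 1 ≤ m → m < P.M → CountGood D F O P K m ω

namespace GoodStream

variable {X : Type u} [MeasurableSpace X] {D : Measure (X × Bool)} {F : Set (X → ℝ)}
  {O : History X → X → ℝ} {P : Params} {η : X → ℝ} {K : ℝ} {ω : ℕ → X × Bool}

section

theorem Cδ_nonneg (hg : GoodStream D F O P η K ω) : 0 ≤ P.Cδ := by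
  linarith [hg.nonneg, hg.le_Cδ]

theorem β_nonneg (hg : GoodStream D F O P η K ω) {m : ℕ} (hm : m ≤ P.M) : 0 ≤ P.β m :=
  hg.Cδ_nonneg.trans (Params.Cδ_le_β hg.Cδ_nonneg hm)

theorem measurableSet_region (hg : GoodStream D F O P η K ω) {m : ℕ} (hm : m ≤ P.M) :
    MeasurableSet (region F O P m ω) :=
  ActiveLearning.measurableSet_region hg.reg (fun _ h => hg.β_nonneg h) hm ω

theorem le_sqLoss_sub (hg : GoodStream D F O P η K ω) {f : X → ℝ} (hf : f ∈ F) {m : ℕ}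
    (hm : m ≤ P.M) :
    (∑ s ∈ Finset.range (epochStart m), queryInd F O P s ω * (f (ω s).1 - η (ω s).1) ^ 2) / 2 -
      2 * K ≤ sqLoss ((algorithm F O P).history ω (epochStart m)) f -
        sqLoss ((algorithm F O P).history ω (epochStart m)) η := by
  rw [sqLoss_sub_sqLoss, Finset.sum_sub_distrib, ← Finset.sum_div, ← Finset.mul_sum]
  have h := hg.noise 0 m (Nat.zero_le _) hm f hf
  rw [show epochStart 0 = 0 from rfl, ← Finset.range_eq_Ico] at h
  linarith

theorem sqLoss_sub_mono (hg : GoodStream D F O P η K ω) {f : X → ℝ} (hf : f ∈ F) {m : ℕ}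
    (hm : m + 1 ≤ P.M) :
    sqLoss ((algorithm F O P).history ω (epochStart m)) f -
        sqLoss ((algorithm F O P).history ω (epochStart m)) η - 2 * K ≤
      sqLoss ((algorithm F O P).history ω (epochStart (m + 1))) f -
        sqLoss ((algorithm F O P).history ω (epochStart (m + 1))) η := by
  rw [sqLoss_sub_sqLoss, sqLoss_sub_sqLoss,
    ← Finset.sum_range_add_sum_Ico _ (epochStart_mono m.le_succ), Finset.sum_sub_distrib (s :=
      Finset.Ico (epochStart m) (epochStart m.succ)), ← Finset.mul_sum]
  have h := hg.noise m (m + 1) m.le_succ hm f hf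
  have h2 : 0 ≤ ∑ s ∈ Finset.Ico (epochStart m) (epochStart (m + 1)),
      queryInd F O P s ω * (f (ω s).1 - η (ω s).1) ^ 2 / 2 :=
    Finset.sum_nonneg fun s _ => div_nonneg (mul_nonneg (queryInd_nonneg s ω) (sq_nonneg _))
      two_pos.le
  simp only [Nat.succ_eq_add_one]
  linarith

theorem sqLoss_le (hg : GoodStream D F O P η K ω) {f : X → ℝ} (hf : f ∈ F) {m : ℕ}
    (hm : m ≤ P.M) :
    sqLoss ((algorithm F O P).history ω (epochStart m)) η ≤
      sqLoss ((algorithm F O P).history ω (epochStart m)) f + 2 * K := by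
  have h1 := hg.le_sqLoss_sub hf hm
  have h2 : 0 ≤ ∑ s ∈ Finset.range (epochStart m), queryInd F O P s ω *
      (f (ω s).1 - η (ω s).1) ^ 2 :=
    Finset.sum_nonneg fun s _ => mul_nonneg (queryInd_nonneg s ω) (sq_nonneg _)
  linarith

theorem mem_activeOn (hg : GoodStream D F O P η K ω) {m : ℕ} (hm : m ≤ P.M) :
    η ∈ activeOn F O P m ω := by
  refine ⟨hg.mem, ?_⟩
  have h1 := hg.sqLoss_le (hg.reg.oracle ((algorithm F O P).history ω (epochStart m))).1 hm
  have h3 := Params.Cδ_le_β hg.Cδ_nonneg hm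
  linarith [hg.nonneg, hg.le_Cδ]

/-- Going back one epoch costs `2 K` for the noise of that epoch and `2 K` for comparing `η` with
the least squares solution. The drop `Cδ ≥ 8 K` of `β` pays for both. -/
theorem activeOn_anti (hg : GoodStream D F O P η K ω) {m : ℕ} (hm : m + 1 ≤ P.M) :
    activeOn F O P (m + 1) ω ⊆ activeOn F O P m ω := by
  intro f hf
  refine ⟨hf.1, ?_⟩
  have h1 := hf.2
  have h2 := (hg.reg.oracle ((algorithm F O P).history ω (epochStart (m + 1)))).2 η hg.mem
  have h3 := hg.sqLoss_sub_mono hf.1 hm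
  have h4 := hg.sqLoss_le (hg.reg.oracle ((algorithm F O P).history ω (epochStart m))).1
    (m.le_succ.trans hm)
  rw [Params.β_succ] at h1
  linarith [hg.nonneg, hg.le_Cδ]

theorem region_anti (hg : GoodStream D F O P η K ω) {m : ℕ} (hm : m + 1 ≤ P.M) :
    region F O P (m + 1) ω ⊆ region F O P m ω := by
  rintro x ⟨h1, h2, h3⟩
  have hl := lcb_anti hg.reg.mem_Icc (activeOn_subset m ω) (hg.activeOn_anti hm)
    ⟨η, hg.mem_activeOn hm⟩ x
  have hu := ucb_mono hg.reg.mem_Icc (activeOn_subset m ω) (hg.activeOn_anti hm)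
    ⟨η, hg.mem_activeOn hm⟩ x
  exact ⟨hl.trans_lt h1, h2.trans_le hu, h3.imp hl.trans_lt fun h => h.trans_le hu⟩

/-- During epoch `m` exactly the points of its region are queried, so the empirical squared distance
there is part of the queried one. That one is at most `2 β (m + 1) + 4 K` for an active `f`; the
deviation bound doubles this and adds `8 K`, and `8 K ≤ β (m + 1)`. -/
theorem integral_sqDist_le (hg : GoodStream D F O P η K ω) {m : ℕ} (hm1 : 1 ≤ m)
    (hm : m + 1 ≤ P.M) {f : X → ℝ} (hf : f ∈ activeOn F O P (m + 1) ω) :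
    (2 : ℝ) ^ (m - 1) * ∫ x, sqDist (region F O P m ω) f η x ∂D.fst ≤ 8 * P.β (m + 1) := by
  have h1 := hg.le_sqLoss_sub hf.1 hm
  have h2 := (hg.reg.oracle ((algorithm F O P).history ω (epochStart (m + 1)))).2 η hg.mem
  have h3 := hf.2
  have h4 := Params.Cδ_le_β hg.Cδ_nonneg hm
  have h5 := hg.dev m hm1 hm f hf.1
  have h6 : ∑ t ∈ Finset.range (epochLen m),
      sqDist (region F O P m ω) f η (ω (epochStart m + t)).1 =
      ∑ t ∈ Finset.Ico (epochStart m) (epochStart (m + 1)),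
        queryInd F O P t ω * (f (ω t).1 - η (ω t).1) ^ 2 := by
    rw [Finset.sum_Ico_eq_sum_range]
    refine Finset.sum_congr rfl fun t ht => ?_
    have ht := Finset.mem_range.1 ht
    rw [sqDist, queryInd, epoch_eq_of_mem hm1 (Nat.le_add_right _ _)
      (by have := epochStart_add_epochLen m; omega)]
    by_cases hx : (ω (epochStart m + t)).1 ∈ region F O P m ω
    · rw [Set.indicator_of_mem hx, Set.indicator_of_mem hx, one_mul]
    · rw [Set.indicator_of_notMem hx, Set.indicator_of_notMem hx, zero_mul]
  rw [h6] at h5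
  have h7 := Finset.sum_range_add_sum_Ico (fun t => queryInd F O P t ω *
    (f (ω t).1 - η (ω t).1) ^ 2) (epochStart_mono m.le_succ)
  have h8 : 0 ≤ ∑ s ∈ Finset.range (epochStart m), queryInd F O P s ω *
      (f (ω s).1 - η (ω s).1) ^ 2 :=
    Finset.sum_nonneg fun s _ => mul_nonneg (queryInd_nonneg s ω) (sq_nonneg _)
  have h9 : 0 ≤ ∫ x, sqDist (region F O P m ω) f η x ∂D.fst := integral_nonneg fun x =>
    (sqDist_mem_Icc (hg.reg.mem_Icc f hf.1) (hg.reg.mem_Icc η hg.mem) x).1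
  have h10 : (2 : ℝ) ^ (m - 1) ≤ epochLen m := by exact_mod_cast two_pow_le_epochLen hm1
  have h11 := mul_le_mul_of_nonneg_right h10 h9
  simp only [Nat.succ_eq_add_one] at h7
  linarith [hg.nonneg, hg.le_Cδ]

/-- In the region the confidence interval contains `1/2` and reaches beyond `1/2 ± γ` on one side,
so it is longer than `γ`. One of its ends is then at least half its length away from `η x`. -/
theorem exists_far (hg : GoodStream D F O P η K ω) {m : ℕ} (hm : m ≤ P.M) {x : X}
    (hx : x ∈ region F O P m ω) : ∃ f ∈ activeOn F O P m ω, P.γ / 2 < |f x - η x| := by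
  obtain ⟨h1, h2, h3⟩ := hx
  have hη := hg.mem_activeOn hm
  have hne : ((fun f : X → ℝ => f x) '' activeOn F O P m ω).Nonempty := ⟨_, η, hη, rfl⟩
  have h4 : P.γ < ucb (activeOn F O P m ω) x - lcb (activeOn F O P m ω) x := by
    rcases h3 with h3 | h3 <;> linarith
  rcases lt_or_ge (P.γ / 2) (ucb (activeOn F O P m ω) x - η x) with h5 | h5
  · obtain ⟨_, ⟨f, hf, rfl⟩, hlt⟩ := exists_lt_of_lt_csSup hne
      (show η x + P.γ / 2 < sSup _ by unfold ucb at h5; linarith)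
    refine ⟨f, hf, lt_of_lt_of_le ?_ (le_abs_self _)⟩
    simp only at hlt
    linarith
  · obtain ⟨_, ⟨f, hf, rfl⟩, hlt⟩ := exists_lt_of_csInf_lt hne
      (show sInf _ < η x - P.γ / 2 by unfold ucb lcb at *; linarith)
    refine ⟨f, hf, lt_of_lt_of_le ?_ (neg_le_abs _)⟩
    simp only at hlt
    linarith

end

variable [IsProbabilityMeasure D]

theorem integral_sqDist_anti (hg : GoodStream D F O P η K ω) {m : ℕ} (hm : m + 1 ≤ P.M)
    {f : X → ℝ} (hf : f ∈ F) :
    ∫ x, sqDist (region F O P (m + 1) ω) f η x ∂D.fst ≤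
      ∫ x, sqDist (region F O P m ω) f η x ∂D.fst := by
  have hint : ∀ k ≤ P.M, Integrable (sqDist (region F O P k ω) f η) D.fst := fun k hk =>
    integrable_of_mem_Icc (measurable_sqDist (hg.measurableSet_region hk)
      (hg.reg.measurable f hf) (hg.reg.measurable η hg.mem))
      (sqDist_mem_Icc (hg.reg.mem_Icc f hf) (hg.reg.mem_Icc η hg.mem))
  refine integral_mono (hint _ hm) (hint _ (m.le_succ.trans hm)) fun x => ?_
  exact Set.indicator_le_indicator_of_subset (hg.region_anti hm) (fun _ => sq_nonneg _) x

/-- The estimate for epoch `m + 1` relies on labels collected in epoch `m`, transferred to the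
smaller region by nestedness. Hence nothing is claimed for the first epoch. -/
theorem measureReal_region_le (hg : GoodStream D F O P η K ω) (hC : 0 < P.Cδ) (hγ : 0 < P.γ)
    {θ : ℝ} (hθ : theta F P.γ ≤ ENNReal.ofReal θ) {m : ℕ} (hm1 : 1 ≤ m) (hm : m + 1 ≤ P.M) :
    D.fst.real (region F O P (m + 1) ω) ≤ 32 * θ * P.β (m + 1) / (P.γ ^ 2 * 2 ^ (m - 1)) := by
  have hβ : 0 < P.β (m + 1) := hC.trans_le (Params.Cδ_le_β hC.le hm)
  have h2 : (0 : ℝ) < 2 ^ (m - 1) := by positivity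
  have h := measureReal_le_of_theta_le (P := D.fst) (V := 8 * P.β (m + 1) / 2 ^ (m - 1)) hg.mem hγ
    (by positivity) hθ (hg.measurableSet_region hm) (activeOn_subset (m + 1) ω)
    (fun x hx => hg.exists_far hm hx) (fun f hf => by
      rw [le_div_iff₀ h2, mul_comm]
      exact (mul_le_mul_of_nonneg_left (hg.integral_sqDist_anti hm hf.1) h2.le).trans
        (hg.integral_sqDist_le hm1 hm hf))
  refine h.trans_eq ?_
  field_simp
  ring

theorem sum_queryInd_epoch_le (hg : GoodStream D F O P η K ω) (hC : 0 < P.Cδ) (hγ : 0 < P.γ)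
    (hγ1 : P.γ < 1) {θ : ℝ} (hθ : theta F P.γ ≤ ENNReal.ofReal θ) {m : ℕ} (hm2 : 2 ≤ m)
    (hm : m < P.M) :
    ∑ t ∈ Finset.Ico (epochStart m) (epochStart (m + 1)), queryInd F O P t ω ≤
      129 * θ * P.β m / P.γ ^ 2 := by
  obtain ⟨k, rfl⟩ : ∃ k, m = k + 1 := ⟨m - 1, by omega⟩
  have hβC := Params.Cδ_le_β hC.le hm.le
  have hθ1 := one_le_of_theta_le hg.mem hθ
  have h1 := hg.count (k + 1) (by omega) hm
  have h2 := hg.measureReal_region_le hC hγ hθ (show 1 ≤ k by omega) hm.le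
  rw [Finset.sum_Ico_eq_sum_range]
  refine h1.trans ?_
  have hlen : (epochLen (k + 1) : ℝ) = 2 * 2 ^ (k - 1) := by
    rw [epochLen_of_two_le hm2]
    obtain ⟨l, rfl⟩ : ∃ l, k = l + 1 := ⟨k - 1, by omega⟩
    push_cast
    ring
  have h3 : epochLen (k + 1) * D.fst.real (region F O P (k + 1) ω) ≤
      64 * θ * P.β (k + 1) / P.γ ^ 2 := by
    rw [hlen]
    calc 2 * 2 ^ (k - 1) * D.fst.real (region F O P (k + 1) ω)
        ≤ 2 * 2 ^ (k - 1) * (32 * θ * P.β (k + 1) / (P.γ ^ 2 * 2 ^ (k - 1))) := by gcongr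
      _ = _ := by field_simp; ring
  have h4 : K ≤ θ * P.β (k + 1) / P.γ ^ 2 := by
    rw [le_div_iff₀ (by positivity)]
    have h5 : P.γ ^ 2 ≤ 1 := by nlinarith
    have h6 : K * P.γ ^ 2 ≤ K := mul_le_of_le_one_right hg.nonneg h5
    have h7 : P.β (k + 1) ≤ θ * P.β (k + 1) := le_mul_of_one_le_left (by linarith) hθ1
    linarith [hg.nonneg, hg.le_Cδ]
  calc 2 * (epochLen (k + 1) * D.fst.real (region F O P (k + 1) ω)) + K
      ≤ 2 * (64 * θ * P.β (k + 1) / P.γ ^ 2) + θ * P.β (k + 1) / P.γ ^ 2 := by linarith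
    _ = _ := by ring

/-- Label complexity: trivial count before epoch `M - k`, disagreement bound afterwards. -/
theorem labels_le (hg : GoodStream D F O P η K ω) (hC : 0 < P.Cδ) (hγ : 0 < P.γ)
    (hγ1 : P.γ < 1) {θ : ℝ} (hθ : theta F P.γ ≤ ENNReal.ofReal θ) {k : ℕ} (hk : k + 2 ≤ P.M) :
    ((algorithm F O P).labels ω : ℝ) ≤
      2 ^ (P.M - k - 1) + k * (129 * θ * ((k + 1) * P.Cδ) / P.γ ^ 2) := by
  have hθ1 := one_le_of_theta_le hg.mem hθ
  rw [labels_algorithm]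
  have hstep : ∀ j ≤ k, ∑ s ∈ Finset.range (epochStart (P.M - k + j)), queryInd F O P s ω ≤
      2 ^ (P.M - k - 1) + j * (129 * θ * ((k + 1) * P.Cδ) / P.γ ^ 2) := by
    intro j hj
    induction j with
    | zero =>
      calc _ ≤ ∑ s ∈ Finset.range (epochStart (P.M - k + 0)), (1 : ℝ) :=
            Finset.sum_le_sum fun s _ => queryInd_le_one s ω
        _ = 2 ^ (P.M - k - 1) := by
            simp only [Finset.sum_const, Finset.card_range, nsmul_eq_mul, mul_one, add_zero]
            rw [epochStart_of_two_le (by omega)]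
            push_cast
            rfl
        _ ≤ _ := by simp
    | succ j ih =>
      have h1 := ih (by omega)
      rw [← add_assoc, ← Finset.sum_range_add_sum_Ico _ (epochStart_mono (P.M - k + j).le_succ)]
      have h2 := hg.sum_queryInd_epoch_le hC hγ hγ1 hθ (m := P.M - k + j) (by omega) (by omega)
      have h3 : P.β (P.M - k + j) ≤ (k + 1) * P.Cδ := by
        unfold Params.β
        refine mul_le_mul_of_nonneg_right ?_ hC.le
        have : (P.M : ℝ) ≤ ((P.M - k + j : ℕ) : ℝ) + k := by
          exact_mod_cast (by omega : P.M ≤ P.M - k + j + k)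
        linarith
      have h4 : 129 * θ * P.β (P.M - k + j) / P.γ ^ 2 ≤
          129 * θ * ((k + 1) * P.Cδ) / P.γ ^ 2 := by gcongr
      push_cast
      simp only [Nat.succ_eq_add_one]
      linarith
  have := hstep k le_rfl
  rwa [Nat.sub_add_cancel (by omega)] at this

end GoodStream

section Learned

variable {X : Type u} {F : Set (X → ℝ)} {O : History X → X → ℝ} {P : Params} {ω : ℕ → X × Bool}

open Classical in
theorem coe_learned (x : X) : ((algorithm F O P).learned ω x : ℝ) =
    if Set.Icc (lcb (activeOn F O P P.M ω) x) (ucb (activeOn F O P P.M ω) x) ⊆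
      Set.Icc (1 / 2 - P.γ) (1 / 2 + P.γ) then 1 / 2
    else if 0 < 2 * O ((algorithm F O P).history ω (epochStart P.M)) x - 1 ∨
      (2 * O ((algorithm F O P).history ω (epochStart P.M)) x - 1 = 0 ∧
        1 / 2 < ucb (activeOn F O P P.M ω) x) then 1 else 0 := by
  change (randomize (classifierAt F O P P.M
    ((algorithm F O P).history ω (epochStart P.M))) x : ℝ) = _
  have hpast : past P.M ((algorithm F O P).history ω (epochStart P.M)) =
      (algorithm F O P).history ω (epochStart P.M) :=
    ActiveLearner.take_history _ _ le_rfl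
  unfold randomize classifierAt
  rw [activeSetAt_history le_rfl, hpast]
  by_cases h1 : Set.Icc (lcb (activeOn F O P P.M ω) x) (ucb (activeOn F O P P.M ω) x) ⊆
      Set.Icc (1 / 2 - P.γ) (1 / 2 + P.γ)
  · rw [if_pos h1, if_pos h1]
  · rw [if_neg h1, if_neg h1]
    by_cases h2 : 0 < 2 * O ((algorithm F O P).history ω (epochStart P.M)) x - 1 ∨
      (2 * O ((algorithm F O P).history ω (epochStart P.M)) x - 1 = 0 ∧
        1 / 2 < ucb (activeOn F O P P.M ω) x)
    · rw [if_pos h2, decide_eq_true h2]; rfl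
    · rw [if_neg h2, decide_eq_false h2]; rfl

end Learned

namespace GoodStream

variable {X : Type u} [MeasurableSpace X] {D : Measure (X × Bool)} {F : Set (X → ℝ)}
  {O : History X → X → ℝ} {P : Params} {η : X → ℝ} {K : ℝ} {ω : ℕ → X × Bool}

theorem measurable_learned (hg : GoodStream D F O P η K ω) :
    Measurable ((algorithm F O P).learned ω) := by
  have hβ : ∀ m ≤ P.M, 0 ≤ P.β m := fun m hm => hg.β_nonneg hm
  have hl := measurable_lcb_activeOn hg.reg hβ le_rfl ω
  have hu := measurable_ucb_activeOn hg.reg hβ le_rfl ω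
  have hf := hg.reg.measurable _
    (hg.reg.oracle ((algorithm F O P).history ω (epochStart P.M))).1
  have hη := hg.mem_activeOn le_rfl
  have hlu : ∀ x, lcb (activeOn F O P P.M ω) x ≤ ucb (activeOn F O P P.M ω) x := fun x =>
    (lcb_le hg.reg.mem_Icc (activeOn_subset _ ω) hη x).trans
      (le_ucb hg.reg.mem_Icc (activeOn_subset _ ω) hη x)
  have hm : Measurable fun x => ((algorithm F O P).learned ω x : ℝ) := by
    classical
    simp_rw [coe_learned]
    refine Measurable.ite ?_ measurable_const (Measurable.ite ?_ measurable_const measurable_const)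
    · simp_rw [fun x => Set.Icc_subset_Icc_iff (a₂ := 1 / 2 - P.γ) (b₂ := 1 / 2 + P.γ) (hlu x)]
      exact (measurableSet_le measurable_const hl).inter (measurableSet_le hu measurable_const)
    · have hf' := (hf.const_mul 2).sub_const 1
      exact (measurableSet_lt measurable_const hf').union
        ((measurableSet_eq_fun hf' measurable_const).inter (measurableSet_lt measurable_const hu))
  exact hm.subtype_mk (h := fun x => ((algorithm F O P).learned ω x).2)

/-- Three cases: abstention forces `|η x - 1/2| ≤ γ` and a coin flip loses at most that; in the
region a wrong sign loses at most `2 |f x - η x|`; elsewhere the interval lies on one side of `1/2`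
and nothing is lost. -/
theorem excess_integrand_le (hg : GoodStream D F O P η K ω) (hγ : 0 < P.γ) (x : X) :
    (1 - 2 * η x) * (((algorithm F O P).learned ω x : ℝ) - plugIn η x) ≤
      sqDist (region F O P P.M ω) (O ((algorithm F O P).history ω (epochStart P.M))) η x / P.γ +
        P.γ * (region F O P P.M ω).indicator (fun _ => 1) x +
        P.γ * {x | |η x - 1 / 2| ≤ P.γ}.indicator (fun _ => 1) x := by
  classical
  have hη := hg.mem_activeOn le_rfl
  have hfm := oracle_mem_activeOn (F := F) (O := O) hg.reg.oracle (hg.β_nonneg le_rfl) ω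
  set f := O ((algorithm F O P).history ω (epochStart P.M)) with hf
  have h1 := lcb_le hg.reg.mem_Icc (activeOn_subset _ ω) hη x
  have h2 := le_ucb hg.reg.mem_Icc (activeOn_subset _ ω) hη x
  have h3 := lcb_le hg.reg.mem_Icc (activeOn_subset _ ω) hfm x
  have h4 := le_ucb hg.reg.mem_Icc (activeOn_subset _ ω) hfm x
  have hi1 : 0 ≤ P.γ * (region F O P P.M ω).indicator (fun _ => (1 : ℝ)) x :=
    mul_nonneg hγ.le (Set.indicator_nonneg (fun _ _ => zero_le_one) x)
  have hi2 : 0 ≤ P.γ * {x | |η x - 1 / 2| ≤ P.γ}.indicator (fun _ => (1 : ℝ)) x :=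
    mul_nonneg hγ.le (Set.indicator_nonneg (fun _ _ => zero_le_one) x)
  have hi3 : 0 ≤ sqDist (region F O P P.M ω) f η x / P.γ :=
    div_nonneg (Set.indicator_nonneg (fun _ _ => sq_nonneg _) x) hγ.le
  have hplug : (plugIn η x : ℝ) = if 0 ≤ 2 * η x - 1 then 1 else 0 := by
    unfold plugIn; split_ifs <;> rfl
  rw [coe_learned, hplug, ← hf]
  by_cases hab : Set.Icc (lcb (activeOn F O P P.M ω) x) (ucb (activeOn F O P P.M ω) x) ⊆
      Set.Icc (1 / 2 - P.γ) (1 / 2 + P.γ)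
  · rw [if_pos hab]
    have h5 := hab ⟨h1, h2⟩
    have hx : x ∈ {x | |η x - 1 / 2| ≤ P.γ} := by
      simp only [Set.mem_ofPred_eq, abs_le]
      constructor <;> linarith [h5.1, h5.2]
    rw [Set.indicator_of_mem hx] at hi2 ⊢
    split_ifs <;> linarith [h5.1, h5.2]
  · rw [if_neg hab]
    by_cases hx : x ∈ region F O P P.M ω
    · rw [Set.indicator_of_mem hx] at hi1 ⊢
      -- Arithmetic-geometric mean inequality at scale `γ`, making both the squared distance and the
      -- mass of the region usable.
      have h5 : 2 * |f x - η x| ≤ sqDist (region F O P P.M ω) f η x / P.γ + P.γ * 1 := by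
        rw [sqDist, Set.indicator_of_mem hx, ← sq_abs, ← sub_le_iff_le_add, le_div_iff₀ hγ]
        nlinarith [sq_nonneg (|f x - η x| - P.γ)]
      have h6 := le_abs_self (f x - η x)
      have h7 := neg_le_abs (f x - η x)
      split_ifs with h8 h9 h9
      · linarith
      · rcases h8 with h8 | h8 <;> linarith [h8]
      · rw [not_or] at h8
        linarith [h8.1]
      · linarith
    · have hcases : 1 / 2 ≤ lcb (activeOn F O P P.M ω) x ∨
          ucb (activeOn F O P P.M ω) x ≤ 1 / 2 := by
        by_contra! hcon
        refine hx ⟨hcon.1, hcon.2, ?_⟩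
        by_contra! hc
        exact hab (Set.Icc_subset_Icc hc.1 hc.2)
      have hgoal : (1 - 2 * η x) * ((if 0 < 2 * f x - 1 ∨ (2 * f x - 1 = 0 ∧
          1 / 2 < ucb (activeOn F O P P.M ω) x) then (1 : ℝ) else 0) -
          if 0 ≤ 2 * η x - 1 then 1 else 0) ≤ 0 := by
        rcases le_or_gt (ucb (activeOn F O P P.M ω) x) (1 / 2) with hu | hu
        -- Here the tie rule matters: with `ucb ≤ 1/2` a tie gives -1, and with `ucb > 1/2`, hence
        -- `lcb ≥ 1/2`, it gives +1, so the sign is never on the wrong side of the interval.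
        · rw [if_neg (by rintro (h | h) <;> linarith [h])]
          split_ifs <;> linarith
        · have hl : 1 / 2 ≤ lcb (activeOn F O P P.M ω) x := hcases.resolve_right (not_le.2 hu)
          rw [if_pos, if_pos]
          · linarith
          · linarith
          · rcases (show 1 / 2 ≤ f x by linarith).eq_or_lt with h | h
            · exact Or.inr ⟨by linarith, hu⟩
            · exact Or.inl (by linarith)
      linarith

variable [IsProbabilityMeasure D]

theorem excess_learned_le (hg : GoodStream D F O P η K ω) (hη : IsCondProb D η)
    (hC : 0 < P.Cδ) (hγ : 0 < P.γ) {θ : ℝ} (hθ : theta F P.γ ≤ ENNReal.ofReal θ)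
    (hM : 2 ≤ P.M) :
    excess D η ((algorithm F O P).learned ω) ≤
      40 * θ * P.Cδ / (P.γ * 2 ^ (P.M - 2)) + P.γ * D.fst.real {x | |η x - 1 / 2| ≤ P.γ} := by
  obtain ⟨k, hk⟩ : ∃ k, P.M = k + 1 := ⟨P.M - 1, by omega⟩
  have hθ1 := one_le_of_theta_le hg.mem hθ
  have hη01 := hg.reg.mem_Icc η hg.mem
  set f := O ((algorithm F O P).history ω (epochStart P.M)) with hf
  have hfm : f ∈ activeOn F O P P.M ω :=
    oracle_mem_activeOn hg.reg.oracle (hg.β_nonneg le_rfl) ω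
  have hfF : f ∈ F := hfm.1
  have hRm := hg.measurableSet_region le_rfl
  have hAm : MeasurableSet {x | |η x - 1 / 2| ≤ P.γ} :=
    measurableSet_le (hη.1.sub_const _).abs measurable_const
  have hsq : Integrable (sqDist (region F O P P.M ω) f η) D.fst :=
    integrable_of_mem_Icc (measurable_sqDist hRm (hg.reg.measurable f hfF) hη.1)
      (sqDist_mem_Icc (hg.reg.mem_Icc f hfF) hη01)
  have hi1 : Integrable ((region F O P P.M ω).indicator fun _ => (1 : ℝ)) D.fst :=
    (integrable_const _).indicator hRm
  have hi2 : Integrable ({x | |η x - 1 / 2| ≤ P.γ}.indicator fun _ => (1 : ℝ)) D.fst :=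
    (integrable_const _).indicator hAm
  have hint : Integrable (fun x => sqDist (region F O P P.M ω) f η x / P.γ +
      P.γ * (region F O P P.M ω).indicator (fun _ => 1) x +
      P.γ * {x | |η x - 1 / 2| ≤ P.γ}.indicator (fun _ => 1) x) D.fst :=
    ((hsq.div_const _).add (hi1.const_mul _)).add (hi2.const_mul _)
  have hlm : Measurable fun x => ((algorithm F O P).learned ω x : ℝ) :=
    measurable_subtype_coe.comp hg.measurable_learned
  have hpm : Measurable fun x => (plugIn η x : ℝ) :=
    measurable_subtype_coe.comp (measurable_plugIn hη.1)
  have hexint : Integrable (fun x => (1 - 2 * η x) *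
      (((algorithm F O P).learned ω x : ℝ) - plugIn η x)) D.fst := by
    refine integrable_of_mem_Icc (a := -1) (b := 1)
      ((measurable_const.sub (hη.1.const_mul 2)).mul (hlm.sub hpm)) fun x => ?_
    rw [Set.mem_Icc, ← abs_le, abs_mul]
    refine mul_le_one₀ ?_ (abs_nonneg _) ?_
    · rw [abs_le]; constructor <;> linarith [(hη01 x).1, (hη01 x).2]
    · rw [abs_le]
      have a1 := ((algorithm F O P).learned ω x).2
      have a2 := (plugIn η x).2
      constructor <;> linarith [a1.1, a1.2, a2.1, a2.2]
  have h2 : (0 : ℝ) < 2 ^ (P.M - 2) := by positivity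
  have e1 : k - 1 = P.M - 2 := by omega
  have hβM : P.β P.M = P.Cδ := by unfold Params.β; ring
  have hV : ∫ x, sqDist (region F O P P.M ω) f η x ∂D.fst ≤ 8 * P.Cδ / 2 ^ (P.M - 2) := by
    rw [le_div_iff₀ h2, mul_comm, ← hβM]
    have a1 := hg.integral_sqDist_anti (m := k) hk.ge hfF
    have a2 := hg.integral_sqDist_le (m := k) (by omega) hk.ge (f := f) (by rw [← hk]; exact hfm)
    rw [← hk] at a1 a2
    rw [e1] at a2
    exact (mul_le_mul_of_nonneg_left a1 h2.le).trans a2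
  have hp : D.fst.real (region F O P P.M ω) ≤ 32 * θ * P.Cδ / (P.γ ^ 2 * 2 ^ (P.M - 2)) := by
    have a1 := hg.measureReal_region_le hC hγ hθ (m := k) (by omega) hk.ge
    rwa [← hk, e1, hβM] at a1
  rw [excess_eq_integral hη hη01 hg.measurable_learned]
  refine (integral_mono hexint hint fun x => hg.excess_integrand_le hγ x).trans ?_
  have hi12 : Integrable (fun x => sqDist (region F O P P.M ω) f η x / P.γ +
      P.γ * (region F O P P.M ω).indicator (fun _ => 1) x) D.fst :=
    (hsq.div_const _).add (hi1.const_mul _)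
  rw [integral_add hi12 (hi2.const_mul _), integral_add (hsq.div_const _) (hi1.const_mul _), integral_div, integral_const_mul,
    integral_const_mul, integral_indicator_const _ hRm, integral_indicator_const _ hAm,
    smul_eq_mul, smul_eq_mul, mul_one, mul_one]
  gcongr
  calc (∫ x, sqDist (region F O P P.M ω) f η x ∂D.fst) / P.γ +
        P.γ * D.fst.real (region F O P P.M ω)
      ≤ 8 * P.Cδ / 2 ^ (P.M - 2) / P.γ + P.γ * (32 * θ * P.Cδ / (P.γ ^ 2 * 2 ^ (P.M - 2))) := by
        gcongr
    _ = (8 * P.Cδ + 32 * (θ * P.Cδ)) / (P.γ * 2 ^ (P.M - 2)) := by field_simp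
    _ ≤ 40 * θ * P.Cδ / (P.γ * 2 ^ (P.M - 2)) := by
        gcongr
        nlinarith

end GoodStream

/-! ### Union bound over the concentration events. -/

section Probability

variable {X : Type u} [MeasurableSpace X] {D : Measure (X × Bool)} [IsProbabilityMeasure D]
  {F : Set (X → ℝ)} {O : History X → X → ℝ} {P : Params} {η : X → ℝ} {K : ℝ}

theorem measure_not_goodStream_le (hR : IsRegressionClass F O) (hηF : η ∈ F) (hη : IsCondProb D η)
    {d : ℕ} (hd : pdim F ≤ d) (hK : 0 ≤ K) (hKC : 8 * K ≤ P.Cδ) (hM : 3 ≤ P.M) :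
    streamLaw D {ω | ¬ GoodStream D F O P η K ω} ≤
      ((P.M + 1) ^ 2 + 2 * (P.M + 1) : ℕ) * failBound (2 ^ (P.M - 1)) d K := by
  have hC : 0 ≤ P.Cδ := by linarith
  have hβ : ∀ m ≤ P.M, 0 ≤ P.β m := fun m hm => hC.trans (Params.Cδ_le_β hC hm)
  set s := Finset.range (P.M + 1) with hs
  set A : ℕ × ℕ → Set (ℕ → X × Bool) := fun p =>
    {ω | p.2 ≤ P.M ∧ ¬ NoiseGood F O P η K p.1 p.2 ω} with hA
  set B : ℕ → Set (ℕ → X × Bool) := fun m =>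
    {ω | (1 ≤ m ∧ m < P.M) ∧ ¬ DevGood D F O P η K m ω} with hB
  set C : ℕ → Set (ℕ → X × Bool) := fun m =>
    {ω | (1 ≤ m ∧ m < P.M) ∧ ¬ CountGood D F O P K m ω} with hC'
  have hsub : {ω | ¬ GoodStream D F O P η K ω} ⊆
      (⋃ p ∈ s ×ˢ s, A p) ∪ ((⋃ m ∈ s, B m) ∪ ⋃ m ∈ s, C m) := by
    intro ω hω
    by_contra hcon
    simp only [Set.mem_union, Set.mem_iUnion, not_or, not_exists] at hcon
    refine hω ⟨hR, hηF, hK, hKC, fun j m hjm hm => ?_, fun m h1 hm => ?_, fun m h1 hm => ?_⟩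
    · by_contra h
      exact hcon.1 (j, m) (Finset.mem_product.2 ⟨Finset.mem_range.2 (by simp only; omega),
        Finset.mem_range.2 (by simp only; omega)⟩) ⟨hm, h⟩
    · by_contra h
      exact hcon.2.1 m (Finset.mem_range.2 (by omega)) ⟨⟨h1, hm⟩, h⟩
    · by_contra h
      exact hcon.2.2 m (Finset.mem_range.2 (by omega)) ⟨⟨h1, hm⟩, h⟩
  have hAle : ∀ p, streamLaw D (A p) ≤ failBound (2 ^ (P.M - 1)) d K := by
    rintro ⟨j, m⟩
    by_cases hm : m ≤ P.M
    · refine (measure_mono fun ω hω => hω.2).trans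
        (measure_not_noiseGood_le hR hηF hη hd hβ hK hm ?_)
      rw [← epochStart_of_two_le (by omega)]
      exact epochStart_mono hm
    · have : A (j, m) = ∅ := by ext ω; simp [hA, hm]
      rw [this, measure_empty]
      exact zero_le
  -- The exceptional first epoch has two points instead of one; `3 ≤ M` absorbs it.
  have hlen : ∀ m, 1 ≤ m → m < P.M → 2 * epochLen m ≤ 2 ^ (P.M - 1) := by
    intro m h1 hm
    rcases h1.eq_or_lt with rfl | h2
    · rw [epochLen_one]
      calc 2 * 2 = 2 ^ 2 := by norm_num
        _ ≤ 2 ^ (P.M - 1) := Nat.pow_le_pow_right two_pos (by omega)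
    · rw [epochLen_of_two_le h2, ← pow_succ']
      exact Nat.pow_le_pow_right two_pos (by omega)
  have hBle : ∀ m, streamLaw D (B m) ≤ failBound (2 ^ (P.M - 1)) d K := by
    intro m
    by_cases hm : 1 ≤ m ∧ m < P.M
    · exact (measure_mono fun ω hω => hω.2).trans
        (measure_not_devGood_le hR hηF hd hβ hm.2.le hm.1 (hlen m hm.1 hm.2))
    · have : B m = ∅ := by
        ext ω
        simp only [hB, Set.mem_ofPred_eq, Set.mem_empty_iff_false, iff_false]
        exact fun h => hm h.1
      rw [this, measure_empty]
      exact zero_le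
  have hCle : ∀ m, streamLaw D (C m) ≤ failBound (2 ^ (P.M - 1)) d K := by
    intro m
    by_cases hm : 1 ≤ m ∧ m < P.M
    · exact (measure_mono fun ω hω => hω.2).trans
        (measure_not_countGood_le hR hβ hm.2.le hm.1)
    · have : C m = ∅ := by
        ext ω
        simp only [hC', Set.mem_ofPred_eq, Set.mem_empty_iff_false, iff_false]
        exact fun h => hm h.1
      rw [this, measure_empty]
      exact zero_le
  refine (measure_mono hsub).trans ((measure_union_le _ _).trans
    ((add_le_add_right (measure_union_le _ _) _).trans ?_))
  have h1 : streamLaw D (⋃ p ∈ s ×ˢ s, A p) ≤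
      ∑ _p ∈ s ×ˢ s, failBound (2 ^ (P.M - 1)) d K :=
    (measure_biUnion_finset_le _ _).trans (Finset.sum_le_sum fun p _ => hAle p)
  have h2 : streamLaw D (⋃ m ∈ s, B m) ≤ ∑ _m ∈ s, failBound (2 ^ (P.M - 1)) d K :=
    (measure_biUnion_finset_le _ _).trans (Finset.sum_le_sum fun m _ => hBle m)
  have h3 : streamLaw D (⋃ m ∈ s, C m) ≤ ∑ _m ∈ s, failBound (2 ^ (P.M - 1)) d K :=
    (measure_biUnion_finset_le _ _).trans (Finset.sum_le_sum fun m _ => hCle m)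
  refine (add_le_add h1 (add_le_add h2 h3)).trans_eq ?_
  simp only [Finset.sum_const, Finset.card_product, hs, Finset.card_range, nsmul_eq_mul]
  push_cast
  ring

/-- If the failure probability is small and good streams are successful, the algorithm succeeds. -/
theorem succeedsWithProb_of_goodStream {ε n p : ℝ} (hp : 0 ≤ p)
    (hbad : streamLaw D {ω | ¬ GoodStream D F O P η K ω} ≤ ENNReal.ofReal p)
    (hgood : ∀ ω, GoodStream D F O P η K ω → (algorithm F O P).Succeeds D η ε n ω) :
    (algorithm F O P).SucceedsWithProb D η ε n (1 - p) := by
  -- Good streams are not known to form a measurable set, so the measurable hull of the bad ones is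
  -- removed.
  refine ⟨(toMeasurable (streamLaw D) {ω | ¬ GoodStream D F O P η K ω})ᶜ,
    (measurableSet_toMeasurable _ _).compl, ?_, fun ω hω => hgood ω ?_⟩
  · rw [prob_compl_eq_one_sub (measurableSet_toMeasurable _ _), measure_toMeasurable,
      ENNReal.ofReal_sub _ hp, ENNReal.ofReal_one]
    exact tsub_le_tsub_left hbad 1
  · by_contra h
    exact hω (subset_toMeasurable _ _ h)

end Probability

/-! ### Choice of the constants -/

section Constants

variable {d : ℕ} {θ ε γ δ : ℝ}

/-- The parameters with the absolute constants chosen for the upper bounds. -/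
noncomputable def chosenParams (d : ℕ) (θ ε γ δ : ℝ) : Params := ⟨2 ^ 20, 64, d, θ, ε, γ, δ⟩

/-- Admissible inputs of the algorithm. -/
structure Admissible (d : ℕ) (θ ε γ δ : ℝ) : Prop where
  d_pos : 1 ≤ d
  θ_ge : 1 ≤ θ
  ε_pos : 0 < ε
  ε_lt : ε < 1
  γ_pos : 0 < γ
  γ_lt : γ < 1 / 2
  δ_pos : 0 < δ
  δ_lt : δ < 1

namespace Admissible

theorem one_le_θd (h : Admissible d θ ε γ δ) : 1 ≤ θ * d := by
  have h1 : (1 : ℝ) ≤ d := by exact_mod_cast h.d_pos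
  nlinarith [h.θ_ge]

theorem inv_mul_two_le (h : Admissible d θ ε γ δ) : 2 * (1 / ε) ≤ θ * d / (ε * γ) := by
  have h0 := h.ε_pos
  have h1 := h.γ_pos
  have h2 := h.one_le_θd
  rw [le_div_iff₀ (mul_pos h0 h1)]
  have : 2 * (1 / ε) * (ε * γ) = 2 * γ := by field_simp
  linarith [h.γ_lt]

theorem two_le (h : Admissible d θ ε γ δ) : 2 ≤ θ * d / (ε * γ) := by
  have h1 := h.inv_mul_two_le
  have h2 : 1 ≤ 1 / ε := by rw [le_div_iff₀ h.ε_pos]; linarith [h.ε_lt]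
  linarith

theorem div_δ (d : ℕ) (θ ε γ δ : ℝ) :
    θ * d / (ε * γ * δ) = θ * d / (ε * γ) / δ := by
  rw [div_div]

theorem le_div_δ (h : Admissible d θ ε γ δ) : θ * d / (ε * γ) ≤ θ * d / (ε * γ * δ) := by
  rw [div_δ, le_div_iff₀ h.δ_pos]
  nlinarith [h.two_le, h.δ_lt]

theorem log_two_le (h : Admissible d θ ε γ δ) : Real.log 2 ≤ Real.log (θ * d / (ε * γ)) :=
  Real.log_le_log two_pos h.two_le

theorem log_le_log_δ (h : Admissible d θ ε γ δ) :
    Real.log (θ * d / (ε * γ)) ≤ Real.log (θ * d / (ε * γ * δ)) :=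
  Real.log_le_log (by linarith [h.two_le]) h.le_div_δ

theorem T_eq (d : ℕ) (θ ε γ δ : ℝ) : (chosenParams d θ ε γ δ).T =
    2 ^ 20 * (θ * d / (ε * γ)) * Real.log (θ * d / (ε * γ * δ)) := rfl

theorem T_ge (h : Admissible d θ ε γ δ) : 1000 ≤ (chosenParams d θ ε γ δ).T := by
  rw [T_eq]
  have h1 := h.two_le
  have h2 := h.log_two_le.trans h.log_le_log_δ
  have h3 := Real.log_two_gt_d9
  calc (1000 : ℝ) ≤ 2 ^ 20 * 2 * (1 / 2) := by norm_num
    _ ≤ _ := by gcongr; linarith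

theorem log_T_div_le (h : Admissible d θ ε γ δ) :
    Real.log ((chosenParams d θ ε γ δ).T / δ) ≤ 22 * Real.log (θ * d / (ε * γ * δ)) := by
  have h1 := h.two_le
  have h2 := h.log_two_le.trans h.log_le_log_δ
  have h3 := Real.log_two_gt_d9
  have hδ := h.δ_pos
  set L := Real.log (θ * d / (ε * γ * δ)) with hL
  have hLpos : 0 < L := by linarith
  have ha : 0 < θ * d / (ε * γ * δ) := by linarith [h.le_div_δ]
  have e : (chosenParams d θ ε γ δ).T / δ = 2 ^ 20 * (θ * d / (ε * γ * δ)) * L := by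
    rw [T_eq, ← hL, div_δ]; ring
  rw [e, Real.log_mul (by positivity) hLpos.ne', Real.log_mul (by positivity) ha.ne', ← hL,
    Real.log_pow]
  have h4 : Real.log L ≤ L := (Real.log_le_sub_one_of_pos hLpos).trans (by linarith)
  push_cast
  linarith

theorem log_T_div_pos (h : Admissible d θ ε γ δ) :
    0 < Real.log ((chosenParams d θ ε γ δ).T / δ) := by
  refine Real.log_pos ?_
  rw [lt_div_iff₀ h.δ_pos]
  linarith [h.T_ge, h.δ_lt]

theorem T_le_two_pow (h : Admissible d θ ε γ δ) :
    (chosenParams d θ ε γ δ).T ≤ 2 ^ (chosenParams d θ ε γ δ).M := by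
  have hT : 0 < (chosenParams d θ ε γ δ).T := by linarith [h.T_ge]
  have h1 := Nat.le_ceil (Real.logb 2 (chosenParams d θ ε γ δ).T)
  rw [Real.logb_le_iff_le_rpow one_lt_two hT, Real.rpow_natCast] at h1
  exact h1

theorem four_le_M (h : Admissible d θ ε γ δ) : 4 ≤ (chosenParams d θ ε γ δ).M := by
  by_contra! hlt
  have h1 := h.T_ge.trans h.T_le_two_pow
  have h2 : (2 : ℝ) ^ (chosenParams d θ ε γ δ).M ≤ 2 ^ 4 :=
    pow_le_pow_right₀ one_le_two hlt.le
  norm_num at h2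
  linarith

theorem two_pow_lt_T (h : Admissible d θ ε γ δ) :
    (2 : ℝ) ^ ((chosenParams d θ ε γ δ).M - 1) < (chosenParams d θ ε γ δ).T := by
  have hT : 0 < (chosenParams d θ ε γ δ).T := by linarith [h.T_ge]
  have h4 := h.four_le_M
  have h1 : (chosenParams d θ ε γ δ).M - 1 < (chosenParams d θ ε γ δ).M := by omega
  have h2 := Nat.lt_ceil.1 h1
  rw [Real.lt_logb_iff_rpow_lt one_lt_two hT, Real.rpow_natCast] at h2
  exact h2

theorem Cδ_pos (h : Admissible d θ ε γ δ) : 0 < (chosenParams d θ ε γ δ).Cδ := by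
  have h1 : (0 : ℝ) < d := by exact_mod_cast h.d_pos
  have := h.log_T_div_pos
  exact mul_pos (mul_pos (by norm_num [chosenParams]) h1) this

theorem Cδ_le (h : Admissible d θ ε γ δ) :
    (chosenParams d θ ε γ δ).Cδ ≤ 1408 * d * Real.log (θ * d / (ε * γ * δ)) := by
  have h1 : (0 : ℝ) ≤ d := by positivity
  calc (chosenParams d θ ε γ δ).Cδ = 64 * d * Real.log ((chosenParams d θ ε γ δ).T / δ) := rfl
    _ ≤ 64 * d * (22 * Real.log (θ * d / (ε * γ * δ))) := by gcongr; exact h.log_T_div_le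
    _ = _ := by ring

theorem excess_bound (h : Admissible d θ ε γ δ) :
    40 * θ * (chosenParams d θ ε γ δ).Cδ / (γ * 2 ^ ((chosenParams d θ ε γ δ).M - 2)) ≤ ε := by
  have hγ := h.γ_pos
  have hε := h.ε_pos
  have hθ := h.θ_ge
  have h4 := h.four_le_M
  have h1 := h.T_le_two_pow
  have hL : 0 < Real.log (θ * d / (ε * γ * δ)) := by
    linarith [h.log_two_le.trans h.log_le_log_δ, Real.log_two_gt_d9]
  have e : (2 : ℝ) ^ (chosenParams d θ ε γ δ).M =
      4 * 2 ^ ((chosenParams d θ ε γ δ).M - 2) := by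
    obtain ⟨k, hk⟩ : ∃ k, (chosenParams d θ ε γ δ).M = k + 2 :=
      ⟨(chosenParams d θ ε γ δ).M - 2, by omega⟩
    rw [hk, Nat.add_sub_cancel, pow_add]; ring
  rw [e, T_eq] at h1
  rw [div_le_iff₀ (by positivity)]
  have h2 := h.Cδ_le
  have h3 : ε * γ * (2 ^ 20 * (θ * d / (ε * γ)) * Real.log (θ * d / (ε * γ * δ))) =
      2 ^ 20 * (θ * d * Real.log (θ * d / (ε * γ * δ))) := by field_simp
  have h5 := mul_le_mul_of_nonneg_left h1 (mul_pos hε hγ).le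
  rw [h3] at h5
  have h6 : 0 ≤ θ * d * Real.log (θ * d / (ε * γ * δ)) := by positivity
  calc 40 * θ * (chosenParams d θ ε γ δ).Cδ
      ≤ 40 * θ * (1408 * d * Real.log (θ * d / (ε * γ * δ))) := by gcongr
    _ = 56320 * (θ * d * Real.log (θ * d / (ε * γ * δ))) := by ring
    _ ≤ 2 ^ 20 / 4 * (θ * d * Real.log (θ * d / (ε * γ * δ))) := by gcongr; norm_num
    _ ≤ ε * (γ * 2 ^ ((chosenParams d θ ε γ δ).M - 2)) := by linarith

/-- With `C₂ = 64` the tail is `(δ / T) ^ (8 d)`. The number of events costs at most `T³`, the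
factor `exp (3 / 2)` at most `T`, and the cover at most `T ^ (3 d)`; since `4 + 3 d ≤ 8 d`, the
powers of `T` cancel. -/
theorem failure_bound (h : Admissible d θ ε γ δ) :
    (((chosenParams d θ ε γ δ).M + 1) ^ 2 + 2 * ((chosenParams d θ ε γ δ).M + 1) : ℕ) *
      failBound (2 ^ ((chosenParams d θ ε γ δ).M - 1)) d ((chosenParams d θ ε γ δ).Cδ / 8) ≤
      ENNReal.ofReal δ := by
  set P := chosenParams d θ ε γ δ with hP
  have hT := h.T_ge
  have h4 := h.four_le_M
  have hN := h.two_pow_lt_T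
  rw [← hP] at hT h4 hN
  set T := P.T
  set N : ℕ := 2 ^ (P.M - 1) with hNdef
  have hNr : (N : ℝ) < T := by rw [hNdef]; push_cast; exact hN
  have hMN : P.M ≤ N := by
    have := (P.M - 1).lt_two_pow_self
    omega
  have hMr : (P.M : ℝ) ≤ T := (by exact_mod_cast hMN : (P.M : ℝ) ≤ N).trans hNr.le
  have hδ := h.δ_pos
  have hd := h.d_pos
  have hexp : Real.exp (-(P.Cδ / 8)) = (δ / T) ^ (8 * d) := by
    have e1 : P.Cδ / 8 = (8 * d : ℕ) * Real.log (T / δ) := by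
      change 64 * (d : ℝ) * Real.log (T / δ) / 8 = _
      push_cast; ring
    rw [e1, ← mul_neg, ← Real.log_inv, inv_div, Real.exp_nat_mul, Real.exp_log (by positivity)]
  unfold failBound
  rw [hexp, ← ENNReal.ofReal_natCast, ← ENNReal.ofReal_natCast, ← ENNReal.ofReal_mul (by positivity),
    ← ENNReal.ofReal_mul (by positivity), ← ENNReal.ofReal_mul (by positivity)]
  refine ENNReal.ofReal_le_ofReal ?_
  push_cast
  have b1 : ((P.M : ℝ) + 1) ^ 2 + 2 * (P.M + 1) ≤ T ^ 3 := by
    calc ((P.M : ℝ) + 1) ^ 2 + 2 * (P.M + 1) ≤ (T + 1) ^ 2 + 2 * (T + 1) := by gcongr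
      _ ≤ T ^ 3 := by nlinarith [sq_nonneg T]
  have b2 : Real.exp (3 / 2) ≤ T := by
    calc Real.exp (3 / 2) ≤ Real.exp 1 ^ 2 := by
          rw [← Real.exp_nat_mul]; exact Real.exp_le_exp.2 (by norm_num)
      _ ≤ 3 ^ 2 := by gcongr; exact Real.exp_one_lt_three.le
      _ ≤ T := by linarith
  have b3 : (N : ℝ) * (N + 1) + 1 ≤ T ^ 3 := by
    calc (N : ℝ) * (N + 1) + 1 ≤ T * (T + 1) + 1 := by gcongr
      _ ≤ T ^ 3 := by nlinarith [sq_nonneg T]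
  calc (((P.M : ℝ) + 1) ^ 2 + 2 * (P.M + 1)) *
        (Real.exp (3 / 2) * ((N : ℝ) * (N + 1) + 1) ^ d * (δ / T) ^ (8 * d))
      ≤ T ^ 3 * (T * (T ^ 3) ^ d * (δ / T) ^ (8 * d)) := by gcongr
    _ = T ^ (4 + 3 * d) * (δ / T) ^ (8 * d) := by rw [← pow_mul, pow_add]; ring
    _ ≤ T ^ (8 * d) * (δ / T) ^ (8 * d) := by
        gcongr
        · linarith
        · omega
    _ = δ ^ (8 * d) := by rw [← mul_pow, mul_div_cancel₀ _ (by positivity)]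
    _ ≤ δ ^ 1 := pow_le_pow_of_le_one hδ.le h.δ_lt.le (by omega)
    _ = δ := pow_one δ

/-- `M` grows with `log log (1 / δ)`, so summing over all epochs would put `δ` into the squared
logarithm. Only the last `k`, of order `log (1 / ε)` plus a constant, are treated by the
disagreement bound; the earlier points number about `ε T`, which is affordable even if all are
queried. -/
theorem exists_cutoff (h : Admissible d θ ε γ δ) :
    ∃ k : ℕ, k + 2 ≤ (chosenParams d θ ε γ δ).M ∧
      (k : ℝ) ≤ 32 * Real.log (θ * d / (ε * γ)) ∧
      (2 : ℝ) ^ ((chosenParams d θ ε γ δ).M - k - 1) ≤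
        θ * d * (1 / γ ^ 2) * Real.log (θ * d / (ε * γ * δ)) := by
  set P := chosenParams d θ ε γ δ with hP
  have hε := h.ε_pos
  have hγ := h.γ_pos
  have hγ1 := h.γ_lt
  have h4 : 4 ≤ P.M := h.four_le_M
  have hθd := h.one_le_θd
  have hlog2 := Real.log_two_gt_d9
  set ℓ := Real.log (θ * d / (ε * γ)) with hℓ
  set L := Real.log (θ * d / (ε * γ * δ)) with hL
  have hℓ2 : Real.log 2 ≤ ℓ := h.log_two_le
  have hLℓ : ℓ ≤ L := h.log_le_log_δ
  have hT : P.T = 2 ^ 20 * (θ * d / (ε * γ)) * L := T_eq d θ ε γ δ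
  have hγ2 : 4 ≤ 1 / γ ^ 2 := by
    rw [le_div_iff₀ (by positivity)]; nlinarith
  set k₀ : ℕ := ⌈Real.logb 2 (2 ^ 20 * (1 / ε))⌉₊ with hk₀
  have hpos : 0 < 2 ^ 20 * (1 / ε) := by positivity
  have hinv : 1 ≤ 1 / ε := by rw [le_div_iff₀ hε]; linarith [h.ε_lt]
  have hk₀le : (k₀ : ℝ) ≤ 32 * ℓ := by
    have h1 : 0 ≤ Real.logb 2 (2 ^ 20 * (1 / ε)) := Real.logb_nonneg one_lt_two (by linarith)
    have h2 : (k₀ : ℝ) ≤ Real.logb 2 (2 ^ 20 * (1 / ε)) + 1 := (Nat.ceil_lt_add_one h1).le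
    have h3 : Real.logb 2 (2 ^ 20 * (1 / ε)) = 20 + Real.log (1 / ε) / Real.log 2 := by
      rw [Real.logb, Real.log_mul (by positivity) (by positivity), Real.log_pow, add_div,
        mul_div_assoc, div_self (by linarith)]
      norm_num
    have h5 : Real.log (1 / ε) ≤ ℓ := Real.log_le_log (by positivity) (by
      linarith [h.inv_mul_two_le])
    have h6 : Real.log (1 / ε) / Real.log 2 ≤ ℓ / (2 / 3) := by
      gcongr
      · linarith
      · linarith
    have h7 : ℓ / (2 / 3) = 3 / 2 * ℓ := by ring
    linarith
  have hk₀ge : 2 ^ 20 * (1 / ε) ≤ (2 : ℝ) ^ k₀ := by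
    have h1 := Nat.le_ceil (Real.logb 2 (2 ^ 20 * (1 / ε)))
    rwa [Real.logb_le_iff_le_rpow one_lt_two hpos, Real.rpow_natCast] at h1
  rcases le_or_gt (k₀ + 2) P.M with hk | hk
  · refine ⟨k₀, hk, hk₀le, ?_⟩
    have h1 : (2 : ℝ) ^ (P.M - k₀ - 1) * 2 ^ k₀ = 2 ^ (P.M - 1) := by
      rw [← pow_add]; congr 1; omega
    have h2 := h.two_pow_lt_T
    rw [← hP, ← h1, hT] at h2
    have h3 : (2 : ℝ) ^ (P.M - k₀ - 1) * (2 ^ 20 * (1 / ε)) ≤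
        (2 : ℝ) ^ (P.M - k₀ - 1) * 2 ^ k₀ := by gcongr
    have h5 : 2 ^ 20 * (θ * d / (ε * γ)) * L = (θ * d * (1 / γ) * L) * (2 ^ 20 * (1 / ε)) := by
      field_simp
    rw [h5] at h2
    have h6 := le_of_mul_le_mul_right (h3.trans h2.le) hpos
    refine h6.trans ?_
    gcongr
    · linarith
    · nlinarith
  -- If there are fewer epochs than the cutoff asks for, only the two points of the first epoch are
  -- counted trivially.
  · refine ⟨P.M - 2, by omega, ?_, ?_⟩
    · refine le_trans ?_ hk₀le
      exact_mod_cast (by omega : P.M - 2 ≤ k₀)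
    · rw [show P.M - (P.M - 2) - 1 = 1 by omega, pow_one]
      calc (2 : ℝ) ≤ 1 * 4 * (1 / 2) := by norm_num
        _ ≤ _ := by gcongr; linarith

theorem label_bound (h : Admissible d θ ε γ δ) {k : ℕ}
    (hk : (k : ℝ) ≤ 32 * Real.log (θ * d / (ε * γ))) {b : ℝ}
    (hb : b ≤ θ * d * (1 / γ ^ 2) * Real.log (θ * d / (ε * γ * δ))) :
    b + k * (129 * θ * ((k + 1) * (chosenParams d θ ε γ δ).Cδ) / γ ^ 2) ≤
      10 ^ 9 * (θ * d) * (1 / γ ^ 2) * Real.log (θ * d / (ε * γ)) ^ 2 *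
        Real.log (θ * d / (ε * γ * δ)) := by
  have hlog2 := Real.log_two_gt_d9
  have hγ := h.γ_pos
  have hθ := h.θ_ge
  have hθd := h.one_le_θd
  have hC := h.Cδ_le
  have hℓ2 := h.log_two_le
  have hLℓ := h.log_le_log_δ
  set ℓ := Real.log (θ * d / (ε * γ)) with hℓ
  set L := Real.log (θ * d / (ε * γ * δ)) with hL
  have hk1 : (k : ℝ) + 1 ≤ 34 * ℓ := by linarith
  have hℓ0 : 0 ≤ ℓ := by linarith
  have hL0 : 0 < L := by linarith
  set Q := θ * d * (1 / γ ^ 2) * L with hQ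
  have hQ0 : 0 ≤ Q := by positivity
  have h1 : k * (129 * θ * ((k + 1) * (chosenParams d θ ε γ δ).Cδ) / γ ^ 2) ≤
      32 * ℓ * (129 * θ * (34 * ℓ * (1408 * d * L)) / γ ^ 2) := by
    have := h.Cδ_pos
    gcongr
  have h2 : 32 * ℓ * (129 * θ * (34 * ℓ * (1408 * d * L)) / γ ^ 2) =
      32 * 129 * 34 * 1408 * (ℓ ^ 2 * Q) := by rw [hQ]; field_simp
  have h3 : Q ≤ 4 * (ℓ ^ 2 * Q) := by
    have : 1 ≤ 4 * ℓ ^ 2 := by nlinarith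
    nlinarith
  have h4 : 0 ≤ ℓ ^ 2 * Q := by positivity
  calc _ ≤ 4 * (ℓ ^ 2 * Q) + 32 * 129 * 34 * 1408 * (ℓ ^ 2 * Q) := by linarith
    _ ≤ 10 ^ 9 * (ℓ ^ 2 * Q) := by linarith
    _ = _ := by rw [hQ]; ring

end Admissible

end Constants

/-! ### Label complexity under Massart and Tsybakov noise. -/

section Upper

variable {X : Type u} [MeasurableSpace X] {D : Measure (X × Bool)} [IsProbabilityMeasure D]
  {F : Set (X → ℝ)} {O : History X → X → ℝ} {η : X → ℝ} {d : ℕ} {θ ε γ δ : ℝ}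

/-- The guarantee of the algorithm, without noise assumptions. -/
theorem algorithm_succeedsWithProb (hR : IsRegressionClass F O) (hηF : η ∈ F)
    (hη : IsCondProb D η) (hpd : pdim F ≤ d) (hθ : theta F γ ≤ ENNReal.ofReal θ)
    (h : Admissible d θ ε γ δ) :
    (algorithm F O (chosenParams d θ ε γ δ)).SucceedsWithProb D η
      (ε + γ * D.fst.real {x | |η x - 1 / 2| ≤ γ})
      (10 ^ 9 * (θ * d) * (1 / γ ^ 2) * Real.log (θ * d / (ε * γ)) ^ 2 *
        Real.log (θ * d / (ε * γ * δ))) (1 - δ) := by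
  have hC := h.Cδ_pos
  have hM := h.four_le_M
  refine succeedsWithProb_of_goodStream (K := (chosenParams d θ ε γ δ).Cδ / 8) h.δ_pos.le
    ((measure_not_goodStream_le hR hηF hη hpd (by linarith) (by linarith) (by omega)).trans
      h.failure_bound) fun ω hg => ⟨hg.measurable_learned, ?_, ?_⟩
  · exact (hg.excess_learned_le hη hC h.γ_pos hθ (by omega)).trans
      (add_le_add_left h.excess_bound _)
  · obtain ⟨k, hkM, hk, hb⟩ := h.exists_cutoff
    exact (hg.labels_le hC h.γ_pos (h.γ_lt.trans (by norm_num)) hθ hkM).trans (h.label_bound hk hb)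

theorem ActiveLearner.SucceedsWithProb.mono {A : ActiveLearner X} {ε ε' n n' p p' : ℝ}
    (h : A.SucceedsWithProb D η ε n p) (hε : ε ≤ ε') (hn : n ≤ n') (hp : p' ≤ p) :
    A.SucceedsWithProb D η ε' n' p' := by
  obtain ⟨E, hE, hpE, hs⟩ := h
  exact ⟨E, hE, (ENNReal.ofReal_le_ofReal hp).trans hpE, fun ω hω =>
    ⟨(hs ω hω).1, (hs ω hω).2.1.trans hε, (hs ω hω).2.2.trans hn⟩⟩

theorem massart_upper (hR : IsRegressionClass F O) (hηF : η ∈ F) (hη : IsCondProb D η)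
    (hd : 1 ≤ d) (hpd : pdim F ≤ d) (hθ : theta F γ ≤ ENNReal.ofReal θ) (hε : 0 < ε) (hε1 : ε < 1)
    (hδ : 0 < δ) (hδ1 : δ < 1) (hmass : Massart D η γ) :
    γ ∈ Set.Ioo (0 : ℝ) (1 / 2) ∧
    (algorithm F O (chosenParams d θ ε γ δ)).SucceedsWithProb D η ε
      (10 ^ 10 * (θ * d) * (1 / γ ^ 2) * Real.log (θ * d / (ε * γ)) ^ 2 *
        Real.log (θ * d / (ε * γ * δ))) (1 - 2 * δ) := by
  obtain ⟨hγ, hnull⟩ := hmass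
  have hγ1 : γ < 1 / 2 := by
    by_contra! hcon
    have : {x | |η x - 1 / 2| ≤ γ} = Set.univ := by
      ext x
      simp only [Set.mem_ofPred_eq, Set.mem_univ, iff_true, abs_le]
      have := hR.mem_Icc η hηF x
      constructor <;> linarith [this.1, this.2]
    rw [this, measure_univ] at hnull
    exact one_ne_zero hnull
  have h : Admissible d θ ε γ δ :=
    ⟨hd, one_le_of_theta_le hηF hθ, hε, hε1, hγ, hγ1, hδ, hδ1⟩
  have hlog2 := Real.log_two_gt_d9
  have hL : 0 ≤ Real.log (θ * d / (ε * γ * δ)) := by linarith [h.log_two_le, h.log_le_log_δ]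
  have hθ0 : 0 ≤ θ * d := by linarith [h.one_le_θd]
  refine ⟨⟨hγ, hγ1⟩, (algorithm_succeedsWithProb hR hηF hη hpd hθ h).mono ?_ ?_ (by linarith)⟩
  · rw [measureReal_def, hnull]; simp
  -- The constant `10 ^ 10` instead of `10 ^ 9` is slack shared with the Tsybakov case, where
  -- halving the accuracy costs a factor `8` through the logarithms.
  · gcongr <;> norm_num

/-- The choice of `γ` makes the abstention cost `γ · c γ ^ β` equal to `ε / 2`, and the run itself
has accuracy `ε / 2`. -/
theorem tsybakov_upper {β c : ℝ} (hγdef : γ = (ε / (2 * c)) ^ (1 / (1 + β)))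
    (hR : IsRegressionClass F O) (hηF : η ∈ F) (hη : IsCondProb D η)
    (hd : 1 ≤ d) (hpd : pdim F ≤ d) (hθ : theta F γ ≤ ENNReal.ofReal θ) (hε : 0 < ε) (hε1 : ε < 1)
    (hδ : 0 < δ) (hδ1 : δ < 1) (hts : Tsybakov D η β c) :
    γ ∈ Set.Ioo (0 : ℝ) (1 / 2) ∧
    (algorithm F O (chosenParams d θ (ε / 2) γ δ)).SucceedsWithProb D η ε
      (10 ^ 10 * (θ * d) * (2 * c / ε) ^ (2 / (1 + β)) * Real.log (θ * d / (ε * γ)) ^ 2 *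
        Real.log (θ * d / (ε * γ * δ))) (1 - 2 * δ) := by
  obtain ⟨hβ, hc, hts⟩ := hts
  have hβ1 : 0 < 1 + β := by linarith
  have hx : 0 < ε / (2 * c) := by positivity
  have hγ : 0 < γ := by rw [hγdef]; positivity
  -- At `τ = 1/2` the Tsybakov event is the whole space. This forces `γ < 1/2`.
  have hc2 : 2 ^ β ≤ c := by
    have h1 := hts (1 / 2) (by norm_num)
    have : {x | |η x - 1 / 2| ≤ 1 / 2} = Set.univ := by
      ext x
      simp only [Set.mem_ofPred_eq, Set.mem_univ, iff_true, abs_le]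
      have := hR.mem_Icc η hηF x
      constructor <;> linarith [this.1, this.2]
    rw [this, measure_univ, ← ENNReal.ofReal_one, ENNReal.ofReal_le_ofReal_iff (by positivity),
      one_div, Real.inv_rpow two_pos.le, ← div_eq_mul_inv, le_div_iff₀ (by positivity)] at h1
    linarith
  have hγpow : γ ^ (1 + β) = ε / (2 * c) := by
    rw [hγdef, ← Real.rpow_mul hx.le, one_div, inv_mul_cancel₀ hβ1.ne', Real.rpow_one]
  have hγ1 : γ < 1 / 2 := by
    rw [← Real.rpow_lt_rpow_iff hγ.le (by norm_num) hβ1, hγpow, one_div,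
      Real.inv_rpow two_pos.le, Real.rpow_add two_pos, Real.rpow_one, div_lt_iff₀ (by positivity),
      inv_mul_eq_div, lt_div_iff₀ (by positivity)]
    nlinarith [Real.rpow_pos_of_pos two_pos β]
  have h : Admissible d θ (ε / 2) γ δ :=
    ⟨hd, one_le_of_theta_le hηF hθ, by linarith, by linarith, hγ, hγ1, hδ, hδ1⟩
  have h' : Admissible d θ ε γ δ :=
    ⟨hd, one_le_of_theta_le hηF hθ, hε, hε1, hγ, hγ1, hδ, hδ1⟩
  refine ⟨⟨hγ, hγ1⟩, (algorithm_succeedsWithProb hR hηF hη hpd hθ h).mono ?_ ?_ (by linarith)⟩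
  · have h1 : D.fst.real {x | |η x - 1 / 2| ≤ γ} ≤ c * γ ^ β := by
      rw [measureReal_def]
      exact ENNReal.toReal_le_of_le_ofReal (by positivity) (hts γ hγ)
    have h2 : γ * (c * γ ^ β) = ε / 2 := by
      rw [Real.rpow_add hγ, Real.rpow_one] at hγpow
      calc γ * (c * γ ^ β) = c * (γ * γ ^ β) := by ring
        _ = ε / 2 := by rw [hγpow]; field_simp
    have h3 := mul_le_mul_of_nonneg_left h1 hγ.le
    linarith
  · have e1 : θ * d / (ε / 2 * γ) = 2 * (θ * d / (ε * γ)) := by field_simp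
    have e2 : θ * d / (ε / 2 * γ * δ) = 2 * (θ * d / (ε * γ * δ)) := by field_simp
    have e3 : 1 / γ ^ 2 = (2 * c / ε) ^ (2 / (1 + β)) := by
      rw [hγdef, ← Real.rpow_natCast, ← Real.rpow_mul hx.le, one_div, ← Real.inv_rpow hx.le,
        inv_div]
      congr 1
      push_cast
      ring
    have hp1 := h'.two_le
    have hp2 := h'.le_div_δ
    have hl1 := h'.log_two_le
    have hl2 := h'.log_le_log_δ
    have hlog2 := Real.log_two_gt_d9
    have hθ0 : 0 ≤ θ * d := by linarith [h.one_le_θd]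
    rw [e1, e2, ← e3, Real.log_mul two_ne_zero (by linarith : (0 : ℝ) < _).ne',
      Real.log_mul two_ne_zero (by linarith : (0 : ℝ) < _).ne']
    set ℓ := Real.log (θ * d / (ε * γ))
    set L := Real.log (θ * d / (ε * γ * δ))
    have hL0 : 0 ≤ L := by linarith
    calc 10 ^ 9 * (θ * d) * (1 / γ ^ 2) * (Real.log 2 + ℓ) ^ 2 * (Real.log 2 + L)
        ≤ 10 ^ 9 * (θ * d) * (1 / γ ^ 2) * (2 * ℓ) ^ 2 * (2 * L) := by
          gcongr <;> linarith
      _ = 8 * 10 ^ 9 * ((θ * d) * (1 / γ ^ 2) * ℓ ^ 2 * L) := by ring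
      _ ≤ 10 ^ 10 * ((θ * d) * (1 / γ ^ 2) * ℓ ^ 2 * L) := by
          gcongr
          norm_num
      _ = _ := by ring

end Upper

/-! ### A pair of hard regression functions -/

section HardPair

/-- The regression function on two points with value `1/2 + a` at `true` and `1` at `false`. -/
noncomputable def hardFun (a : ℝ) : Bool → ℝ := fun x => if x then 1 / 2 + a else 1

/-- The class of the two regression functions `hardFun a` and `hardFun (-a)`. -/
def hardClass (a : ℝ) : Set (Bool → ℝ) := {hardFun a, hardFun (-a)}

open Classical in
/-- Least squares over `hardClass a`. -/
noncomputable def hardOracle (a : ℝ) (S : History Bool) : Bool → ℝ :=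
  if sqLoss S (hardFun a) ≤ sqLoss S (hardFun (-a)) then hardFun a else hardFun (-a)

/-- The distribution with mass `w` at the point `true` and conditional probability `hardFun a`. -/
noncomputable def hardDist (w a : ℝ) : Measure (Bool × Bool) :=
  ENNReal.ofReal (w * (1 / 2 + a)) • Measure.dirac (true, true) +
    ENNReal.ofReal (w * (1 / 2 - a)) • Measure.dirac (true, false) +
    ENNReal.ofReal (1 - w) • Measure.dirac (false, true)

variable {w a : ℝ}

theorem isRegressionClass_hardClass (ha0 : 0 ≤ a) (ha : a ≤ 1 / 2) :
    IsRegressionClass (hardClass a) (hardOracle a) where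
  mem_Icc := by
    rintro f (rfl | rfl) x <;> cases x <;> simp only [hardFun] <;> constructor <;>
      norm_num <;> linarith
  oracle := by
    intro S
    unfold hardOracle
    split_ifs with h
    · refine ⟨Or.inl rfl, ?_⟩
      rintro f (rfl | rfl)
      exacts [le_rfl, h]
    · refine ⟨Or.inr rfl, ?_⟩
      rintro f (rfl | rfl)
      exacts [(not_le.1 h).le, le_rfl]
  measurable := fun _ _ => Measurable.of_discrete
  separable := ⟨hardClass a, subset_rfl, (Set.toFinite {hardFun a, hardFun (-a)}).countable,
    fun f hf => ⟨fun _ => f, fun _ => hf, fun _ => tendsto_const_nhds⟩⟩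
  measurable_lcb := fun _ _ _ => Measurable.of_discrete
  measurable_ucb := fun _ _ _ => Measurable.of_discrete

theorem pdim_hardClass_le (a : ℝ) : pdim (hardClass a) ≤ 1 := by
  refine iSup₂_le fun S hS => ?_
  by_contra! hcard
  obtain ⟨p, hp, q, hq, hpq⟩ := Finset.one_lt_card.1 (by exact_mod_cast hcard)
  obtain ⟨f, hf, hf'⟩ := hS ∅ (by simp)
  obtain ⟨g, hg, hg'⟩ := hS {p} (by simpa using hp)
  obtain ⟨k, hk, hk'⟩ := hS {q} (by simpa using hq)
  have hfg : f ≠ g := by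
    rintro rfl
    simpa using (hf' p hp).symm.trans (hg' p hp)
  have hfk : f ≠ k := by
    rintro rfl
    simpa using (hf' q hq).symm.trans (hk' q hq)
  have hgk : g ≠ k := by
    rintro rfl
    simpa [hpq] using (hg' p hp).symm.trans (hk' p hp)
  rcases hf with rfl | rfl <;> rcases hg with rfl | rfl <;> rcases hk with rfl | rfl <;>
    contradiction

/-- Members differ only at `true`, so the disagreement set is contained in `{true}`. A value gap
above `γ'` there contributes at least `γ'² μ {true}` to the squared `L²` distance, which is at most
`ε²`. -/
theorem theta_hardClass_le (a : ℝ) {γ : ℝ} (hγ : 0 < γ) : theta (hardClass a) γ ≤ 1 := by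
  refine iSup₂_le fun g hg => iSup₂_le fun ι hι => sup_le ?_ le_rfl
  refine iSup₂_le fun μ _ => iSup₂_le fun γ' hγ' => iSup₂_le fun ε hε => ?_
  have hε0 : 0 < ε := hι.trans hε
  have hγ0 : 0 < γ' := by linarith
  set R := {x | ∃ f ∈ hardClass a, |f x - g x| > γ' ∧
    Real.sqrt (∫ x', (f x' - g x') ^ 2 ∂μ) ≤ ε} with hR
  have heq : ∀ f ∈ hardClass a, f false - g false = 0 := by
    intro f hf
    rcases hf with rfl | rfl <;> rcases hg with rfl | rfl <;> simp [hardFun]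
  have hsub : R ⊆ {true} := by
    rintro (_ | _) ⟨f, hf, h, -⟩
    · rw [heq f hf, abs_zero] at h
      linarith
    · rfl
  rcases R.eq_empty_or_nonempty with h0 | ⟨x, hx⟩
  · simp [h0]
  · obtain rfl : x = true := hsub hx
    obtain ⟨f, hf, h1, h2⟩ := hx
    rw [Real.sqrt_le_left hε0.le, integral_fintype (Integrable.of_finite)] at h2
    simp only [Fintype.sum_bool, heq f hf, smul_eq_mul] at h2
    have h3 : γ' ^ 2 ≤ (f true - g true) ^ 2 := by
      rw [← sq_abs (f true - g true)]
      exact pow_le_pow_left₀ hγ0.le h1.le 2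
    calc ENNReal.ofReal (γ' ^ 2 / ε ^ 2) * μ R
        ≤ ENNReal.ofReal (γ' ^ 2 / ε ^ 2) * μ {true} := by gcongr
      _ = ENNReal.ofReal (γ' ^ 2 / ε ^ 2 * μ.real {true}) := by
          rw [ENNReal.ofReal_mul (by positivity), ofReal_measureReal]
      _ ≤ 1 := by
          rw [← ENNReal.ofReal_one]
          refine ENNReal.ofReal_le_ofReal ?_
          rw [div_mul_eq_mul_div, div_le_one (by positivity)]
          have h4 := mul_le_mul_of_nonneg_right h3 (measureReal_nonneg (μ := μ) (s := {true}))
          linarith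

theorem lintegral_hardDist (w a : ℝ) (f : Bool × Bool → ENNReal) :
    ∫⁻ z, f z ∂(hardDist w a) = ENNReal.ofReal (w * (1 / 2 + a)) * f (true, true) +
      ENNReal.ofReal (w * (1 / 2 - a)) * f (true, false) +
      ENNReal.ofReal (1 - w) * f (false, true) := by
  simp [hardDist, lintegral_add_measure, lintegral_smul_measure]

theorem integral_hardDist (hw0 : 0 ≤ w) (hw : w ≤ 1) (ha : |a| ≤ 1 / 2) (f : Bool × Bool → ℝ) :
    ∫ z, f z ∂(hardDist w a) = w * (1 / 2 + a) * f (true, true) +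
      w * (1 / 2 - a) * f (true, false) + (1 - w) * f (false, true) := by
  obtain ⟨h1, h2⟩ := abs_le.1 ha
  have hint : ∀ (p : ℝ) (z : Bool × Bool),
      Integrable f (ENNReal.ofReal p • Measure.dirac z) := fun p z =>
    (integrable_dirac (by simp)).smul_measure ENNReal.ofReal_ne_top
  rw [hardDist, integral_add_measure ((hint _ _).add_measure (hint _ _)) (hint _ _),
    integral_add_measure (hint _ _) (hint _ _)]
  simp only [integral_smul_measure, integral_dirac, smul_eq_mul]
  rw [ENNReal.toReal_ofReal (by nlinarith), ENNReal.toReal_ofReal (by nlinarith),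
    ENNReal.toReal_ofReal (by linarith)]

theorem isProbabilityMeasure_hardDist (hw0 : 0 ≤ w) (hw : w ≤ 1) (ha : |a| ≤ 1 / 2) :
    IsProbabilityMeasure (hardDist w a) := by
  obtain ⟨h1, h2⟩ := abs_le.1 ha
  refine ⟨?_⟩
  rw [← lintegral_one, lintegral_hardDist, mul_one, mul_one, mul_one,
    ← ENNReal.ofReal_add (by nlinarith) (by nlinarith),
    ← ENNReal.ofReal_add (by nlinarith) (by linarith), ← ENNReal.ofReal_one]
  congr 1
  ring

theorem lintegral_fst_hardDist (hw0 : 0 ≤ w) (ha : |a| ≤ 1 / 2) (f : Bool → ENNReal) :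
    ∫⁻ x, f x ∂(hardDist w a).fst =
      ENNReal.ofReal w * f true + ENNReal.ofReal (1 - w) * f false := by
  obtain ⟨h1, h2⟩ := abs_le.1 ha
  rw [Measure.fst, lintegral_map Measurable.of_discrete measurable_fst, lintegral_hardDist,
    ← add_mul, ← ENNReal.ofReal_add (by nlinarith) (by nlinarith)]
  congr 3
  ring

theorem fst_hardDist_apply (hw0 : 0 ≤ w) (ha : |a| ≤ 1 / 2) (S : Set Bool) :
    (hardDist w a).fst S = ENNReal.ofReal w * S.indicator 1 true +
      ENNReal.ofReal (1 - w) * S.indicator 1 false := by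
  rw [← lintegral_fst_hardDist hw0 ha, lintegral_indicator_one MeasurableSet.of_discrete]

theorem isCondProb_hardDist (hw0 : 0 ≤ w) (ha : |a| ≤ 1 / 2) :
    IsCondProb (hardDist w a) (hardFun a) := by
  refine ⟨Measurable.of_discrete, fun S _ => ?_⟩
  rw [← lintegral_indicator_one MeasurableSet.of_discrete, lintegral_hardDist,
    ← lintegral_indicator MeasurableSet.of_discrete, lintegral_fst_hardDist hw0 ha]
  by_cases h1 : true ∈ S <;> by_cases h2 : false ∈ S <;>
    simp [h1, h2, hardFun, ENNReal.ofReal_mul hw0]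

/-- A wrong sign at `true` loses `2 a w`, and leaning the wrong way loses at least half of it.
Together with the mirror statement for `-a`, excess below `a w` identifies the sign of the bias. -/
theorem excess_hardDist_ge (hw0 : 0 ≤ w) (hw : w ≤ 1) (ha0 : 0 < a) (ha : a ≤ 1 / 2)
    {p : RandClassifier Bool} (hp : (p true : ℝ) ≤ 1 / 2) :
    a * w ≤ excess (hardDist w a) (hardFun a) p := by
  have ha' : |a| ≤ 1 / 2 := by rwa [abs_of_pos ha0]
  have e1 : plugIn (hardFun a) true = 1 := by
    simp only [plugIn, hardFun, if_true]
    rw [if_pos (by linarith)]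
  have e2 : plugIn (hardFun a) false = 1 := by
    simp only [plugIn, hardFun]
    norm_num
  have h3 := (p false).2.2
  rw [excess, err, err, integral_hardDist hw0 hw ha', integral_hardDist hw0 hw ha']
  simp only [e1, e2, if_true, Bool.false_eq_true, if_false, Set.Icc.coe_one]
  have h4 := mul_nonneg (sub_nonneg.2 hw) (sub_nonneg.2 h3)
  have h5 := mul_nonneg (mul_nonneg ha0.le hw0) (sub_nonneg.2 hp)
  nlinarith

theorem excess_hardDist_neg_ge (hw0 : 0 ≤ w) (hw : w ≤ 1) (ha0 : 0 < a) (ha : a ≤ 1 / 2)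
    {p : RandClassifier Bool} (hp : 1 / 2 ≤ (p true : ℝ)) :
    a * w ≤ excess (hardDist w (-a)) (hardFun (-a)) p := by
  have ha' : |-a| ≤ 1 / 2 := by rwa [abs_neg, abs_of_pos ha0]
  have e1 : plugIn (hardFun (-a)) true = 0 := by
    simp only [plugIn, hardFun, if_true]
    rw [if_neg (by linarith)]
  have e2 : plugIn (hardFun (-a)) false = 1 := by
    simp only [plugIn, hardFun]
    norm_num
  have h3 := (p false).2.2
  rw [excess, err, err, integral_hardDist hw0 hw ha', integral_hardDist hw0 hw ha']
  simp only [e1, e2, if_true, Bool.false_eq_true, if_false, Set.Icc.coe_one, Set.Icc.coe_zero]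
  have h4 := mul_nonneg (sub_nonneg.2 hw) (sub_nonneg.2 h3)
  have h5 := mul_nonneg (mul_nonneg ha0.le hw0) (sub_nonneg.2 hp)
  nlinarith

end HardPair

/-! ### Distinguishing two label probabilities with few queries -/

section Distinguish

variable {w a : ℝ}

/-- The number of queried labels in a history. -/
def History.count {X : Type u} (H : History X) : ℕ := H.countP fun z => z.2.isSome

open Classical in
/-- The history after one more observation. -/
noncomputable def ActiveLearner.extend {X : Type u} (A : ActiveLearner X) (H : History X)
    (z : X × Bool) : History X :=
  H ++ [(z.1, if A.query H z.1 then some z.2 else none)]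

theorem ActiveLearner.history_succ {X : Type u} (A : ActiveLearner X) (ω : ℕ → X × Bool) (t : ℕ) :
    A.history ω (t + 1) = A.extend (A.history ω t) (ω t) := rfl

/-- The conditional expectation of `g` after one more observation from `hardDist w a`. -/
noncomputable def ActiveLearner.step (A : ActiveLearner Bool) (w a : ℝ) (g : History Bool → ℝ)
    (H : History Bool) : ℝ :=
  w * (1 / 2 + a) * g (A.extend H (true, true)) + w * (1 / 2 - a) * g (A.extend H (true, false)) +
    (1 - w) * g (A.extend H (false, true))

/-- No measurability of the learner is required: there are only finitely many possible observations
at each time. -/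
theorem ActiveLearner.measurable_comp_history (A : ActiveLearner Bool) (t : ℕ)
    (φ : History Bool → ENNReal) : Measurable fun ω => φ (A.history ω t) := by
  induction t generalizing φ with
  | zero =>
    have h0 : Measurable fun _ : ℕ → Bool × Bool => φ [] := measurable_const
    exact h0
  | succ t ih =>
    have h1 : Measurable fun q : (Bool × Bool) × (ℕ → Bool × Bool) =>
        φ (A.extend (A.history q.2 t) q.1) :=
      measurable_from_prod_countable_right fun z => ih fun H => φ (A.extend H z)
    have h2 : Measurable fun ω : ℕ → Bool × Bool => (ω t, ω) :=
      (measurable_pi_apply t).prodMk measurable_id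
    have h3 := h1.comp h2
    exact h3

theorem ActiveLearner.step_nonneg (A : ActiveLearner Bool) (hw0 : 0 ≤ w) (hw : w ≤ 1)
    (ha : |a| ≤ 1 / 2) {g : History Bool → ℝ} (hg : ∀ H, 0 ≤ g H) (H : History Bool) :
    0 ≤ A.step w a g H := by
  obtain ⟨h1, h2⟩ := abs_le.1 ha
  exact add_nonneg (add_nonneg (mul_nonneg (mul_nonneg hw0 (by linarith)) (hg _))
    (mul_nonneg (mul_nonneg hw0 (by linarith)) (hg _))) (mul_nonneg (by linarith) (hg _))

/-- Integrating out the last observation is one `step`, so probabilities of events of the final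
history are computed by backward recursion from the empty one. -/
theorem ActiveLearner.lintegral_history (A : ActiveLearner Bool) (hw0 : 0 ≤ w) (hw : w ≤ 1)
    (ha : |a| ≤ 1 / 2) [IsProbabilityMeasure (hardDist w a)] (t : ℕ) {g : History Bool → ℝ}
    (hg : ∀ H, 0 ≤ g H) :
    ∫⁻ ω, ENNReal.ofReal (g (A.history ω t)) ∂(streamLaw (hardDist w a)) =
      ENNReal.ofReal ((A.step w a)^[t] g []) := by
  induction t generalizing g with
  | zero => simp [ActiveLearner.history]
  | succ t ih =>
    obtain ⟨h1, h2⟩ := abs_le.1 ha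
    rw [lintegral_update _ t (A.measurable_comp_history (t + 1) fun H => ENNReal.ofReal (g H)),
      Function.iterate_succ_apply, ← ih (A.step_nonneg hw0 hw ha hg)]
    refine lintegral_congr fun ω => ?_
    have h3 : ∀ z, A.history (Function.update ω t z) t = A.history ω t := fun z =>
      history_congr _ fun s hs => Function.update_of_ne hs.ne _ _
    simp only [ActiveLearner.history_succ, h3, Function.update_self]
    rw [lintegral_hardDist, ← ENNReal.ofReal_mul (mul_nonneg hw0 (by linarith)),
      ← ENNReal.ofReal_mul (mul_nonneg hw0 (by linarith)), ← ENNReal.ofReal_mul (by linarith),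
      ← ENNReal.ofReal_add, ← ENNReal.ofReal_add]
    · rfl
    · exact add_nonneg (mul_nonneg (mul_nonneg hw0 (by linarith)) (hg _))
        (mul_nonneg (mul_nonneg hw0 (by linarith)) (hg _))
    · exact mul_nonneg (by linarith) (hg _)
    · exact mul_nonneg (mul_nonneg hw0 (by linarith)) (hg _)
    · exact mul_nonneg (mul_nonneg hw0 (by linarith)) (hg _)

theorem ActiveLearner.count_extend_of_query {X : Type u} {A : ActiveLearner X} {H : History X}
    {z : X × Bool} (h : A.query H z.1) : (A.extend H z).count = H.count + 1 := by
  simp [ActiveLearner.extend, History.count, h]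

theorem ActiveLearner.extend_of_not_query {X : Type u} {A : ActiveLearner X} {H : History X}
    {z : X × Bool} (h : ¬ A.query H z.1) : A.extend H z = H ++ [(z.1, none)] := by
  simp [ActiveLearner.extend, h]

theorem History.count_append_none {X : Type u} (H : History X) (x : X) :
    History.count (H ++ [(x, none)]) = H.count := by
  simp [History.count]

theorem ActiveLearner.count_le_count_extend {X : Type u} (A : ActiveLearner X) (H : History X)
    (z : X × Bool) : H.count ≤ (A.extend H z).count := by
  simp [ActiveLearner.extend, History.count]

/-- The invariant of the induction over the observations: `g₁` and `g₂` are (conditional)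
probabilities of disjoint events on which at most `n` labels are queried, under the
distributions `hardDist w a` and `hardDist w (-a)`. Here `ρ ^ 2 = 1 - 4 a ^ 2`. -/
structure Separated (n : ℕ) (ρ : ℝ) (g₁ g₂ : History Bool → ℝ) : Prop where
  eq_zero₁ : ∀ H : History Bool, n < H.count → g₁ H = 0
  eq_zero₂ : ∀ H : History Bool, n < H.count → g₂ H = 0
  le : ∀ H : History Bool, ∀ s t : ℝ, 0 ≤ s → 0 ≤ t →
    s ^ 2 * g₁ H + t ^ 2 * g₂ H ≤ 4 / 3 * (s ^ 2 + t ^ 2 - s * t * ρ ^ (n - H.count))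

/-- The free weights `s, t` make the inequality inductive: they absorb the square roots of the label
likelihoods. The two labels contribute cross terms `s t √(1/4 - a²)` each, together `s t ρ`.
Unqueried points carry no information, since the marginals agree, and leave the count unchanged. -/
theorem Separated.step {n : ℕ} {ρ : ℝ} {g₁ g₂ : History Bool → ℝ} (h : Separated n ρ g₁ g₂)
    (A : ActiveLearner Bool) (hw0 : 0 ≤ w) (hw : w ≤ 1) (ha : |a| ≤ 1 / 2) (hρ0 : 0 ≤ ρ)
    (hρ1 : ρ ≤ 1) (hρ : ρ ^ 2 = 1 - 4 * a ^ 2) :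
    Separated n ρ (A.step w a g₁) (A.step w (-a) g₂) := by
  obtain ⟨ha1, ha2⟩ := abs_le.1 ha
  refine ⟨fun H hH => ?_, fun H hH => ?_, fun H s t hs ht => ?_⟩
  · have h0 : ∀ z, g₁ (A.extend H z) = 0 := fun z =>
      h.eq_zero₁ _ (hH.trans_le (A.count_le_count_extend H z))
    simp [ActiveLearner.step, h0]
  · have h0 : ∀ z, g₂ (A.extend H z) = 0 := fun z =>
      h.eq_zero₂ _ (hH.trans_le (A.count_le_count_extend H z))
    simp [ActiveLearner.step, h0]
  · have hst : 0 ≤ s * t := mul_nonneg hs ht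
    rcases lt_or_ge n H.count with hH | hH
    · have h1 : ∀ z, g₁ (A.extend H z) = 0 := fun z =>
        h.eq_zero₁ _ (hH.trans_le (A.count_le_count_extend H z))
      have h2 : ∀ z, g₂ (A.extend H z) = 0 := fun z =>
        h.eq_zero₂ _ (hH.trans_le (A.count_le_count_extend H z))
      simp only [ActiveLearner.step, h1, h2, mul_zero, add_zero, Nat.sub_eq_zero_of_le hH.le,
        pow_zero, mul_one]
      nlinarith [sq_nonneg (s - t)]
    · have hfalse : s ^ 2 * g₁ (A.extend H (false, true)) + t ^ 2 * g₂ (A.extend H (false, true)) ≤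
          4 / 3 * (s ^ 2 + t ^ 2 - s * t * ρ ^ (n - H.count)) := by
        by_cases hq : A.query H false
        · have hc := ActiveLearner.count_extend_of_query (z := (false, true)) hq
          rcases hH.lt_or_eq with hlt | heq
          · refine (h.le _ s t hs ht).trans ?_
            have : ρ ^ (n - H.count) ≤ ρ ^ (n - (A.extend H (false, true)).count) :=
              pow_le_pow_of_le_one hρ0 hρ1 (by omega)
            nlinarith [mul_le_mul_of_nonneg_left this hst]
          -- The label budget is exhausted, so a further query makes both success probabilities
          -- vanish.
          · rw [h.eq_zero₁ _ (by omega), h.eq_zero₂ _ (by omega), heq, Nat.sub_self]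
            nlinarith [sq_nonneg (s - t)]
        · rw [ActiveLearner.extend_of_not_query (z := (false, true)) hq]
          have := h.le (H ++ [(false, none)]) s t hs ht
          rwa [History.count_append_none] at this
      have htrue : s ^ 2 * ((1 / 2 + a) * g₁ (A.extend H (true, true)) +
            (1 / 2 - a) * g₁ (A.extend H (true, false))) +
          t ^ 2 * ((1 / 2 - a) * g₂ (A.extend H (true, true)) +
            (1 / 2 + a) * g₂ (A.extend H (true, false))) ≤
          4 / 3 * (s ^ 2 + t ^ 2 - s * t * ρ ^ (n - H.count)) := by
        by_cases hq : A.query H true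
        · have hc1 := ActiveLearner.count_extend_of_query (z := (true, true)) hq
          have hc2 := ActiveLearner.count_extend_of_query (z := (true, false)) hq
          rcases hH.lt_or_eq with hlt | heq
          · obtain ⟨j, hj⟩ : ∃ j, n - H.count = j + 1 := ⟨n - H.count - 1, by omega⟩
            set r := Real.sqrt (1 / 2 + a) with hr
            set q := Real.sqrt (1 / 2 - a) with hq'
            have hr0 : 0 ≤ r := Real.sqrt_nonneg _
            have hq0 : 0 ≤ q := Real.sqrt_nonneg _
            have hr2 : r ^ 2 = 1 / 2 + a := Real.sq_sqrt (by linarith)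
            have hq2 : q ^ 2 = 1 / 2 - a := Real.sq_sqrt (by linarith)
            have hrq : r * q = ρ / 2 := by
              refine (sq_eq_sq₀ (mul_nonneg hr0 hq0) (by linarith)).1 ?_
              rw [mul_pow, hr2, hq2, div_pow, hρ]
              ring
            have h1 := h.le (A.extend H (true, true)) (s * r) (t * q) (mul_nonneg hs hr0)
              (mul_nonneg ht hq0)
            have h2 := h.le (A.extend H (true, false)) (s * q) (t * r) (mul_nonneg hs hq0)
              (mul_nonneg ht hr0)
            rw [hc1, show n - (H.count + 1) = j by omega] at h1
            rw [hc2, show n - (H.count + 1) = j by omega] at h2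
            have e1 : s * r * (t * q) = s * t * (ρ / 2) := by rw [← hrq]; ring
            have e2 : s * q * (t * r) = s * t * (ρ / 2) := by rw [← hrq]; ring
            rw [e1, mul_pow, mul_pow, hr2, hq2] at h1
            rw [e2, mul_pow, mul_pow, hr2, hq2] at h2
            rw [hj, pow_succ ρ j]
            linarith
          · rw [h.eq_zero₁ _ (by omega), h.eq_zero₂ _ (by omega), h.eq_zero₁ _ (by omega),
              h.eq_zero₂ _ (by omega), heq, Nat.sub_self]
            nlinarith [sq_nonneg (s - t)]
        · rw [ActiveLearner.extend_of_not_query (z := (true, true)) hq,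
            ActiveLearner.extend_of_not_query (z := (true, false)) hq]
          have := h.le (H ++ [(true, none)]) s t hs ht
          rw [History.count_append_none] at this
          simp only
          linarith
      have h1 := mul_le_mul_of_nonneg_left htrue hw0
      have h2 := mul_le_mul_of_nonneg_left hfalse (sub_nonneg.2 hw)
      simp only [ActiveLearner.step]
      linarith

theorem Separated.iterate {n : ℕ} {ρ : ℝ} {g₁ g₂ : History Bool → ℝ} (h : Separated n ρ g₁ g₂)
    (A : ActiveLearner Bool) (hw0 : 0 ≤ w) (hw : w ≤ 1) (ha : |a| ≤ 1 / 2) (hρ0 : 0 ≤ ρ)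
    (hρ1 : ρ ≤ 1) (hρ : ρ ^ 2 = 1 - 4 * a ^ 2) (k : ℕ) :
    Separated n ρ ((A.step w a)^[k] g₁) ((A.step w (-a))^[k] g₂) := by
  induction k generalizing g₁ g₂ with
  | zero => exact h
  | succ k ih =>
    rw [Function.iterate_succ_apply, Function.iterate_succ_apply]
    exact ih (h.step A hw0 hw ha hρ0 hρ1 hρ)

/-- At a final history at most one indicator is one. The constant `4/3` is what turns `4/3 (s² + t²
- s t) - s²` into the square `(s - 2 t)² / 3`. -/
theorem separated_indicator (n : ℕ) {ρ : ℝ} (hρ0 : 0 ≤ ρ) (hρ1 : ρ ≤ 1) {G₁ G₂ : Set (History Bool)}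
    (h1 : ∀ H ∈ G₁, H.count ≤ n) (h2 : ∀ H ∈ G₂, H.count ≤ n) (hd : Disjoint G₁ G₂) :
    Separated n ρ (G₁.indicator 1) (G₂.indicator 1) := by
  refine ⟨fun H hH => ?_, fun H hH => ?_, fun H s t hs ht => ?_⟩
  · exact Set.indicator_of_notMem (fun hm => absurd (h1 H hm) (not_le.2 hH)) _
  · exact Set.indicator_of_notMem (fun hm => absurd (h2 H hm) (not_le.2 hH)) _
  · have h3 : ρ ^ (n - H.count) ≤ 1 := pow_le_one₀ hρ0 hρ1
    have h4 := mul_le_mul_of_nonneg_left h3 (mul_nonneg hs ht)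
    by_cases hm1 : H ∈ G₁
    · have hm2 : H ∉ G₂ := Set.disjoint_left.1 hd hm1
      rw [Set.indicator_of_mem hm1, Set.indicator_of_notMem hm2, Pi.one_apply]
      nlinarith [sq_nonneg (s - 2 * t)]
    · rw [Set.indicator_of_notMem hm1]
      by_cases hm2 : H ∈ G₂
      · rw [Set.indicator_of_mem hm2, Pi.one_apply]
        nlinarith [sq_nonneg (2 * s - t)]
      · rw [Set.indicator_of_notMem hm2]
        nlinarith [sq_nonneg (s - t)]

/-- A deterministic learner with few labels cannot recognize both distributions. -/
theorem ActiveLearner.measure_add_measure_le (A : ActiveLearner Bool) (hw0 : 0 ≤ w) (hw : w ≤ 1)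
    (ha : |a| ≤ 1 / 2) [IsProbabilityMeasure (hardDist w a)]
    [IsProbabilityMeasure (hardDist w (-a))] (n : ℕ) {G₁ G₂ : Set (History Bool)}
    (h1 : ∀ H ∈ G₁, H.count ≤ n) (h2 : ∀ H ∈ G₂, H.count ≤ n) (hd : Disjoint G₁ G₂) :
    streamLaw (hardDist w a) {ω | A.history ω A.horizon ∈ G₁} +
      streamLaw (hardDist w (-a)) {ω | A.history ω A.horizon ∈ G₂} ≤
      ENNReal.ofReal (8 / 3 - 4 / 3 * Real.sqrt (1 - 4 * a ^ 2) ^ n) := by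
  have ha2 : a ^ 2 ≤ 1 / 4 := by
    rw [← sq_abs]
    nlinarith [abs_nonneg a]
  have hρ0 := Real.sqrt_nonneg (1 - 4 * a ^ 2)
  have hρ1 : Real.sqrt (1 - 4 * a ^ 2) ≤ 1 := Real.sqrt_le_one.2 (by nlinarith)
  have hρ := Real.sq_sqrt (by linarith : 0 ≤ 1 - 4 * a ^ 2)
  have key := ((separated_indicator n hρ0 hρ1 h1 h2 hd).iterate A hw0 hw ha hρ0 hρ1 hρ
    A.horizon).le [] 1 1 zero_le_one zero_le_one
  have hind : ∀ (G : Set (History Bool)) (H : History Bool),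
      0 ≤ G.indicator (1 : History Bool → ℝ) H := fun G H =>
    Set.indicator_nonneg (fun _ _ => zero_le_one) H
  have hmeas : ∀ (b : ℝ) (_ : |b| ≤ 1 / 2) [IsProbabilityMeasure (hardDist w b)]
      (G : Set (History Bool)), streamLaw (hardDist w b) {ω | A.history ω A.horizon ∈ G} =
        ENNReal.ofReal ((A.step w b)^[A.horizon] (G.indicator 1) []) := by
    intro b hb _ G
    rw [← A.lintegral_history hw0 hw hb A.horizon (hind G)]
    have hm : Measurable fun ω => G.indicator (1 : History Bool → ENNReal) (A.history ω A.horizon) :=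
      A.measurable_comp_history _ _
    have hS : MeasurableSet {ω | A.history ω A.horizon ∈ G} := by
      have : {ω | A.history ω A.horizon ∈ G} =
          (fun ω => G.indicator (1 : History Bool → ENNReal) (A.history ω A.horizon)) ⁻¹' {1} := by
        ext ω
        by_cases h : A.history ω A.horizon ∈ G <;> simp [h]
      rw [this]
      exact hm (measurableSet_singleton 1)
    rw [← lintegral_indicator_one hS]
    refine lintegral_congr fun ω => ?_
    by_cases h : A.history ω A.horizon ∈ G <;> simp [h]
  have hit : ∀ (b : ℝ) (_ : |b| ≤ 1 / 2) (k : ℕ) {g : History Bool → ℝ} (_ : ∀ H, 0 ≤ g H)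
      (H : History Bool), 0 ≤ (A.step w b)^[k] g H := by
    intro b hb k
    induction k with
    | zero => exact fun hg => hg
    | succ k ih =>
      intro g hg
      rw [Function.iterate_succ_apply]
      exact ih (A.step_nonneg hw0 hw hb hg)
  have ha' : |-a| ≤ 1 / 2 := by rwa [abs_neg]
  rw [hmeas a ha, hmeas (-a) ha', ← ENNReal.ofReal_add (hit a ha _ (hind G₁) [])
    (hit (-a) ha' _ (hind G₂) [])]
  refine ENNReal.ofReal_le_ofReal ?_
  simp only [History.count, List.countP_nil, Nat.sub_zero] at key
  linarith

/-- Lower bound on the number of labels of a randomized learner that succeeds under both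
distributions. -/
theorem labels_ge_of_succeedsWithProb {U : Type v} [MeasurableSpace U] {ν : Measure U}
    [IsProbabilityMeasure ν] {A : U → ActiveLearner Bool} (hw0 : 0 ≤ w) (hw : w ≤ 1) (ha0 : 0 < a)
    (ha : a ≤ 1 / 2) [IsProbabilityMeasure (hardDist w a)]
    [IsProbabilityMeasure (hardDist w (-a))] {ε n : ℝ} (hε : ε < a * w)
    (h1 : RandLearnerSucceedsWithProb ν A (hardDist w a) (hardFun a) ε n (3 / 4))
    (h2 : RandLearnerSucceedsWithProb ν A (hardDist w (-a)) (hardFun (-a)) ε n (3 / 4)) :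
    15 / 256 * (1 / a ^ 2) ≤ n := by
  obtain ⟨E₁, hE₁, hp₁, hs₁⟩ := h1
  obtain ⟨E₂, hE₂, hp₂, hs₂⟩ := h2
  have ha' : |a| ≤ 1 / 2 := by rwa [abs_of_pos ha0]
  set N := ⌊n⌋₊ with hN
  set ρ := Real.sqrt (1 - 4 * a ^ 2) with hρdef
  have ha2 : a ^ 2 ≤ 1 / 4 := by nlinarith
  have hρ := Real.sq_sqrt (by linarith : 0 ≤ 1 - 4 * a ^ 2)
  have hρ0 := Real.sqrt_nonneg (1 - 4 * a ^ 2)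
  rw [← hρdef] at hρ hρ0
  -- For a fixed seed the learner is deterministic, and success under the two distributions forces
  -- opposite leanings at `true`. The seed is then integrated out.
  have hslice : ∀ s, streamLaw (hardDist w a) (Prod.mk s ⁻¹' E₁) +
      streamLaw (hardDist w (-a)) (Prod.mk s ⁻¹' E₂) ≤
      ENNReal.ofReal (8 / 3 - 4 / 3 * ρ ^ N) := by
    intro s
    refine le_trans (add_le_add ?_ ?_) ((A s).measure_add_measure_le hw0 hw ha' N
      (G₁ := {H | 1 / 2 < ((A s).output H true : ℝ) ∧ H.count ≤ N})
      (G₂ := {H | ((A s).output H true : ℝ) < 1 / 2 ∧ H.count ≤ N})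
      (fun H hH => hH.2) (fun H hH => hH.2)
      (Set.disjoint_left.2 fun H hH hH' => lt_asymm hH.1 hH'.1))
    · refine measure_mono fun ω hω => ?_
      obtain ⟨-, he, hl⟩ := hs₁ (s, ω) hω
      refine ⟨?_, Nat.le_floor hl⟩
      by_contra! hcon
      have := excess_hardDist_ge hw0 hw ha0 ha (p := (A s).learned ω) hcon
      exact absurd (this.trans he) (not_le.2 hε)
    · refine measure_mono fun ω hω => ?_
      obtain ⟨-, he, hl⟩ := hs₂ (s, ω) hω
      refine ⟨?_, Nat.le_floor hl⟩
      by_contra! hcon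
      have := excess_hardDist_neg_ge hw0 hw ha0 ha (p := (A s).learned ω) hcon
      exact absurd (this.trans he) (not_le.2 hε)
  rw [Measure.prod_apply hE₁] at hp₁
  rw [Measure.prod_apply hE₂] at hp₂
  have hsum := add_le_add hp₁ hp₂
  rw [← lintegral_add_left (measurable_measure_prodMk_left hE₁),
    ← ENNReal.ofReal_add (by norm_num) (by norm_num)] at hsum
  have hfin := hsum.trans (lintegral_mono hslice)
  rw [lintegral_const, measure_univ, mul_one, ENNReal.ofReal_le_ofReal_iff'] at hfin
  -- From `3/4 + 3/4 ≤ 8/3 - 4/3 ρ ^ N`. Squaring and Bernoulli's inequality give `1 - 4 N a² ≤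
  -- 49/64`.
  have hpow : ρ ^ N ≤ 7 / 8 := by
    rcases hfin with h | h <;> linarith
  have hpow2 : (1 - 4 * a ^ 2) ^ N ≤ 49 / 64 := by
    rw [← hρ, ← pow_mul, mul_comm, pow_mul]
    calc (ρ ^ N) ^ 2 ≤ (7 / 8) ^ 2 := pow_le_pow_left₀ (by positivity) hpow 2
      _ = _ := by norm_num
  have hber := one_add_mul_le_pow (by linarith : -2 ≤ -(4 * a ^ 2)) N
  rw [← sub_eq_add_neg] at hber
  have hNa : 15 / 256 ≤ N * a ^ 2 := by linarith
  have hN0 : 0 < N := by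
    rcases N.eq_zero_or_pos with h | h
    · rw [h] at hNa
      norm_num at hNa
    · exact h
  have hn : (N : ℝ) ≤ n := Nat.floor_le (by
    by_contra! hcon
    exact hN0.ne' (Nat.floor_of_nonpos hcon.le))
  refine le_trans ?_ hn
  rw [mul_one_div, div_le_iff₀ (by positivity)]
  exact hNa

end Distinguish

/-! ### Minimax lower bounds -/

section Lower

theorem massart_hardDist {w a τ : ℝ} (hw0 : 0 ≤ w) (hw : w = 1) (hτ : 0 < τ)
    (hτa : τ < |a|) (ha : |a| ≤ 1 / 2) : Massart (hardDist w a) (hardFun a) τ := by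
  refine ⟨hτ, ?_⟩
  have h1 : true ∉ {x | |hardFun a x - 1 / 2| ≤ τ} := by simpa [hardFun] using hτa
  rw [fst_hardDist_apply hw0 ha, Set.indicator_of_notMem h1, hw]
  simp

/-- Mass `w` at distance `|a|` from `1/2` is critical at `τ = |a|`, where `w = 2 ^ β |a| ^ β ≤ c |a|
^ β`. The rest sits at distance `1/2`, where `c τ ^ β` is already at least one. -/
theorem tsybakov_hardDist {w a β c : ℝ} (hw0 : 0 ≤ w) (hβ : 0 ≤ β)
    (hc : 2 ^ β ≤ c) (ha0 : a ≠ 0) (ha : |a| ≤ 1 / 2) (hwa : w = (2 * |a|) ^ β) :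
    Tsybakov (hardDist w a) (hardFun a) β c := by
  have h2 : (0 : ℝ) < 2 ^ β := Real.rpow_pos_of_pos two_pos β
  have ha0' : 0 < |a| := abs_pos.2 ha0
  have hc0 : 0 < c := h2.trans_le hc
  have hw : w ≤ 1 := by
    rw [hwa]
    exact Real.rpow_le_one (by positivity) (by linarith) hβ
  have := isProbabilityMeasure_hardDist hw0 hw ha
  refine ⟨hβ, hc0, fun τ hτ => ?_⟩
  rcases lt_or_ge τ (1 / 2) with hτ1 | hτ1
  · have hf : false ∉ {x | |hardFun a x - 1 / 2| ≤ τ} := by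
      simp only [hardFun, Set.mem_ofPred_eq, not_le]
      norm_num
      linarith
    rw [fst_hardDist_apply hw0 ha, Set.indicator_of_notMem hf, mul_zero, add_zero]
    rcases lt_or_ge τ |a| with hτa | hτa
    · have ht : true ∉ {x | |hardFun a x - 1 / 2| ≤ τ} := by simpa [hardFun] using hτa
      rw [Set.indicator_of_notMem ht, mul_zero]
      exact bot_le
    · have ht : true ∈ {x | |hardFun a x - 1 / 2| ≤ τ} := by simpa [hardFun] using hτa
      rw [Set.indicator_of_mem ht, Pi.one_apply, mul_one]
      refine ENNReal.ofReal_le_ofReal ?_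
      rw [hwa, Real.mul_rpow two_pos.le ha0'.le]
      have := Real.rpow_le_rpow ha0'.le hτa hβ
      gcongr
  · calc (hardDist w a).fst {x | |hardFun a x - 1 / 2| ≤ τ} ≤ 1 := prob_le_one
      _ = ENNReal.ofReal 1 := ENNReal.ofReal_one.symm
      _ ≤ ENNReal.ofReal (c * τ ^ β) := ENNReal.ofReal_le_ofReal (by
        calc (1 : ℝ) = (2 * (1 / 2)) ^ β := by norm_num
          _ = 2 ^ β * (1 / 2) ^ β := Real.mul_rpow two_pos.le (by norm_num)
          _ ≤ c * τ ^ β := by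
            have := Real.rpow_le_rpow (by norm_num) hτ1 hβ
            gcongr)

theorem massart_lower {τ₀ ε : ℝ} (hτ : 0 < τ₀) (hτ1 : τ₀ < 1 / 2) (hε : ε ≤ τ₀) :
    ∃ (X : Type) (_ : MeasurableSpace X) (F : Set (X → ℝ)) (O : History X → X → ℝ),
      IsRegressionClass F O ∧ pdim F ≤ 1 ∧ (∀ γ : ℝ, 0 < γ → theta F γ ≤ 1) ∧
      ∀ (U : Type u) [MeasurableSpace U] (ν : Measure U) [IsProbabilityMeasure ν]
        (A : U → ActiveLearner X) (n : ℝ),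
        (∀ (D : Measure (X × Bool)) [IsProbabilityMeasure D], ∀ η ∈ F, IsCondProb D η →
          Massart D η τ₀ → RandLearnerSucceedsWithProb ν A D η ε n (3 / 4)) →
        1 / 100 * (1 / τ₀ ^ 2) ≤ n := by
  -- The bias must strictly exceed `τ₀` for the Massart condition, yet be of the same order. With
  -- all mass on the ambiguous point, `ε ≤ τ₀ < a` is the required gap.
  set a := min (2 * τ₀) (1 / 2) with ha
  have ha1 : a ≤ 1 / 2 := min_le_right _ _
  have ha2 : a ≤ 2 * τ₀ := min_le_left _ _
  have hτa : τ₀ < a := lt_min (by linarith) hτ1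
  have ha0 : 0 < a := hτ.trans hτa
  have habs : |a| = a := abs_of_pos ha0
  have habs' : |-a| = a := by rw [abs_neg, habs]
  refine ⟨Bool, inferInstance, hardClass a, hardOracle a, isRegressionClass_hardClass ha0.le ha1,
    pdim_hardClass_le a, fun γ hγ => theta_hardClass_le a hγ, fun U _ ν _ A n h => ?_⟩
  have := isProbabilityMeasure_hardDist zero_le_one le_rfl (habs.trans_le ha1)
  have := isProbabilityMeasure_hardDist zero_le_one le_rfl (habs'.trans_le ha1)
  have key := labels_ge_of_succeedsWithProb (ε := ε) (n := n) zero_le_one le_rfl ha0 ha1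
    (by linarith)
    (h _ _ (Or.inl rfl) (isCondProb_hardDist zero_le_one (habs.trans_le ha1))
      (massart_hardDist zero_le_one rfl hτ (by rwa [habs]) (habs.trans_le ha1)))
    (h _ _ (Or.inr rfl) (isCondProb_hardDist zero_le_one (habs'.trans_le ha1))
      (massart_hardDist zero_le_one rfl hτ (by rwa [habs']) (habs'.trans_le ha1)))
  refine le_trans ?_ key
  calc 1 / 100 * (1 / τ₀ ^ 2) ≤ 15 / 256 * (1 / (2 * τ₀) ^ 2) := by
        rw [mul_one_div, mul_one_div, div_le_div_iff₀ (by positivity) (by positivity)]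
        nlinarith [pow_pos hτ 2]
    _ ≤ 15 / 256 * (1 / a ^ 2) := by gcongr

theorem tsybakov_lower {β c ε : ℝ} (hβ : 0 ≤ β) (hc : 2 ^ β ≤ c) (hε0 : 0 < ε) (hε : ε ≤ 1 / 4) :
    ∃ (X : Type) (_ : MeasurableSpace X) (F : Set (X → ℝ)) (O : History X → X → ℝ),
      IsRegressionClass F O ∧ pdim F ≤ 1 ∧ (∀ γ : ℝ, 0 < γ → theta F γ ≤ 1) ∧
      ∀ (U : Type u) [MeasurableSpace U] (ν : Measure U) [IsProbabilityMeasure ν]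
        (A : U → ActiveLearner X) (n : ℝ),
        (∀ (D : Measure (X × Bool)) [IsProbabilityMeasure D], ∀ η ∈ F, IsCondProb D η →
          Tsybakov D η β c → RandLearnerSucceedsWithProb ν A D η ε n (3 / 4)) →
        1 / 100 * (1 / ε) ^ (2 / (1 + β)) ≤ n := by
  have hβ1 : 0 < 1 + β := by linarith
  -- With bias `a = b / 2` and mass `w = b ^ β` the loss `a w = b ^ (1 + β) / 2 = 2 ε` exceeds `ε`,
  -- while `a` is as small as the Tsybakov condition permits, up to constants.
  set b := (4 * ε) ^ (1 / (1 + β)) with hb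
  have hb0 : 0 < b := by positivity
  have hb1 : b ≤ 1 := Real.rpow_le_one (by positivity) (by linarith) (by positivity)
  have hbpow : b ^ (1 + β) = 4 * ε := by
    rw [hb, ← Real.rpow_mul (by positivity), one_div, inv_mul_cancel₀ hβ1.ne', Real.rpow_one]
  have hbsq : b ^ 2 = (4 * ε) ^ (2 / (1 + β)) := by
    rw [hb, ← Real.rpow_natCast, ← Real.rpow_mul (by positivity)]
    congr 1
    push_cast
    ring
  set a := b / 2 with ha
  have ha0 : 0 < a := by positivity
  have ha1 : a ≤ 1 / 2 := by linarith
  have habs : |a| = a := abs_of_pos ha0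
  have habs' : |-a| = a := by rw [abs_neg, habs]
  have h2a : 2 * a = b := by rw [ha]; ring
  set w := b ^ β with hw
  have hw0 : 0 ≤ w := by positivity
  have hw1 : w ≤ 1 := Real.rpow_le_one hb0.le hb1 hβ
  have haw : ε < a * w := by
    rw [Real.rpow_add hb0, Real.rpow_one, ← hw] at hbpow
    have : a * w = 2 * ε := by rw [ha]; linarith
    linarith
  refine ⟨Bool, inferInstance, hardClass a, hardOracle a, isRegressionClass_hardClass ha0.le ha1,
    pdim_hardClass_le a, fun γ hγ => theta_hardClass_le a hγ, fun U _ ν _ A n h => ?_⟩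
  have := isProbabilityMeasure_hardDist hw0 hw1 (habs.trans_le ha1)
  have := isProbabilityMeasure_hardDist hw0 hw1 (habs'.trans_le ha1)
  have key := labels_ge_of_succeedsWithProb (ε := ε) (n := n) hw0 hw1 ha0 ha1 haw
    (h _ _ (Or.inl rfl) (isCondProb_hardDist hw0 (habs.trans_le ha1))
      (tsybakov_hardDist hw0 hβ hc ha0.ne' (habs.trans_le ha1) (by rw [habs, h2a])))
    (h _ _ (Or.inr rfl) (isCondProb_hardDist hw0 (habs'.trans_le ha1))
      (tsybakov_hardDist hw0 hβ hc (neg_ne_zero.2 ha0.ne') (habs'.trans_le ha1)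
        (by rw [habs', h2a])))
  refine le_trans ?_ key
  have e1 : 1 / a ^ 2 = 4 * (1 / b ^ 2) := by rw [ha]; field_simp; norm_num
  have hexp : 2 / (1 + β) ≤ 2 := by
    rw [div_le_iff₀ hβ1]
    linarith
  have h4 : (4 : ℝ) ^ (2 / (1 + β)) ≤ 16 := by
    calc (4 : ℝ) ^ (2 / (1 + β)) ≤ 4 ^ (2 : ℝ) :=
          Real.rpow_le_rpow_of_exponent_le (by norm_num) hexp
      _ = 16 := by norm_num
  have hεp : 0 < ε ^ (2 / (1 + β)) := by positivity
  rw [e1, hbsq, Real.mul_rpow (by norm_num) hε0.le, one_div ε, Real.inv_rpow hε0.le, ← one_div]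
  calc 1 / 100 * (1 / ε ^ (2 / (1 + β))) ≤ 15 / 256 * (4 * (1 / (16 * ε ^ (2 / (1 + β))))) := by
        rw [mul_comm (16 : ℝ), ← div_div]
        have : 0 ≤ 1 / ε ^ (2 / (1 + β)) := by positivity
        linarith
    _ ≤ _ := by gcongr

end Lower

end ActiveLearning

theorem mainTheorem5 :
    ∃ C₁ C₂ C₃ c₀ : ℝ, 0 < C₁ ∧ 0 < C₂ ∧ 0 < C₃ ∧ 0 < c₀ ∧
    -- upper bound under Massart noise, with abstention parameter `τ₀`
    (∀ (X : Type u) [MeasurableSpace X] (D : Measure (X × Bool)) [IsProbabilityMeasure D]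
        (F : Set (X → ℝ)) (O : History X → X → ℝ) (η : X → ℝ) (d : ℕ) (θ τ₀ ε δ : ℝ),
        IsRegressionClass F O → η ∈ F → IsCondProb D η →
        1 ≤ d → pdim F ≤ d → theta F τ₀ ≤ ENNReal.ofReal θ →
        0 < ε → ε < 1 → 0 < δ → δ < 1 →
        Massart D η τ₀ →
        τ₀ ∈ Set.Ioo (0 : ℝ) (1 / 2) ∧
        (algorithm F O ⟨C₁, C₂, d, θ, ε, τ₀, δ⟩).SucceedsWithProb D η ε
          (C₃ * (θ * d) * (1 / τ₀ ^ 2) * Real.log (θ * d / (ε * τ₀)) ^ 2 *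
            Real.log (θ * d / (ε * τ₀ * δ)))
          (1 - 2 * δ)) ∧
    -- upper bound under Tsybakov noise, with abstention parameter `(ε / (2 c)) ^ (1 / (1 + β))`
    (∀ (X : Type u) [MeasurableSpace X] (D : Measure (X × Bool)) [IsProbabilityMeasure D]
        (F : Set (X → ℝ)) (O : History X → X → ℝ) (η : X → ℝ) (d : ℕ) (θ β c ε δ γ : ℝ),
        γ = (ε / (2 * c)) ^ (1 / (1 + β)) →
        IsRegressionClass F O → η ∈ F → IsCondProb D η →
        1 ≤ d → pdim F ≤ d → theta F γ ≤ ENNReal.ofReal θ →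
        0 < ε → ε < 1 → 0 < δ → δ < 1 →
        Tsybakov D η β c →
        γ ∈ Set.Ioo (0 : ℝ) (1 / 2) ∧
        (algorithm F O ⟨C₁, C₂, d, θ, ε / 2, γ, δ⟩).SucceedsWithProb D η ε
          (C₃ * (θ * d) * (2 * c / ε) ^ (2 / (1 + β)) * Real.log (θ * d / (ε * γ)) ^ 2 *
            Real.log (θ * d / (ε * γ * δ)))
          (1 - 2 * δ)) ∧
    -- minimax lower bound under Massart noise, for every active learner
    (∀ τ₀ ε : ℝ, 0 < τ₀ → τ₀ < 1 / 2 → 0 < ε → ε ≤ τ₀ →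
        ∃ (X : Type) (_ : MeasurableSpace X) (F : Set (X → ℝ)) (O : History X → X → ℝ),
          IsRegressionClass F O ∧ pdim F ≤ 1 ∧ (∀ γ : ℝ, 0 < γ → theta F γ ≤ 1) ∧
          ∀ (U : Type u) [MeasurableSpace U] (ν : Measure U) [IsProbabilityMeasure ν]
            (A : U → ActiveLearner X) (n : ℝ),
            (∀ (D : Measure (X × Bool)) [IsProbabilityMeasure D], ∀ η ∈ F, IsCondProb D η →
              Massart D η τ₀ → RandLearnerSucceedsWithProb ν A D η ε n (3 / 4)) →
            c₀ * (1 / τ₀ ^ 2) ≤ n) ∧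
    -- minimax lower bound under Tsybakov noise, for every active learner
    (∀ β c ε : ℝ, 0 ≤ β → 2 ^ β ≤ c → 0 < ε → ε ≤ 1 / 4 →
        ∃ (X : Type) (_ : MeasurableSpace X) (F : Set (X → ℝ)) (O : History X → X → ℝ),
          IsRegressionClass F O ∧ pdim F ≤ 1 ∧ (∀ γ : ℝ, 0 < γ → theta F γ ≤ 1) ∧
          ∀ (U : Type u) [MeasurableSpace U] (ν : Measure U) [IsProbabilityMeasure ν]
            (A : U → ActiveLearner X) (n : ℝ),
            (∀ (D : Measure (X × Bool)) [IsProbabilityMeasure D], ∀ η ∈ F, IsCondProb D η →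
              Tsybakov D η β c → RandLearnerSucceedsWithProb ν A D η ε n (3 / 4)) →
            c₀ * (1 / ε) ^ (2 / (1 + β)) ≤ n) := by
  refine ⟨2 ^ 20, 64, 10 ^ 10, 1 / 100, by norm_num, by norm_num, by norm_num, by norm_num,
    ?_, ?_, ?_, ?_⟩
  · intro X _ D _ F O η d θ τ₀ ε δ hR hηF hη hd hpd hθ hε hε1 hδ hδ1 hm
    exact massart_upper hR hηF hη hd hpd hθ hε hε1 hδ hδ1 hm
  · intro X _ D _ F O η d θ β c ε δ γ hγ hR hηF hη hd hpd hθ hε hε1 hδ hδ1 ht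
    exact tsybakov_upper hγ hR hηF hη hd hpd hθ hε hε1 hδ hδ1 ht
  · exact fun τ₀ ε hτ hτ1 _ hε => massart_lower hτ hτ1 hε
  · exact fun β c ε hβ hc hε hε1 => tsybakov_lower hβ hc hε hε1
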